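/- Throughout, $\delta\in\mathbb Z$, $\mathbb N=\{1,2,3,\dots\}$, and $\Lambda$ is the set of all integer partitions (Young diagrams). The box in row $i$ and column $j$ has $\delta$-charge $\delta-1-2(j-i)$. A rim is a skew diagram whose boxes, joined when they share an edge, form a non-empty chain (path). For $\mu\subset\lambda$ the skew $\lambda/\mu$ is a minimal $\delta$-balanced skew if it is the disjoint union of two rims that are exchanged by a rotation by $\pi$ about a point of the line of $\delta$-charge $0$, such that this rotation fixes no row of the skew. The block $[\lambda]_\delta$ is the class of $\lambda$ under the equivalence relation on $\Lambda$ generated by the pairs $(\mu,\nu)$ with $\nu/\mu$ a minimal $\delta$-balanced skew, and the block graph $G_\delta(\lambda)$ is the directed graph with vertex set $[\lambda]_\delta$ and an edge $\mu\to\nu$ whenever $\nu/\mu$ is a minimal $\delta$-balanced skew. $G_{even}$ (resp. $G_{odd}$) is the directed graph whose vertices are the finite subsets of $\mathbb N$ of even (resp. odd) order, with an edge $a\to b$ if $a\setminus b=\{\alpha\}$ and $b\setminus a=\{\alpha+1\}$ for some $\alpha\in\mathbb N$, or if $a\setminus b=\emptyset$ and $b\setminus a=\{1,2\}$. The toggle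 map is $a\mapsto a\,\triangle\,\{1\}$. For $\lambda\in\Lambda$ put $e_\delta(\lambda)=\lambda-\tfrac{\delta}{2}(1,1,1,\dots)-(0,1,2,\dots)\in\mathbb R^{\mathbb N}$, and let $v$ be the sequence obtained from $e_\delta(\lambda)$ by deleting all pairs of terms $x,-x$ (at two distinct places). Let $o(v)$ be the sequence for which $|o(v)_i|$ is the position of $|v_i|$ among the magnitudes of the terms of $v$ in increasing order, and $o(v)_i$ has the sign of $v_i$, except that the sign of a term with $v_i=0$ is chosen so that the number of positive terms is even. Let $u_\delta(\lambda)\subset\mathbb N$ be the set of positive terms of $o(v)$, and let $o_\delta(\lambda)$ be $u_\delta(\lambda)$ if this set is of even order, and $u_\delta(\lambda)\,\triangle\,\{1\}$ otherwise. Let $\mathcal D$ be the group of transformations of $\mathbb R^{\mathbb N}$ generated, for $i<j$, by $(ij)$, which exchanges the $i$-th and $j$-th entries, and $(ij)_-$, which exchanges these entries and changes the sign of both. Alcoves are the connected components of $\mathbb R^{\mathbb N}$ (product topology) minus all hyperplanes $v_i=v_j$ and $v_i=-v_j$, $i<j$; the fundamental alcove is $C'=\{v: v_1>v_2>\cdots,\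 v_1+v_2<0\}$. The vertices of $G_{alc}$ are the dominant alcoves, i.e. the alcoves in the $\mathcal D$-orbit of $C'$ that consist of strictly descending sequences. There is an edge $A\to B$ if the closures of $A$ and $B$ have in common a point that lies on exactly one of the hyperplanes and the number of hyperplanes separating $B$ from $C'$ is one more than that for $A$. Theorem. (a) The toggle map is an isomorphism of directed graphs $G_{odd}\to G_{even}$, and there is an isomorphism $G_{even}\to G_{alc}$ that sends $o_2(\mu)$ to the alcove containing $e_2(\mu)$ for each $\mu\in[\emptyset]_2$. (b) For all $\delta\in\mathbb Z$ and $\lambda\in\Lambda$, the map $o_\delta$ restricts to a bijection from $[\lambda]_\delta$ onto the set of finite subsets of $\mathbb N$ of even order, and this bijection is an isomorphism of directed graphs $G_\delta(\lambda)\cong G_{even}$. If $u_\delta(\lambda)$ is of even order, this isomorphism is $\nu\mapsto u_\delta(\nu)$; if $u_\delta(\lambda)$ is of odd order, then $\nu\mapsto u_\delta(\nu)$ is an isomorphism $G_\delta(\lambda)\cong G_{odd}$, and $o_\delta$ is its composite with the toggle map. (c) For all $\delta\in\mathbb Z$ and $\lambda\in\Lambda$ there is an isomorphism $G_\delta(\lambda)\cong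 G_{alc}$ that sends $\nu$ to the alcove containing $e_2(\mu)$, where $\mu$ is the partition in $[\emptyset]_2$ with $o_2(\mu)=o_\delta(\nu)$. (d) Consequently $G_\delta(\lambda)\cong G_{\delta'}(\lambda')$ for all $\delta,\delta'\in\mathbb Z$ and $\lambda,\lambda'\in\Lambda$. -/

import Mathlib

namespace BrauerBlock

noncomputable section

/-! ### Young diagrams, rims and the block relation

Integer partitions are `YoungDiagram`s; the box in row `i` and column `j` (both counted from `0`)
is the pair `(i, j)`. The plane is `ℝ × ℝ` with coordinates (row, column), rows growing downwards,
and a box is located by its centre, taken at the point `(i, j)`. -/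

/-- A finite set of boxes is a skew if it is the difference of two nested Young diagrams. -/
def IsSkew (R : Finset (ℕ × ℕ)) : Prop :=
  ∃ μ ν : YoungDiagram, μ ≤ ν ∧ R = ν.cells \ μ.cells

/-- The dual graph of a set of boxes: two boxes are joined when they have a common edge. -/
def dualGraph (R : Finset (ℕ × ℕ)) : SimpleGraph R :=
  SimpleGraph.fromRel fun a b =>
    (a.1.1 = b.1.1 ∧ a.1.2 + 1 = b.1.2) ∨ (a.1.2 = b.1.2 ∧ a.1.1 + 1 = b.1.1)

/-- A rim is a skew whose dual graph is a (nonempty) chain. -/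
def IsRim (R : Finset (ℕ × ℕ)) : Prop :=
  IsSkew R ∧ ∃ n : ℕ, Nonempty (dualGraph R ≃g SimpleGraph.pathGraph (n + 1))

/-- The centre of a box, as a point of the plane. -/
def centre (b : ℕ × ℕ) : ℝ × ℝ := ((b.1 : ℝ), (b.2 : ℝ))

/-- The `δ`-charge `δ - 1 - 2 (column - row)`, extended from box centres to all points of the
plane. -/
def charge (δ : ℤ) (x : ℝ × ℝ) : ℝ := (δ : ℝ) - 1 - 2 * (x.2 - x.1)

/-- The rotation of the plane by `π` about the point `c`. -/
def piRotation (c x : ℝ × ℝ) : ℝ × ℝ := (2 * c.1 - x.1, 2 * c.2 - x.2)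

/-- The skew `ν / μ` is a minimal `δ`-balanced skew: it is a pair of rims that are exchanged by
a `π`-rotation about a point `c` of the `δ`-charge-`0` diagonal, and no row of the skew is fixed
by this rotation (that is, `c` is not on the mid-line of any row that meets the skew). -/
def IsMinBalancedSkew (δ : ℤ) (μ ν : YoungDiagram) : Prop :=
  μ ≤ ν ∧ ∃ R R' : Finset (ℕ × ℕ),
    IsRim R ∧ IsRim R' ∧ Disjoint R R' ∧ ν.cells \ μ.cells = R ∪ R' ∧
    ∃ c : ℝ × ℝ, charge δ c = 0 ∧
      piRotation c '' (centre '' (R : Set (ℕ × ℕ))) = centre '' (R' : Set (ℕ × ℕ)) ∧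
      ∀ b ∈ ν.cells \ μ.cells, (piRotation c (centre b)).1 ≠ (centre b).1

/-- The strict order `<^δ`: the transitive closure of "`ν / μ` is a minimal `δ`-balanced skew". -/
def ltDelta (δ : ℤ) : YoungDiagram → YoungDiagram → Prop :=
  Relation.TransGen (IsMinBalancedSkew δ)

/-- The block `[λ]_δ`: the class of `λ` for the reflexive-symmetric-transitive closure of
`<^δ`. -/
def block (δ : ℤ) (lam : YoungDiagram) : Set YoungDiagram :=
  {μ | Relation.EqvGen (ltDelta δ) lam μ}

/-- The block graph `G_δ(λ)`: an edge goes from `μ` to `ν` when `ν / μ` is a minimal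
`δ`-balanced skew. -/
def blockGraph (δ : ℤ) (lam : YoungDiagram) : Digraph (block δ lam) where
  Adj μ ν := IsMinBalancedSkew δ μ ν

/-! ### The graphs on subsets of `{1, 2, 3, …}` -/

/-- Subsets of `{1, 2, 3, …}` of even (finite) order. -/
def evenSubsets : Set (Set ℕ+) := {a | a.Finite ∧ Even a.ncard}

/-- Subsets of `{1, 2, 3, …}` of odd (finite) order. -/
def oddSubsets : Set (Set ℕ+) := {a | a.Finite ∧ Odd a.ncard}

/-- Edge labels: a number `α`, or the symbol `12`. -/
inductive EdgeLabel
  | num (α : ℕ+)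
  | oneTwo

/-- `a → b` with the given label. -/
def LabelledEdge : EdgeLabel → Set ℕ+ → Set ℕ+ → Prop
  | .num α, a, b => a \ b = {α} ∧ b \ a = {α + 1}
  | .oneTwo, a, b => a \ b = ∅ ∧ b \ a = {1, 2}

/-- The graph `G_even`. -/
def graphEven : Digraph evenSubsets where
  Adj a b := ∃ l, LabelledEdge l a b

/-- The graph `G_odd`. -/
def graphOdd : Digraph oddSubsets where
  Adj a b := ∃ l, LabelledEdge l a b

/-- Toggling the presence of `1`. -/
def toggle (a : Set ℕ+) : Set ℕ+ := symmDiff a {1}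

/-! ### The map `o_δ`

Sequences are indexed from `0`, so that the `i`-th entry here is the `(i+1)`-st entry in
one-based numbering. -/

/-- `e_δ(λ) = λ + ρ_δ` with `ρ_δ = -(δ/2)(1,1,…) - (0,1,2,…)`. -/
def eMap (δ : ℤ) (lam : YoungDiagram) : ℕ → ℝ :=
  fun i => (lam.rowLen i : ℝ) - (δ : ℝ) / 2 - (i : ℝ)

/-- `Reg`: the subsequence left after the removal of all doubletons, that is of all pairs of terms
(at two distinct places) of the form `x, -x`. -/
def regularize (v : ℕ → ℝ) : ℕ → ℝ :=
  fun n => v (Nat.nth (fun i => ∀ j, j ≠ i → v j ≠ -v i) n)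

/-- The map `o` on regular, strongly descending sequences: `|o(v)_i|` is the position (from `1`) of
`v_i` in the magnitude ordering of the terms of `v`; the sign of `o(v)_i` is that of `v_i`, except
that for `v_i = 0` it is chosen so as to make the number of positive terms even. -/
def signedRank (v : ℕ → ℝ) : ℕ → ℤ := fun i =>
  if 0 < v i ∨ (v i = 0 ∧ Odd {j | 0 < v j}.ncard) then
    ({j | |v j| ≤ |v i|}.ncard : ℤ)
  else
    -({j | |v j| ≤ |v i|}.ncard : ℤ)

/-- The set of positive terms of an integer sequence. -/
def positiveTerms (w : ℕ → ℤ) : Set ℕ+ := {n | ∃ i, w i = ((n : ℕ) : ℤ)}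

/-- The positive terms of `o(Reg(e_δ(λ)))`, before any toggling. -/
def untoggled (δ : ℤ) (lam : YoungDiagram) : Set ℕ+ :=
  positiveTerms (signedRank (regularize (eMap δ lam)))

open Classical in
/-- The map `o_δ`: the positive terms of `o(Reg(e_δ(λ)))`, with the presence of `1` toggled if this
set is of odd order. -/
def oMap (δ : ℤ) (lam : YoungDiagram) : Set ℕ+ :=
  if Odd (untoggled δ lam).ncard then toggle (untoggled δ lam) else untoggled δ lam

/-! ### The dominant alcove graph

`ℕ → ℝ` carries the product topology. -/

/-- The reflection `(ij)`, exchanging the entries `v i` and `v j`. -/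
def reflPlus (i j : ℕ) : Equiv.Perm (ℕ → ℝ) :=
  Function.Involutive.toPerm (fun v k => v (Equiv.swap i j k)) (by
    intro v; funext k; simp)

/-- The reflection `(ij)_-`, exchanging the entries `v i` and `v j` and changing the sign of
both. -/
def reflMinus (i j : ℕ) : Equiv.Perm (ℕ → ℝ) :=
  Function.Involutive.toPerm
    (fun v k => if k = i ∨ k = j then -v (Equiv.swap i j k) else v k) (by
    intro v; funext k
    by_cases hi : k = i
    · subst hi; simp
    · by_cases hj : k = j
      · subst hj; simp
      · simp [hi, hj])

/-- The reflection group `𝒟` generated by all `(ij)` and `(ij)_-` with `i < j`. -/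
def groupD : Subgroup (Equiv.Perm (ℕ → ℝ)) :=
  Subgroup.closure {s | ∃ i j, i < j ∧ (s = reflPlus i j ∨ s = reflMinus i j)}

/-- The reflection hyperplanes of the reflections `(ij)` and `(ij)_-`, `i < j`. -/
def hyperplanes : Set (Set (ℕ → ℝ)) :=
  {H | ∃ i j, i < j ∧ (H = {v | v i = v j} ∨ H = {v | v i = -v j})}

/-- An alcove is a connected component of the space with all the hyperplanes removed. -/
def IsAlcove (A : Set (ℕ → ℝ)) : Prop :=
  ∃ x ∈ (⋃₀ hyperplanes)ᶜ, A = connectedComponentIn (⋃₀ hyperplanes)ᶜ x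

/-- The fundamental chamber for the parabolic subgroup generated by the `(ij)`: the strictly
descending sequences. -/
def fundamentalChamber : Set (ℕ → ℝ) := {v | StrictAnti v}

/-- The fundamental alcove: the part of the fundamental chamber bounded by the hyperplane of
`(12)_-`, on the side `v₁ + v₂ < 0`, which contains `(-1, -2, -3, …)`. -/
def fundamentalAlcove : Set (ℕ → ℝ) := {v | StrictAnti v ∧ v 0 + v 1 < 0}

/-- The dominant alcoves of the reflection group `𝒟`: the alcoves in the `𝒟`-orbit of the
fundamental alcove that lie in the fundamental chamber. -/
def dominantAlcoves : Set (Set (ℕ → ℝ)) :=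
  {A | IsAlcove A ∧ (∃ w ∈ groupD, A = w '' fundamentalAlcove) ∧ A ⊆ fundamentalChamber}

/-- The hyperplane `H` separates the alcoves `A` and `B`. -/
def Separates (H A B : Set (ℕ → ℝ)) : Prop :=
  ∀ a ∈ A, ∀ b ∈ B, (segment ℝ a b ∩ H).Nonempty

/-- The length of an alcove: the number of hyperplanes separating it from the fundamental alcove. -/
def alcoveLength (A : Set (ℕ → ℝ)) : ℕ :=
  {H | H ∈ hyperplanes ∧ Separates H fundamentalAlcove A}.ncard

/-- The closures of `A` and `B` meet in a wall: their intersection contains a point of some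
hyperplane `H` that is on no other hyperplane. -/
def ShareWall (A B : Set (ℕ → ℝ)) : Prop :=
  ∃ H ∈ hyperplanes, (closure A ∩ closure B ∩ (H \ ⋃₀ (hyperplanes \ {H}))).Nonempty

/-- The dominant alcove graph `G_alc`: adjacent alcoves are joined, and edges are directed away
from the fundamental alcove. -/
def graphAlc : Digraph dominantAlcoves where
  Adj A B := ShareWall A B ∧ alcoveLength B = alcoveLength A + 1

/-- Isomorphisms of directed graphs. -/
abbrev DigraphIso {V W : Type*} (G : Digraph V) (H : Digraph W) := G.Adj ≃r H.Adj

end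

end BrauerBlock

namespace BrauerBlock

/-! ### Bead sequences and diagonal heights -/

/-! A Young diagram is encoded by its beads `rowLen i - i`, a strictly descending sequence of
integers which is e_δ up to a constant shift. Adding a rim amounts to moving one bead to the right.
A rotation by π about a point of the charge-0 diagonal sends content c to δ - 1 - c and so acts on
bead places by c ↦ δ - c. Hence a minimal δ-balanced skew replaces beads p and δ - q by q and δ - p,
where the configuration in between is symmetric; the condition on fixed rows governs what happens at
the fixed place δ/2 (`isMinBalancedSkew_iff`).

In terms of the doubled entries 2b - δ the reflection becomes a change of sign. Nonzero magnitudes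
that occur with both signs are removed by `regularize` and never change; every other magnitude that
occurs carries one sign. A minimal balanced skew changes the signs of two consecutive single
magnitudes: the larger from - to +, the smaller from + to -, or from - to + if it is the least one.
After passing to ranks this is an edge of the subset graph (`isMinBalancedSkew_iff_labelledEdge`).
The paired magnitudes, the single magnitudes and the parity of the pattern are therefore invariants
of a block. They are complete: every finite pattern of the right parity is realized
(`exists_untoggled_eq`), and every pattern descends along edges to ∅ or {1} (`exists_predecessor`).
This gives `mem_block_iff`, and with it the isomorphisms with G_even and G_odd.

On the alcove side, a dominant alcove is determined by the signs of the sums v_i + v_j. If s lists n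
for n ∈ a and -n for n ∉ a in descending order, the length of its alcove is the number of pairs with
positive sum, and edges of G_alc are the additions of a single pair. Row i of `posPairs s` has s_i -
1 elements if s_i > 0 and none otherwise (`IsSignedSeq.ncard_row`), so the pairs determine a except
for the presence of 1, which is restored by evenness. Hence edges of G_alc and of G_even agree
(`adj_alcoveOf_iff`). Finally e_2(∅) = (-1, -2, -3, …) has no cancelling terms, so on the block of ∅
for δ = 2 the sequence e_2(μ) is itself the signed sequence of its set and lies in the right alcove;
the other blocks are reached through G_even. -/

/-- The `i`-th bead of a Young diagram. -/
def bead (μ : YoungDiagram) (i : ℕ) : ℤ := (μ.rowLen i : ℤ) - i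

/-- The set of beads of a Young diagram. -/
def beadSet (μ : YoungDiagram) : Set ℤ := Set.range (bead μ)

theorem bead_strictAnti (μ : YoungDiagram) : StrictAnti (bead μ) := by
  intro i j hij
  have := μ.rowLen_anti i j hij.le
  simp only [bead]
  omega

/-- A strictly monotone sequence is determined by its range; the order dual turns descending into
ascending. -/
theorem bead_eq_of_beadSet_eq {μ ν : YoungDiagram} (h : beadSet μ = beadSet ν) :
    bead μ = bead ν := by
  have := StrictMono.range_inj (f := fun i => OrderDual.toDual (bead μ i))
    (g := fun i => OrderDual.toDual (bead ν i)) (bead_strictAnti μ) (bead_strictAnti ν)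
  exact this.1 h

theorem eq_of_rowLen_eq {μ ν : YoungDiagram} (h : ∀ i, μ.rowLen i = ν.rowLen i) : μ = ν := by
  ext ⟨i, j⟩
  rw [YoungDiagram.mem_cells, YoungDiagram.mem_cells, YoungDiagram.mem_iff_lt_rowLen,
    YoungDiagram.mem_iff_lt_rowLen, h]

theorem eq_of_beadSet_eq {μ ν : YoungDiagram} (h : beadSet μ = beadSet ν) : μ = ν := by
  refine eq_of_rowLen_eq fun i => ?_
  have := congrFun (bead_eq_of_beadSet_eq h) i
  simp only [bead] at this
  omega

theorem exists_bead_le (μ : YoungDiagram) (c : ℤ) : ∃ i, bead μ i ≤ c := by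
  refine ⟨μ.rowLen 0 + c.natAbs, ?_⟩
  have := μ.rowLen_anti 0 (μ.rowLen 0 + c.natAbs) (Nat.zero_le _)
  simp only [bead]
  omega

open Classical in
/-- The number of beads greater than `c`; equivalently, the row below the last box of content `c`. -/
noncomputable def height (μ : YoungDiagram) (c : ℤ) : ℕ := Nat.find (exists_bead_le μ c)

/-- Beads descend, so those above c form an initial segment of the indices. Nearly every property of
heights below is read off from this equivalence. -/
theorem lt_height_iff {μ : YoungDiagram} {c : ℤ} {i : ℕ} : i < height μ c ↔ c < bead μ i := by
  classical
  unfold height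
  rw [Nat.lt_find_iff]
  constructor
  · intro h
    exact not_le.1 (h i le_rfl)
  · intro h m hm
    exact not_le.2 (h.trans_le ((bead_strictAnti μ).antitone hm))

theorem mem_iff_lt_height {μ : YoungDiagram} {i j : ℕ} :
    (i, j) ∈ μ ↔ i < height μ ((j : ℤ) - i) := by
  rw [lt_height_iff, YoungDiagram.mem_iff_lt_rowLen, bead]
  omega

theorem height_antitone (μ : YoungDiagram) : Antitone (height μ) := by
  intro c d h
  refine le_of_forall_lt fun i hi => ?_
  rw [lt_height_iff] at hi ⊢
  omega

/-- Lowering the threshold from c to c - 1 admits exactly the bead at c. Thus beads are the unit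
drops of the height function. -/
theorem height_sub_one_of_mem {μ : YoungDiagram} {c : ℤ} (h : c ∈ beadSet μ) :
    height μ (c - 1) = height μ c + 1 := by
  obtain ⟨i, hi⟩ := h
  have h1 : height μ c = i := by
    refine le_antisymm (not_lt.1 fun h => ?_) (not_lt.1 fun h => ?_)
    · rw [lt_height_iff] at h
      omega
    · have h2 := bead_strictAnti μ h
      rw [hi, ← lt_height_iff] at h2
      omega
  have h2 : i < height μ (c - 1) := by
    rw [lt_height_iff]
    omega
  have h3 : ¬ i + 1 < height μ (c - 1) := by
    rw [lt_height_iff]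
    have := bead_strictAnti μ (Nat.lt_succ_self i)
    simp only [Nat.succ_eq_add_one] at this
    omega
  omega

theorem height_sub_one_of_notMem {μ : YoungDiagram} {c : ℤ} (h : c ∉ beadSet μ) :
    height μ (c - 1) = height μ c := by
  refine le_antisymm (le_of_forall_lt fun i hi => ?_) (height_antitone μ (by omega))
  rw [lt_height_iff] at hi ⊢
  have : bead μ i ≠ c := fun h' => h ⟨i, h'⟩
  omega

theorem mem_beadSet_iff {μ : YoungDiagram} {c : ℤ} :
    c ∈ beadSet μ ↔ height μ (c - 1) = height μ c + 1 := by
  refine ⟨height_sub_one_of_mem, fun h => ?_⟩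
  by_contra h'
  have := height_sub_one_of_notMem h'
  omega

theorem height_sub_one_cases (μ : YoungDiagram) (c : ℤ) :
    height μ (c - 1) = height μ c ∨ height μ (c - 1) = height μ c + 1 := by
  by_cases h : c ∈ beadSet μ
  · exact Or.inr (height_sub_one_of_mem h)
  · exact Or.inl (height_sub_one_of_notMem h)

/-- The height also counts the -c rows above the first row that the diagonal of a negative content c
meets. This keeps column indices nonnegative. -/
theorem neg_le_height (μ : YoungDiagram) (c : ℤ) : -c ≤ height μ c := by
  by_contra! h
  have h1 : ¬ height μ c < height μ c := lt_irrefl _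
  rw [lt_height_iff, bead] at h1
  omega

theorem le_iff_height_le {μ ν : YoungDiagram} : μ ≤ ν ↔ ∀ c, height μ c ≤ height ν c := by
  constructor
  · intro h c
    refine le_of_forall_lt fun i hi => ?_
    by_cases hc : i + c < 0
    · have := neg_le_height ν c
      omega
    · have e : ((i + c).toNat : ℤ) - i = c := by omega
      rw [← e] at hi ⊢
      rw [← mem_iff_lt_height] at hi ⊢
      exact h hi
  · rintro h ⟨i, j⟩ hij
    change (i, j) ∈ μ at hij
    rw [mem_iff_lt_height] at hij ⊢
    exact hij.trans_le (h _)

/-- A function with unit steps that agrees with a height function away from a finite interval is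
itself a height function. -/
theorem exists_height_eq (μ : YoungDiagram) (h : ℤ → ℕ) (N : ℕ)
    (hN : ∀ c : ℤ, N < c.natAbs → h c = height μ c)
    (hstep : ∀ c, h (c - 1) = h c ∨ h (c - 1) = h c + 1) :
    ∃ ν : YoungDiagram, ∀ c, height ν c = h c := by
  -- As h drops by at most one per step, h c + c is monotone; the bound then propagates from the far
  -- left, where h is a true height function.
  have hlow : ∀ c : ℤ, -c ≤ h c := by
    have hmono : Monotone fun c : ℤ => (h c : ℤ) + c := by
      refine monotone_int_of_le_succ fun c => ?_
      have := hstep (c + 1)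
      rw [add_sub_cancel_right] at this
      omega
    intro c
    have h1 := hmono (show min c (-(N : ℤ) - 1) ≤ c from min_le_left _ _)
    have h2 := hN (min c (-(N : ℤ) - 1)) (by omega)
    have h3 := neg_le_height μ (min c (-(N : ℤ) - 1))
    simp only at h1
    omega
  -- A box of the new shape is either a box of `μ` or on one of the finitely many diagonals with
  -- content in [-N, N].
  have hfin : {b : ℕ × ℕ | b.1 < h ((b.2 : ℤ) - b.1)}.Finite := by
    refine (μ.cells.finite_toSet.union ((Set.finite_Icc (-(N : ℤ)) N).biUnion fun c _ =>
      ((Finset.range (h c)).finite_toSet.image fun i : ℕ => (i, (i + c).toNat)))).subset ?_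
    rintro ⟨i, j⟩ hij
    simp only [Set.mem_ofPred_eq] at hij
    by_cases hc : N < ((j : ℤ) - i).natAbs
    · left
      rw [hN _ hc, ← mem_iff_lt_height] at hij
      exact hij
    · right
      refine Set.mem_biUnion (x := (j : ℤ) - i) (by simp only [Set.mem_Icc]; omega) ?_
      exact ⟨i, by simpa using hij, by simp⟩
  have hanti : Antitone h := antitone_int_of_succ_le fun c => by
    have := hstep (c + 1)
    rw [add_sub_cancel_right] at this
    omega
  -- Going up k rows raises the content by k, and h loses at most k. This gives closure under moving
  -- up; `hanti` gives closure under moving left.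
  have hcol : ∀ (c : ℤ) (k : ℕ), h c ≤ h (c + k) + k := by
    intro c k
    induction k with
    | zero => simp
    | succ k ih =>
      have := hstep (c + (k + 1 : ℕ))
      rw [show c + ((k + 1 : ℕ) : ℤ) - 1 = c + k by push_cast; ring] at this
      omega
  let ν : YoungDiagram :=
    { cells := hfin.toFinset
      isLowerSet := by
        rintro ⟨i, j⟩ ⟨i', j'⟩ hle hmem
        simp only [Prod.mk_le_mk] at hle
        simp only [Set.Finite.coe_toFinset, Set.mem_ofPred_eq] at hmem ⊢
        have h1 := hcol ((j : ℤ) - i) (i - i')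
        have h2 := hanti (show (j' : ℤ) - i' ≤ (j : ℤ) - i + (i - i' : ℕ) by omega)
        omega }
  have hν : ∀ i j : ℕ, (i, j) ∈ ν ↔ i < h ((j : ℤ) - i) := by
    intro i j
    rw [← YoungDiagram.mem_cells]
    simp [ν]
  refine ⟨ν, fun c => ?_⟩
  refine eq_of_forall_lt_iff fun i => ?_
  by_cases hc : i + c < 0
  · have := neg_le_height ν c
    have := hlow c
    constructor <;> intro <;> omega
  · have e : ((i + c).toNat : ℤ) - i = c := by omega
    rw [← e, ← mem_iff_lt_height, hν]

/-- Moving one bead to the right adds one box on each diagonal that it crosses. -/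
theorem exists_move_right (μ : YoungDiagram) {p q : ℤ} (hpq : p < q) (hp : p ∈ beadSet μ)
    (hq : q ∉ beadSet μ) :
    ∃ ν : YoungDiagram, (∀ c, height ν c = height μ c + if p ≤ c ∧ c < q then 1 else 0) ∧
      ∀ c, c ∈ beadSet ν ↔ (c ∈ beadSet μ ∧ c ≠ p) ∨ c = q := by
  have hp' := height_sub_one_of_mem hp
  have hq' := height_sub_one_of_notMem hq
  obtain ⟨ν, hν⟩ := exists_height_eq μ
    (fun c => height μ c + if p ≤ c ∧ c < q then 1 else 0) (p.natAbs + q.natAbs)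
    (by
      intro c hc
      rw [if_neg (by omega), add_zero])
    (by
      intro c
      rcases eq_or_ne c p with rfl | h1
      · rw [if_neg (by omega), if_pos (by omega)]
        omega
      rcases eq_or_ne c q with rfl | h2
      · rw [if_pos (by omega), if_neg (by omega)]
        omega
      have := height_sub_one_cases μ c
      by_cases h3 : p ≤ c ∧ c < q
      · rw [if_pos (by omega), if_pos h3]
        omega
      · rw [if_neg (by omega), if_neg h3]
        omega)
  refine ⟨ν, hν, fun c => ?_⟩
  rw [mem_beadSet_iff, mem_beadSet_iff, hν, hν]
  rcases eq_or_ne c p with rfl | h1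
  · rw [if_neg (by omega), if_pos (by omega)]
    omega
  rcases eq_or_ne c q with rfl | h2
  · rw [if_pos (by omega), if_neg (by omega)]
    omega
  by_cases h3 : p ≤ c ∧ c < q
  · rw [if_pos (by omega), if_pos h3]
    omega
  · rw [if_neg (by omega), if_neg h3]
    omega

/-- Here the heights on [q, p) decrease by one. The truncated subtraction is harmless, since the
bead at p makes every height to its left positive. -/
theorem exists_move_left (μ : YoungDiagram) {p q : ℤ} (hpq : q < p) (hp : p ∈ beadSet μ)
    (hq : q ∉ beadSet μ) :
    ∃ ν : YoungDiagram, ∀ c, c ∈ beadSet ν ↔ (c ∈ beadSet μ ∧ c ≠ p) ∨ c = q := by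
  have hp' := height_sub_one_of_mem hp
  have hq' := height_sub_one_of_notMem hq
  have hpos : ∀ c, c < p → 0 < height μ c := fun c hc => by
    have := height_antitone μ (show c ≤ p - 1 by omega)
    omega
  obtain ⟨ν, hν⟩ := exists_height_eq μ
    (fun c => height μ c - if q ≤ c ∧ c < p then 1 else 0) (p.natAbs + q.natAbs)
    (by
      intro c hc
      rw [if_neg (by omega), Nat.sub_zero])
    (by
      intro c
      have := hpos c
      have := hpos (c - 1)
      rcases eq_or_ne c p with rfl | h1
      · rw [if_pos (by omega), if_neg (by omega)]
        omega
      rcases eq_or_ne c q with rfl | h2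
      · rw [if_neg (by omega), if_pos (by omega)]
        omega
      have := height_sub_one_cases μ c
      by_cases h3 : q ≤ c ∧ c < p
      · rw [if_pos (by omega), if_pos h3]
        omega
      · rw [if_neg (by omega), if_neg h3]
        omega)
  refine ⟨ν, fun c => ?_⟩
  rw [mem_beadSet_iff, mem_beadSet_iff, hν, hν]
  have := hpos c
  have := hpos (c - 1)
  rcases eq_or_ne c p with rfl | h1
  · rw [if_pos (by omega), if_neg (by omega)]
    omega
  rcases eq_or_ne c q with rfl | h2
  · rw [if_neg (by omega), if_pos (by omega)]
    omega
  by_cases h3 : q ≤ c ∧ c < p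
  · rw [if_pos (by omega), if_pos h3]
    omega
  · rw [if_neg (by omega), if_neg h3]
    omega

/-- Any bead may be moved to any free place. -/
theorem exists_move (μ : YoungDiagram) {p q : ℤ} (hp : p ∈ beadSet μ) (hq : q ∉ beadSet μ) :
    ∃ ν : YoungDiagram, ∀ c, c ∈ beadSet ν ↔ (c ∈ beadSet μ ∧ c ≠ p) ∨ c = q := by
  rcases lt_trichotomy p q with h | h | h
  · obtain ⟨ν, -, hν⟩ := exists_move_right μ h hp hq
    exact ⟨ν, hν⟩
  · exact absurd (h ▸ hp) hq
  · exact exists_move_left μ h hp hq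

end BrauerBlock

namespace BrauerBlock

/-! ### Rims -/

theorem dualGraph_adj {R : Finset (ℕ × ℕ)} {a b : R} :
    (dualGraph R).Adj a b ↔
      (a.1.1 = b.1.1 ∧ (a.1.2 + 1 = b.1.2 ∨ b.1.2 + 1 = a.1.2)) ∨
      (a.1.2 = b.1.2 ∧ (a.1.1 + 1 = b.1.1 ∨ b.1.1 + 1 = a.1.1)) := by
  rw [dualGraph, SimpleGraph.fromRel_adj]
  constructor
  · rintro ⟨-, h⟩
    omega
  · intro h
    refine ⟨?_, by omega⟩
    rintro rfl
    omega

/-- A walk on the integers without backtracking is monotone. -/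
theorem eq_add_or_eq_sub_of_steps (w : ℕ → ℤ) (n : ℕ)
    (h1 : ∀ k < n, w (k + 1) = w k + 1 ∨ w (k + 1) = w k - 1)
    (h2 : ∀ k, k + 2 ≤ n → w (k + 2) ≠ w k) :
    (∀ k ≤ n, w k = w 0 + k) ∨ (∀ k ≤ n, w k = w 0 - k) := by
  induction n with
  | zero =>
    left
    intro k hk
    obtain rfl : k = 0 := by omega
    simp
  | succ n ih =>
    rcases n with _ | n
    · rcases h1 0 (by omega) with h | h
      · left
        intro k hk
        rcases (show k = 0 ∨ k = 1 by omega) with rfl | rfl <;> simp_all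
      · right
        intro k hk
        rcases (show k = 0 ∨ k = 1 by omega) with rfl | rfl <;> simp_all
    · have e1 := h1 (n + 1) (by omega)
      have e2 := h2 n (by omega)
      rcases ih (fun k hk => h1 k (by omega)) (fun k hk => h2 k (by omega)) with h | h
      · left
        intro k hk
        rcases hk.lt_or_eq with hk | rfl
        · exact h k (by omega)
        · have e3 := h n (by omega)
          have e4 := h (n + 1) (by omega)
          rw [show n + 1 + 1 = n + 2 from rfl] at *
          push_cast at *
          omega
      · right
        intro k hk
        rcases hk.lt_or_eq with hk | rfl
        · exact h k (by omega)
        · have e3 := h n (by omega)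
          have e4 := h (n + 1) (by omega)
          rw [show n + 1 + 1 = n + 2 from rfl] at *
          push_cast at *
          omega

/-- A skew whose dual graph is a path has at most one box of each content. -/
theorem IsRim.eq_of_content_eq {R : Finset (ℕ × ℕ)} (h : IsRim R) {a b : ℕ × ℕ} (ha : a ∈ R)
    (hb : b ∈ R) (hab : (a.2 : ℤ) - a.1 = (b.2 : ℤ) - b.1) : a = b := by
  wlog hle : a.1 ≤ b.1 generalizing a b
  · exact (this hb ha hab.symm (by omega)).symm
  obtain ⟨⟨μ, ν, -, hR⟩, n, ⟨f⟩⟩ := h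
  obtain ⟨i, j⟩ := a
  obtain ⟨i', j'⟩ := b
  simp only at hab hle
  by_contra hne
  have hlt : i < i' := by
    refine lt_of_le_of_ne hle fun h => hne ?_
    subst h
    ext <;> simp
    omega
  rw [hR, Finset.mem_sdiff] at ha hb
  -- Skews are convex: with two boxes on one diagonal they contain the whole rectangle spanned, in
  -- particular a 2 × 2 square. Its dual graph is a 4-cycle, which does not embed in a path.
  have key : ∀ x y : ℕ, i ≤ x → j ≤ y → x ≤ i' → y ≤ j' → (x, y) ∈ R := by
    intro x y h1 h2 h3 h4
    rw [hR, Finset.mem_sdiff]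
    refine ⟨ν.isLowerSet (a := (i', j')) ⟨h3, h4⟩ hb.1, fun h => ha.2 ?_⟩
    exact μ.isLowerSet (a := (x, y)) ⟨h1, h2⟩ h
  let A : R := ⟨(i, j), key _ _ (by omega) (by omega) (by omega) (by omega)⟩
  let B : R := ⟨(i + 1, j), key _ _ (by omega) (by omega) (by omega) (by omega)⟩
  let C : R := ⟨(i, j + 1), key _ _ (by omega) (by omega) (by omega) (by omega)⟩
  let D : R := ⟨(i + 1, j + 1), key _ _ (by omega) (by omega) (by omega) (by omega)⟩
  have hAB : (dualGraph R).Adj A B := by rw [dualGraph_adj]; simp [A, B]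
  have hAC : (dualGraph R).Adj A C := by rw [dualGraph_adj]; simp [A, C]
  have hBD : (dualGraph R).Adj B D := by rw [dualGraph_adj]; simp [B, D]
  have hCD : (dualGraph R).Adj C D := by rw [dualGraph_adj]; simp [C, D]
  have hBC : f B ≠ f C := fun h => by simpa [B, C] using f.injective h
  have hAD : f A ≠ f D := fun h => by simpa [A, D] using f.injective h
  rw [← f.map_adj_iff, SimpleGraph.pathGraph_adj] at hAB hAC hBD hCD
  rw [Ne, Fin.ext_iff] at hBC hAD
  omega

/-- A rim has exactly one box of each content in some interval. -/
theorem IsRim.exists_rows {R : Finset (ℕ × ℕ)} (h : IsRim R) :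
    ∃ (p q : ℤ) (r : ℤ → ℕ), p < q ∧ (∀ c, p ≤ c → c < q → 0 ≤ r c + c) ∧
      ∀ i j : ℕ, (i, j) ∈ R ↔ p ≤ (j : ℤ) - i ∧ (j : ℤ) - i < q ∧ i = r ((j : ℤ) - i) := by
  have hinj := @IsRim.eq_of_content_eq R h
  obtain ⟨-, n, ⟨f⟩⟩ := h
  -- The boxes in the order of the path; `Fin.ofNat` wraps around only beyond n, where `g` is not
  -- used.
  let g : ℕ → R := fun k => f.symm (Fin.ofNat (n + 1) k)
  have hval : ∀ k ≤ n, (Fin.ofNat (n + 1) k : ℕ) = k := fun k hk => by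
    simp [Nat.mod_eq_of_lt (Nat.lt_succ_of_le hk)]
  let w : ℕ → ℤ := fun k => ((g k).1.2 : ℤ) - (g k).1.1
  have hsurj : ∀ b (hb : b ∈ R), ∃ k ≤ n, (g k).1 = b := by
    intro b hb
    refine ⟨f ⟨b, hb⟩, by omega, ?_⟩
    simp [g]
  have hstep : ∀ k < n, w (k + 1) = w k + 1 ∨ w (k + 1) = w k - 1 := by
    intro k hk
    have : (dualGraph R).Adj (g k) (g (k + 1)) := by
      simp only [g]
      rw [f.symm.map_adj_iff, SimpleGraph.pathGraph_adj, hval k (by omega), hval (k + 1) (by omega)]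
      simp
    rw [dualGraph_adj] at this
    simp only [w]
    omega
  -- A repeated content would be a repeated box. So the contents along the path form a walk without
  -- backtracking, that is, an interval run through monotonically.
  have hback : ∀ k, k + 2 ≤ n → w (k + 2) ≠ w k := by
    intro k hk he
    have h1 := Subtype.ext (hinj (g (k + 2)).2 (g k).2 he)
    have h2 := congrArg Fin.val (f.symm.injective h1)
    rw [hval _ (by omega), hval _ (by omega)] at h2
    omega
  have hint : ∃ p q : ℤ, p < q ∧ ∀ c, (p ≤ c ∧ c < q) ↔ ∃ k ≤ n, w k = c := by
    rcases eq_add_or_eq_sub_of_steps w n hstep hback with hw | hw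
    · refine ⟨w 0, w 0 + n + 1, by omega, fun c => ⟨fun hc => ?_, ?_⟩⟩
      · refine ⟨(c - w 0).toNat, by omega, ?_⟩
        rw [hw _ (by omega)]
        omega
      · rintro ⟨k, hk, rfl⟩
        rw [hw k hk]
        omega
    · refine ⟨w 0 - n, w 0 + 1, by omega, fun c => ⟨fun hc => ?_, ?_⟩⟩
      · refine ⟨(w 0 - c).toNat, by omega, ?_⟩
        rw [hw _ (by omega)]
        omega
      · rintro ⟨k, hk, rfl⟩
        rw [hw k hk]
        omega
  obtain ⟨p, q, hpq, hint⟩ := hint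
  -- The row is made a total function of the content, with the default 0 outside [p, q).
  have hex : ∀ c : ℤ, ∃ i : ℕ, p ≤ c ∧ c < q → ∃ j : ℕ, (i, j) ∈ R ∧ (j : ℤ) - i = c := by
    intro c
    by_cases hc : p ≤ c ∧ c < q
    · obtain ⟨k, -, hk⟩ := (hint c).1 hc
      exact ⟨(g k).1.1, fun _ => ⟨(g k).1.2, (g k).2, hk⟩⟩
    · exact ⟨0, fun h => absurd h hc⟩
  choose r hr using hex
  refine ⟨p, q, r, hpq, fun c h1 h2 => ?_, fun i j => ⟨fun hij => ?_, ?_⟩⟩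
  · obtain ⟨j, -, hj⟩ := hr c ⟨h1, h2⟩
    omega
  · obtain ⟨k, hk, he⟩ := hsurj _ hij
    have hc := (hint ((j : ℤ) - i)).2 ⟨k, hk, by simp only [w, he]⟩
    obtain ⟨j', hj', hc'⟩ := hr _ hc
    exact ⟨hc.1, hc.2, congrArg Prod.fst (hinj hij hj' hc'.symm)⟩
  · rintro ⟨h1, h2, h3⟩
    obtain ⟨j', hj', hc'⟩ := hr _ ⟨h1, h2⟩
    rw [← h3] at hj' hc'
    obtain rfl : j' = j := by omega
    exact hj'

theorem mem_sdiff_iff_height {μ ν : YoungDiagram} {i j : ℕ} :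
    (i, j) ∈ ν.cells \ μ.cells ↔ height μ ((j : ℤ) - i) ≤ i ∧ i < height ν ((j : ℤ) - i) := by
  rw [Finset.mem_sdiff, YoungDiagram.mem_cells, YoungDiagram.mem_cells, mem_iff_lt_height,
    mem_iff_lt_height, not_lt, and_comm]

/-- The boxes added by moving a single bead to the right. -/
theorem mem_sdiff_of_move {μ κ : YoungDiagram} {p q : ℤ}
    (h : ∀ c, height κ c = height μ c + if p ≤ c ∧ c < q then 1 else 0) {i j : ℕ} :
    (i, j) ∈ κ.cells \ μ.cells ↔
      p ≤ (j : ℤ) - i ∧ (j : ℤ) - i < q ∧ i = height μ ((j : ℤ) - i) := by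
  rw [mem_sdiff_iff_height, h]
  by_cases hc : p ≤ (j : ℤ) - i ∧ (j : ℤ) - i < q
  · rw [if_pos hc]
    omega
  · rw [if_neg hc]
    omega

/-- Moving a single bead to the right adds a rim. -/
theorem isRim_of_move {μ κ : YoungDiagram} {p q : ℤ} (hpq : p < q)
    (h : ∀ c, height κ c = height μ c + if p ≤ c ∧ c < q then 1 else 0) :
    IsRim (κ.cells \ μ.cells) := by
  have hmem := @mem_sdiff_of_move μ κ p q h
  refine ⟨⟨μ, κ, le_iff_height_le.2 fun c => by rw [h]; omega, rfl⟩, (q - p).toNat - 1, ⟨?_⟩⟩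
  -- The boxes are numbered by content: the one on diagonal c lies in row `height μ c`. Heights of
  -- neighbouring diagonals differ by at most one, so successive boxes share an edge.
  let e : (κ.cells \ μ.cells : Finset (ℕ × ℕ)) ≃ Fin ((q - p).toNat - 1 + 1) :=
    { toFun := fun b => ⟨((b.1.2 : ℤ) - b.1.1 - p).toNat, by
        obtain ⟨⟨i, j⟩, hb⟩ := b
        have := hmem.1 hb
        simp only
        omega⟩
      invFun := fun k => ⟨(height μ (p + k), (height μ (p + k) + (p + k)).toNat), by
        have := neg_le_height μ (p + k)
        have e : ((height μ (p + k) + (p + k)).toNat : ℤ) - height μ (p + k) = p + k := by omega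
        rw [hmem, e]
        omega⟩
      left_inv := by
        rintro ⟨⟨i, j⟩, hb⟩
        have := hmem.1 hb
        have e : p + (((j : ℤ) - i - p).toNat : ℕ) = (j : ℤ) - i := by omega
        simp only [e, Subtype.mk.injEq, Prod.mk.injEq]
        omega
      right_inv := by
        intro k
        have := neg_le_height μ (p + k)
        ext
        simp only
        omega }
  refine ⟨e, ?_⟩
  rintro ⟨⟨i, j⟩, hb⟩ ⟨⟨i', j'⟩, hb'⟩
  rw [SimpleGraph.pathGraph_adj, dualGraph_adj]
  simp only [e, Equiv.coe_fn_mk]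
  have h1 := hmem.1 hb
  have h2 := hmem.1 hb'
  have s1 := height_sub_one_cases μ ((j : ℤ) - i)
  have s2 := height_sub_one_cases μ ((j' : ℤ) - i')
  constructor
  · intro hadj
    rcases hadj with hadj | hadj
    · rw [show (j' : ℤ) - i' - 1 = (j : ℤ) - i by omega] at s2
      omega
    · rw [show (j : ℤ) - i - 1 = (j' : ℤ) - i' by omega] at s1
      omega
  · intro hadj
    omega

end BrauerBlock

namespace BrauerBlock

/-! ### Minimal balanced skews in terms of beads -/

/-- The beads `p` and `δ - q` of `μ` are replaced by `q` and `δ - p`, and between `p` and `q` the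
bead configuration is invariant under `c ↦ δ - c`. -/
def IsBeadFlip (δ : ℤ) (μ ν : YoungDiagram) (p q : ℤ) : Prop :=
  p < q ∧ δ < p + q ∧ p ∈ beadSet μ ∧ δ - q ∈ beadSet μ ∧ q ∉ beadSet μ ∧
    (δ - p ∈ beadSet μ → 2 * p = δ) ∧ (2 * p < δ → ∀ c, 2 * c = δ → c ∉ beadSet μ) ∧
    (∀ c, p < c → c < q → c ≠ δ - p → (c ∈ beadSet μ ↔ δ - c ∈ beadSet μ)) ∧
    ∀ c, c ∈ beadSet ν ↔ (c ∈ beadSet μ ∧ c ≠ p ∧ c ≠ δ - q) ∨ c = q ∨ c = δ - p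

/-- The discrete derivative of the indicator of [p, q). As beads are the drops of the height
function, it converts boxes added on an interval of diagonals into a bead moved from p to q. -/
theorem indicator_Ico_step {p q : ℤ} (hpq : p < q) (c : ℤ) :
    (if p ≤ c - 1 ∧ c - 1 < q then (1 : ℤ) else 0) - (if p ≤ c ∧ c < q then 1 else 0) =
      (if c = q then 1 else 0) - (if c = p then 1 else 0) := by
  split_ifs <;> omega

/-- The rotation about a point of the charge-`0` diagonal in integral coordinates. -/
theorem exists_integral_rotation {δ : ℤ} {R R' : Finset (ℕ × ℕ)} (hR : R.Nonempty) {c : ℝ × ℝ}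
    (hc : charge δ c = 0)
    (hrot : piRotation c '' (centre '' (R : Set (ℕ × ℕ))) = centre '' (R' : Set (ℕ × ℕ))) :
    ∃ K : ℤ, 2 * c.1 = K ∧
      (∀ b ∈ R, ∃ b' ∈ R', (b'.1 : ℤ) = K - b.1 ∧ (b'.2 : ℤ) = K + δ - 1 - b.2) ∧
      (∀ b' ∈ R', ∃ b ∈ R, (b'.1 : ℤ) = K - b.1 ∧ (b'.2 : ℤ) = K + δ - 1 - b.2) := by
  have hto : ∀ b ∈ R, ∃ b' ∈ R', (b'.1 : ℝ) = 2 * c.1 - b.1 ∧ (b'.2 : ℝ) = 2 * c.2 - b.2 := by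
    intro b hb
    have : piRotation c (centre b) ∈ centre '' (R' : Set (ℕ × ℕ)) := by
      rw [← hrot]
      exact ⟨_, ⟨b, hb, rfl⟩, rfl⟩
    obtain ⟨b', hb', he⟩ := this
    simp only [centre, piRotation, Prod.mk.injEq] at he
    exact ⟨b', hb', he⟩
  have hfrom : ∀ b' ∈ R', ∃ b ∈ R, (b'.1 : ℝ) = 2 * c.1 - b.1 ∧ (b'.2 : ℝ) = 2 * c.2 - b.2 := by
    intro b' hb'
    have : centre b' ∈ piRotation c '' (centre '' (R : Set (ℕ × ℕ))) := by
      rw [hrot]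
      exact ⟨b', hb', rfl⟩
    obtain ⟨_, ⟨b, hb, rfl⟩, he⟩ := this
    simp only [centre, piRotation, Prod.mk.injEq] at he
    exact ⟨b, hb, he.1.symm, he.2.symm⟩
  obtain ⟨b, hb⟩ := hR
  obtain ⟨b', -, h1, -⟩ := hto b hb
  -- The row of a box plus that of its image is twice the row of the centre, so K is an integer;
  -- charge 0 then makes twice the column of the centre K + δ - 1.
  have hK : 2 * c.1 = ((b.1 + b'.1 : ℤ) : ℝ) := by
    push_cast
    linarith
  have hK' : 2 * c.2 = ((b.1 + b'.1 + δ - 1 : ℤ) : ℝ) := by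
    simp only [charge] at hc
    push_cast at hK ⊢
    linarith
  rw [hK, hK'] at hto hfrom
  refine ⟨_, hK, fun b hb => ?_, fun b' hb' => ?_⟩
  · obtain ⟨b', hb', h1, h2⟩ := hto b hb
    exact ⟨b', hb', by exact_mod_cast h1, by exact_mod_cast h2⟩
  · obtain ⟨b, hb, h1, h2⟩ := hfrom b' hb'
    exact ⟨b, hb, by exact_mod_cast h1, by exact_mod_cast h2⟩

/-- The two rims occupy the contents [p, q) and [δ - q, δ - p), one box per diagonal each, so the
height of `ν` is that of `μ` plus two indicators; taking differences yields the bead changes. Since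
heights drop by 0 or 1 for both diagrams, these changes also decide which places are occupied in
`μ`, except at the fixed place δ/2, where `hfix` decides. The rotation supplies the symmetry in
between. -/
theorem isBeadFlip_of_rims {δ K : ℤ} {μ ν : YoungDiagram} {p q : ℤ} {r r' : ℤ → ℕ}
    (hle : ∀ c, height μ c ≤ height ν c) (hpq : p < q) (hδ : δ < p + q)
    (hmem : ∀ (c : ℤ) (i : ℕ), (height μ c ≤ i ∧ i < height ν c) ↔
      (p ≤ c ∧ c < q ∧ i = r c) ∨ (δ - q ≤ c ∧ c < δ - p ∧ i = r' c))
    (hdisj : ∀ c, p ≤ c → c < q → δ - q ≤ c → c < δ - p → r c ≠ r' c)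
    (hrot : ∀ c, p ≤ c → c < q → (r c : ℤ) + r' (δ - 1 - c) = K)
    (hfix : ∀ (c : ℤ) (i : ℕ), height μ c ≤ i → i < height ν c → 2 * (i : ℤ) ≠ K) :
    IsBeadFlip δ μ ν p q := by
  have hnone : ∀ c, ¬ (p ≤ c ∧ c < q) → ¬ (δ - q ≤ c ∧ c < δ - p) →
      height ν c = height μ c := by
    intro c h1 h2
    have := hmem c (height μ c)
    have := hle c
    omega
  have hleft : ∀ c, (p ≤ c ∧ c < q) → ¬ (δ - q ≤ c ∧ c < δ - p) →
      r c = height μ c ∧ height ν c = height μ c + 1 := by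
    intro c h1 h2
    have := hmem c (height μ c)
    have := hmem c (r c)
    have := hmem c (height ν c - 1)
    omega
  have hright : ∀ c, ¬ (p ≤ c ∧ c < q) → (δ - q ≤ c ∧ c < δ - p) →
      r' c = height μ c ∧ height ν c = height μ c + 1 := by
    intro c h1 h2
    have := hmem c (height μ c)
    have := hmem c (r' c)
    have := hmem c (height ν c - 1)
    omega
  have hboth : ∀ c, (p ≤ c ∧ c < q) → (δ - q ≤ c ∧ c < δ - p) →
      r c + r' c = 2 * height μ c + 1 ∧ height ν c = height μ c + 2 := by
    intro c h1 h2
    have := hmem c (height μ c)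
    have := hmem c (height μ c + 1)
    have := hmem c (r c)
    have := hmem c (r' c)
    have := hmem c (height ν c - 1)
    have := hdisj c h1.1 h1.2 h2.1 h2.2
    omega
  have hν : ∀ c, (height ν c : ℤ) = height μ c + (if p ≤ c ∧ c < q then 1 else 0) +
      (if δ - q ≤ c ∧ c < δ - p then 1 else 0) := by
    intro c
    split_ifs with h1 h2 h2
    · have := hboth c h1 h2
      omega
    · have := hleft c h1 h2
      omega
    · have := hright c h1 h2
      omega
    · have := hnone c h1 h2
      omega
  have hstep : ∀ c, (height ν (c - 1) : ℤ) - height ν c = height μ (c - 1) - height μ c +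
      ((if c = q then 1 else 0) - (if c = p then 1 else 0)) +
      ((if c = δ - p then 1 else 0) - (if c = δ - q then 1 else 0)) := by
    intro c
    rw [← indicator_Ico_step hpq, ← indicator_Ico_step (show δ - q < δ - p by omega), hν, hν]
    ring
  -- Where the rims overlap, their boxes on diagonal c have rows h and h + 1 in some order. Adding
  -- the rotation identities for c and δ - 1 - c removes the order, and halving gives the claim. For
  -- c ≥ δ - p each of the two diagonals has one box, in row h.
  have hsum : ∀ c, p ≤ c → c < q → (c < δ - p → (height μ c : ℤ) + height μ (δ - 1 - c) + 1 = K) ∧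
      (δ - p ≤ c → (height μ c : ℤ) + height μ (δ - 1 - c) = K) := by
    intro c h1 h2
    refine ⟨fun h3 => ?_, fun h3 => ?_⟩
    · have e1 := hrot c h1 h2
      have e2 := hrot (δ - 1 - c) (by omega) (by omega)
      have e3 := hboth c ⟨h1, h2⟩ (by omega)
      have e4 := hboth (δ - 1 - c) (by omega) (by omega)
      rw [show δ - 1 - (δ - 1 - c) = c by ring] at e2
      omega
    · have e1 := hrot c h1 h2
      have e3 := hleft c ⟨h1, h2⟩ (by omega)
      have e4 := hright (δ - 1 - c) (by omega) (by omega)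
      omega
  have hp : p ∈ beadSet μ := by
    rw [mem_beadSet_iff]
    have e3 := height_sub_one_cases μ p
    -- In this case one bead leaves p while another arrives there, so the bead changes say nothing.
    -- But K is the sum of the heights at p and p - 1, and if these were equal, row `height μ p`
    -- would be fixed.
    by_cases h : 2 * p = δ
    · have e1 := (hsum p le_rfl hpq).2 (by omega)
      have e2 := hfix p (height μ p) le_rfl (by have := hleft p (by omega) (by omega); omega)
      rw [show δ - 1 - p = p - 1 by omega] at e1
      omega
    · have e1 := hstep p
      have e4 := height_sub_one_cases ν p
      rw [if_neg (by omega), if_pos rfl, if_neg (by omega), if_neg (by omega)] at e1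
      omega
  have hq : q ∉ beadSet μ := by
    rw [mem_beadSet_iff]
    have e1 := hstep q
    have e4 := height_sub_one_cases ν q
    rw [if_pos rfl, if_neg (by omega), if_neg (by omega), if_neg (by omega)] at e1
    omega
  have hp' : δ - p ∈ beadSet μ → 2 * p = δ := by
    rw [mem_beadSet_iff]
    intro h
    by_contra
    have e1 := hstep (δ - p)
    have e4 := height_sub_one_cases ν (δ - p)
    rw [if_neg (by omega), if_neg (by omega), if_pos rfl, if_neg (by omega)] at e1
    omega
  have hq' : δ - q ∈ beadSet μ := by
    rw [mem_beadSet_iff]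
    have e1 := hstep (δ - q)
    have e3 := height_sub_one_cases μ (δ - q)
    have e4 := height_sub_one_cases ν (δ - q)
    rw [if_neg (by omega), if_neg (by omega), if_neg (by omega), if_pos rfl] at e1
    omega
  have hbead : ∀ c, c ∈ beadSet ν ↔ (c ∈ beadSet μ ∧ c ≠ p ∧ c ≠ δ - q) ∨ c = q ∨ c = δ - p := by
    intro c
    rw [mem_beadSet_iff] at hp hq hp' hq' ⊢
    rw [mem_beadSet_iff]
    have e1 := hstep c
    have e3 := height_sub_one_cases μ c
    have e4 := height_sub_one_cases ν c
    rcases eq_or_ne c p with rfl | h1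
    · rw [if_neg (by omega), if_pos rfl, if_neg (show ¬ c = δ - q by omega)] at e1
      by_cases h : c = δ - c
      · rw [if_pos h] at e1
        omega
      · rw [if_neg h] at e1
        omega
    rcases eq_or_ne c q with rfl | h2
    · rw [if_pos rfl, if_neg (by omega), if_neg (by omega), if_neg (by omega)] at e1
      omega
    rcases eq_or_ne c (δ - p) with rfl | h3
    · rw [if_neg (by omega), if_neg (by omega), if_pos rfl, if_neg (by omega)] at e1
      omega
    rcases eq_or_ne c (δ - q) with rfl | h4
    · rw [if_neg (by omega), if_neg (by omega), if_neg (by omega), if_pos rfl] at e1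
      omega
    rw [if_neg h1, if_neg h2, if_neg h3, if_neg h4] at e1
    omega
  refine ⟨hpq, hδ, hp, hq', hq, hp', fun h c hc hcμ => ?_, fun c h1 h2 h3 => ?_, hbead⟩
  -- A bead at the fixed place c = δ/2 would give K = 2 (h + 1) with h the height at c, so the lower
  -- of the two boxes on diagonal c would lie in a fixed row.
  · have e1 := (hsum c (by omega) (by omega)).1 (by omega)
    have e2 := hboth c (by omega) (by omega)
    have e3 := hfix c (height μ c + 1) (by omega) (by omega)
    rw [show δ - 1 - c = c - 1 by omega] at e1
    rw [mem_beadSet_iff] at hcμ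
    omega
  -- Subtracting the sums for c and c - 1 equates the drops at c and δ - c; as c ≠ δ - p, both sums
  -- are of the same kind.
  · have e1 := hsum c h1.le h2
    have e2 := hsum (c - 1) (by omega) (by omega)
    rw [show δ - 1 - (c - 1) = δ - c by ring] at e2
    have e3 := height_sub_one_cases μ c
    have e4 := height_sub_one_cases μ (δ - c)
    rw [mem_beadSet_iff, mem_beadSet_iff]
    rw [show δ - c - 1 = δ - 1 - c by ring] at e4 ⊢
    omega

/-- The rotation forces the content interval of the second rim to be the image of [p, q). The rims
enter symmetrically, so they may be exchanged to get δ < p + q, unless both intervals coincide,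
which is impossible. -/
theorem IsMinBalancedSkew.exists_isBeadFlip {δ : ℤ} {μ ν : YoungDiagram}
    (h : IsMinBalancedSkew δ μ ν) : ∃ p q, IsBeadFlip δ μ ν p q := by
  obtain ⟨hle, R, R', hR, hR', hdisj, hunion, c, hc, hrot, hfix⟩ := h
  obtain ⟨p, q, r, hpq, hr, hmem⟩ := hR.exists_rows
  obtain ⟨p', q', r', hpq', hr', hmem'⟩ := hR'.exists_rows
  have hbox : ∀ c, p ≤ c → c < q → ∃ j : ℕ, (j : ℤ) - r c = c ∧ (r c, j) ∈ R := by
    intro c h1 h2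
    have := hr c h1 h2
    have e : ((r c + c).toNat : ℤ) - r c = c := by omega
    exact ⟨(r c + c).toNat, e, (hmem _ _).2 (by rw [e]; exact ⟨h1, h2, rfl⟩)⟩
  have hbox' : ∀ c, p' ≤ c → c < q' → ∃ j : ℕ, (j : ℤ) - r' c = c ∧ (r' c, j) ∈ R' := by
    intro c h1 h2
    have := hr' c h1 h2
    have e : ((r' c + c).toNat : ℤ) - r' c = c := by omega
    exact ⟨(r' c + c).toNat, e, (hmem' _ _).2 (by rw [e]; exact ⟨h1, h2, rfl⟩)⟩
  obtain ⟨K, hK, hto, hfrom⟩ := exists_integral_rotation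
    (let ⟨_, _, h⟩ := hbox p le_rfl hpq; ⟨_, h⟩) hc hrot
  have hrow : ∀ c, p ≤ c → c < q →
      (p' ≤ δ - 1 - c ∧ δ - 1 - c < q') ∧ (r c : ℤ) + r' (δ - 1 - c) = K := by
    intro c h1 h2
    obtain ⟨j, hj, hb⟩ := hbox c h1 h2
    obtain ⟨⟨i', j'⟩, hb', e1, e2⟩ := hto _ hb
    have := (hmem' _ _).1 hb'
    simp only at e1 e2
    rw [show (j' : ℤ) - i' = δ - 1 - c by omega] at this
    omega
  have hrow' : ∀ c, p' ≤ c → c < q' → (p ≤ δ - 1 - c ∧ δ - 1 - c < q) := by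
    intro c h1 h2
    obtain ⟨j, hj, hb⟩ := hbox' c h1 h2
    obtain ⟨⟨i', j'⟩, hb', e1, e2⟩ := hfrom _ hb
    have := (hmem _ _).1 hb'
    simp only at e1 e2
    rw [show (j' : ℤ) - i' = δ - 1 - c by omega] at this
    omega
  obtain ⟨rfl, rfl⟩ : p' = δ - q ∧ q' = δ - p := by
    have := hrow p le_rfl hpq
    have := hrow (q - 1) (by omega) (by omega)
    have := hrow' p' le_rfl hpq'
    have := hrow' (q' - 1) (by omega) (by omega)
    omega
  rw [le_iff_height_le] at hle
  have hmem₂ : ∀ (c : ℤ) (i : ℕ), (height μ c ≤ i ∧ i < height ν c) ↔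
      (p ≤ c ∧ c < q ∧ i = r c) ∨ (δ - q ≤ c ∧ c < δ - p ∧ i = r' c) := by
    intro c i
    by_cases hi : 0 ≤ i + c
    · have e : ((i + c).toNat : ℤ) - i = c := by omega
      have h1 := @mem_sdiff_iff_height μ ν i (i + c).toNat
      have h2 := hmem i (i + c).toNat
      have h3 := hmem' i (i + c).toNat
      rw [e] at h1 h2 h3
      rw [← h1, hunion, Finset.mem_union, h2, h3]
    · have := neg_le_height μ c
      have := hr c
      have := hr' c
      constructor
      · omega
      · rintro (⟨h1, h2, rfl⟩ | ⟨h1, h2, rfl⟩) <;> omega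
  have hdisj₂ : ∀ c, p ≤ c → c < q → δ - q ≤ c → c < δ - p → r c ≠ r' c := by
    intro c h1 h2 h3 h4 he
    obtain ⟨j, hj, hb⟩ := hbox c h1 h2
    obtain ⟨j', hj', hb'⟩ := hbox' c h3 h4
    rw [← he] at hj' hb'
    obtain rfl : j = j' := by omega
    exact Finset.disjoint_left.1 hdisj hb hb'
  have hfix₂ : ∀ (c : ℤ) (i : ℕ), height μ c ≤ i → i < height ν c → 2 * (i : ℤ) ≠ K := by
    intro c i h1 h2 h3
    have := neg_le_height μ c
    have e : ((i + c).toNat : ℤ) - i = c := by omega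
    have hb : (i, (i + c).toNat) ∈ ν.cells \ μ.cells := by
      rw [mem_sdiff_iff_height, e]
      exact ⟨h1, h2⟩
    refine hfix _ hb ?_
    simp only [piRotation, centre, hK, ← h3]
    push_cast
    ring
  rcases lt_trichotomy δ (p + q) with hδ | hδ | hδ
  · exact ⟨p, q, isBeadFlip_of_rims hle hpq hδ hmem₂ hdisj₂ (fun c h1 h2 => (hrow c h1 h2).2) hfix₂⟩
  -- Coinciding intervals would add two boxes on diagonal p and none on p - 1. The height of `ν`
  -- would then increase from p - 1 to p.
  · exfalso
    have e1 := hmem₂ (p - 1) (height μ (p - 1))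
    have e2 := hle (p - 1)
    have e3 := hdisj₂ p le_rfl hpq (by omega) (by omega)
    have e4 := hmem₂ p (r p)
    have e5 := hmem₂ p (r' p)
    have e6 := height_sub_one_cases μ p
    have e7 := height_sub_one_cases ν p
    omega
  · refine ⟨δ - q, δ - p, isBeadFlip_of_rims (K := K) (r := r') (r' := r) hle hpq' (by omega)
      (fun c i => ?_) (fun c h1 h2 h3 h4 => ?_) (fun c h1 h2 => ?_) hfix₂⟩
    · rw [hmem₂, or_comm, sub_sub_cancel, sub_sub_cancel]
    · exact (hdisj₂ c (by omega) (by omega) h1 h2).symm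
    · have := hrow (δ - 1 - c) (by omega) (by omega)
      rw [show δ - 1 - (δ - 1 - c) = c by ring] at this
      omega

/-- The flip is carried out in two moves through an intermediate diagram κ, first p to q and then δ
- q to δ - p. Each move adds a rim, and the symmetry of the beads shows that the rims are exchanged
by a rotation. -/
theorem IsBeadFlip.isMinBalancedSkew {δ : ℤ} {μ ν : YoungDiagram} {p q : ℤ}
    (h : IsBeadFlip δ μ ν p q) : IsMinBalancedSkew δ μ ν := by
  obtain ⟨hpq, hδ, hp, hq', hq, hp', hcen, hsymm, hν⟩ := h
  obtain ⟨κ, hκ, hκb⟩ := exists_move_right μ hpq hp hq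
  obtain ⟨ν', hν', hνb⟩ := exists_move_right κ (p := δ - q) (q := δ - p) (by omega)
    ((hκb _).2 (Or.inl ⟨hq', by omega⟩))
    (by
      rw [hκb]
      rintro (⟨h1, h2⟩ | h)
      · have := hp' h1
        omega
      · omega)
  obtain rfl : ν = ν' := by
    refine eq_of_beadSet_eq (Set.ext fun c => ?_)
    rw [hν, hνb, hκb]
    constructor
    · rintro (⟨h1, h2, h3⟩ | h | h)
      · exact Or.inl ⟨Or.inl ⟨h1, h2⟩, h3⟩
      · exact Or.inl ⟨Or.inr h, by omega⟩
      · exact Or.inr h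
    · tauto
  have hκμ : μ ≤ κ := le_iff_height_le.2 fun c => by rw [hκ]; omega
  have hνκ : κ ≤ ν := le_iff_height_le.2 fun c => by rw [hν']; omega
  have hcells : ν.cells \ μ.cells = (κ.cells \ μ.cells) ∪ (ν.cells \ κ.cells) := by
    ext b
    have h1 : b ∈ μ.cells → b ∈ κ.cells := fun h => hκμ h
    have h2 : b ∈ κ.cells → b ∈ ν.cells := fun h => hνκ h
    simp only [Finset.mem_union, Finset.mem_sdiff]
    tauto
  -- The rows of opposite boxes have constant sum: passing from c to c + 1 the first height drops if
  -- there is a bead of `μ` at c + 1, and the second rises if there is one of κ at δ - 1 - c.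
  have hsum : ∃ K : ℤ, ∀ c, p ≤ c → c < q → (height μ c : ℤ) + height κ (δ - 1 - c) = K := by
    refine ⟨(height μ p : ℤ) + height κ (δ - 1 - p), fun c h1 h2 => ?_⟩
    induction c, h1 using Int.leInduction with
    | base => rfl
    | succ c h1 ih =>
      rw [← ih (by omega)]
      have e2 := height_sub_one_cases μ (c + 1)
      have e3 := height_sub_one_cases κ (δ - 1 - c)
      have e4 := hsymm (c + 1) (by omega) h2
      have e5 := hκb (δ - 1 - c)
      have e6 := mem_beadSet_iff (μ := μ) (c := c + 1)
      rw [mem_beadSet_iff (μ := κ)] at e5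
      rw [show δ - (c + 1) = δ - 1 - c by ring] at e4
      rw [show δ - 1 - c - 1 = δ - 1 - (c + 1) by ring] at e3 e5
      rw [add_sub_cancel_right] at e2 e6
      -- The one place outside the symmetry assumption. Neither δ - p in `μ` nor p in κ carries a
      -- bead, the latter having just been vacated.
      by_cases h3 : c + 1 = δ - p
      · have h4 : c + 1 ∉ beadSet μ := by
          intro h
          rw [h3] at h
          have := hp' h
          omega
        have h5 : ¬ ((δ - 1 - c ∈ beadSet μ ∧ δ - 1 - c ≠ p) ∨ δ - 1 - c = q) := by
          rintro (h | h) <;> omega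
        rw [e6] at h4
        rw [← e5] at h5
        omega
      · have h4 := e4 h3
        have h5 : ((δ - 1 - c ∈ beadSet μ ∧ δ - 1 - c ≠ p) ∨ δ - 1 - c = q) ↔
            c + 1 ∈ beadSet μ := by
          rw [h4]
          constructor
          · rintro (h | h)
            · exact h.1
            · omega
          · intro h
            exact Or.inl ⟨h, by omega⟩
        rw [h5, e6] at e5
        omega
  obtain ⟨K, hsum⟩ := hsum
  have hfix : ∀ c, p ≤ c → c < q → 2 * (height μ c : ℤ) ≠ K := by
    intro c h1 h2 hK
    -- If δ ≤ 2p, opposite diagonals lie to the left and K > 2 h by monotonicity. Otherwise K is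
    -- odd, as evaluation at the middle diagonal δ/2 shows; for even δ this uses that the fixed
    -- place is empty.
    by_cases hpδ : δ ≤ 2 * p
    · have e1 := hsum c h1 h2
      have e2 := height_antitone κ (show δ - 1 - c ≤ c by omega)
      have e3 := hκ c
      rw [if_pos ⟨h1, h2⟩] at e3
      omega
    · have e1 := hsum (δ / 2) (by omega) (by omega)
      have e2 := hκ (δ / 2)
      rw [if_pos (by omega)] at e2
      rcases Int.emod_two_eq_zero_or_one δ with hpar | hpar
      · have e3 := hcen (by omega) (δ / 2) (by omega)
        have e4 : δ / 2 ∉ beadSet κ := by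
          rw [hκb]
          rintro (h | h)
          · exact e3 h.1
          · omega
        have e5 := height_sub_one_of_notMem e4
        rw [show δ - 1 - δ / 2 = δ / 2 - 1 by omega] at e1
        omega
      · rw [show δ - 1 - δ / 2 = δ / 2 by omega] at e1
        omega
  have hmemR := @mem_sdiff_of_move μ κ p q hκ
  have hmemR' := @mem_sdiff_of_move κ ν (δ - q) (δ - p) hν'
  -- The centre has row K/2, so that opposite rows have sum K; its column is then dictated by charge
  -- 0.
  refine ⟨hκμ.trans hνκ, κ.cells \ μ.cells, ν.cells \ κ.cells, isRim_of_move hpq hκ,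
    isRim_of_move (by omega) hν', ?_, hcells, ((K : ℝ) / 2, ((K : ℝ) + δ - 1) / 2), ?_, ?_, ?_⟩
  · rw [Finset.disjoint_left]
    intro b h1 h2
    rw [Finset.mem_sdiff] at h1 h2
    exact h2.2 h1.1
  · simp only [charge]
    ring
  · ext ⟨x, y⟩
    constructor
    · rintro ⟨_, ⟨⟨i, j⟩, hb, rfl⟩, he⟩
      have h1 := hmemR.1 hb
      have h2 := hsum ((j : ℤ) - i) h1.1 h1.2.1
      have h3 := neg_le_height κ (δ - 1 - ((j : ℤ) - i))
      refine ⟨((K - i).toNat, (K + δ - 1 - j).toNat), ?_, ?_⟩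
      · rw [Finset.mem_coe, hmemR']
        have e : ((K + δ - 1 - j).toNat : ℤ) - ((K - i).toNat : ℤ) = δ - 1 - ((j : ℤ) - i) := by
          omega
        rw [e]
        omega
      · rw [← he]
        have e1 : ((K - i).toNat : ℝ) = K - i := by
          have : ((K - i).toNat : ℤ) = K - i := by omega
          exact_mod_cast this
        have e2 : ((K + δ - 1 - j).toNat : ℝ) = K + δ - 1 - j := by
          have : ((K + δ - 1 - j).toNat : ℤ) = K + δ - 1 - j := by omega
          exact_mod_cast this
        simp only [centre, piRotation, e1, e2, Prod.mk.injEq]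
        constructor <;> ring
    · rintro ⟨⟨i', j'⟩, hb, he⟩
      have h1 := hmemR'.1 hb
      have h2 := hsum (δ - 1 - ((j' : ℤ) - i')) (by omega) (by omega)
      have h3 := neg_le_height μ (δ - 1 - ((j' : ℤ) - i'))
      rw [show δ - 1 - (δ - 1 - ((j' : ℤ) - i')) = (j' : ℤ) - i' by ring] at h2
      refine ⟨_, ⟨((K - i').toNat, (K + δ - 1 - j').toNat), ?_, rfl⟩, ?_⟩
      · rw [Finset.mem_coe, hmemR]
        have e : ((K + δ - 1 - j').toNat : ℤ) - ((K - i').toNat : ℤ) =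
            δ - 1 - ((j' : ℤ) - i') := by
          omega
        rw [e]
        omega
      · rw [← he]
        have e1 : ((K - i').toNat : ℝ) = K - i' := by
          have : ((K - i').toNat : ℤ) = K - i' := by omega
          exact_mod_cast this
        have e2 : ((K + δ - 1 - j').toNat : ℝ) = K + δ - 1 - j' := by
          have : ((K + δ - 1 - j').toNat : ℤ) = K + δ - 1 - j' := by omega
          exact_mod_cast this
        simp only [centre, piRotation, e1, e2, Prod.mk.injEq]
        constructor <;> ring
  · rintro ⟨i, j⟩ hb he
    simp only [piRotation, centre] at he
    have he' : 2 * (i : ℤ) = K := by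
      have : (2 * i : ℝ) = K := by linarith
      exact_mod_cast this
    rw [hcells, Finset.mem_union, hmemR, hmemR'] at hb
    rcases hb with h1 | h1
    · refine hfix _ h1.1 h1.2.1 ?_
      omega
    · have h2 := hsum (δ - 1 - ((j : ℤ) - i)) (by omega) (by omega)
      rw [show δ - 1 - (δ - 1 - ((j : ℤ) - i)) = (j : ℤ) - i by ring] at h2
      refine hfix (δ - 1 - ((j : ℤ) - i)) (by omega) (by omega) ?_
      omega

theorem isMinBalancedSkew_iff {δ : ℤ} {μ ν : YoungDiagram} :
    IsMinBalancedSkew δ μ ν ↔ ∃ p q, IsBeadFlip δ μ ν p q :=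
  ⟨IsMinBalancedSkew.exists_isBeadFlip, fun ⟨_, _, h⟩ => h.isMinBalancedSkew⟩

end BrauerBlock

namespace BrauerBlock

/-! ### Signs and magnitudes -/

/-- Twice the `i`-th entry of `e_δ(μ)`. -/
def dbl (δ : ℤ) (μ : YoungDiagram) (i : ℕ) : ℤ := 2 * bead μ i - δ

/-- The set of doubled entries of `e_δ(μ)`. -/
def dblSet (δ : ℤ) (μ : YoungDiagram) : Set ℤ := Set.range (dbl δ μ)

/-- The (doubled) nonzero magnitudes that occur with both signs. -/
def pairedMags (δ : ℤ) (μ : YoungDiagram) : Set ℕ :=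
  {k | 0 < k ∧ (k : ℤ) ∈ dblSet δ μ ∧ -(k : ℤ) ∈ dblSet δ μ}

/-- The (doubled) magnitudes that occur exactly once. -/
def singleMags (δ : ℤ) (μ : YoungDiagram) : Set ℕ :=
  {k | ((k : ℤ) ∈ dblSet δ μ ∨ -(k : ℤ) ∈ dblSet δ μ) ∧ k ∉ pairedMags δ μ}

/-- The nonzero single magnitudes that occur with positive sign. -/
def posMags (δ : ℤ) (μ : YoungDiagram) : Set ℕ :=
  {k | 0 < k ∧ (k : ℤ) ∈ dblSet δ μ ∧ -(k : ℤ) ∉ dblSet δ μ}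

/-- The single magnitudes with positive sign, the sign of zero being fixed by parity. -/
def upMags (δ : ℤ) (μ : YoungDiagram) : Set ℕ :=
  {k | k ∈ posMags δ μ ∨ (k = 0 ∧ (0 : ℤ) ∈ dblSet δ μ ∧ Odd (posMags δ μ).ncard)}

/-- The `n`-th element of an infinite set of natural numbers, counting from `1`. -/
noncomputable def place (M : Set ℕ) (n : ℕ+) : ℕ := Nat.nth (· ∈ M) n.natPred

variable {δ : ℤ} {μ ν : YoungDiagram}

/-- Doubling keeps all entries integral, also for odd δ. -/
theorem eMap_eq_dbl (δ : ℤ) (μ : YoungDiagram) (i : ℕ) : eMap δ μ i = (dbl δ μ i : ℝ) / 2 := by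
  simp only [eMap, dbl, bead]
  push_cast
  ring

theorem dbl_strictAnti (δ : ℤ) (μ : YoungDiagram) : StrictAnti (dbl δ μ) := by
  intro i j h
  have := bead_strictAnti μ h
  simp only [dbl]
  omega

theorem mem_dblSet_iff {z : ℤ} : z ∈ dblSet δ μ ↔ ∃ b ∈ beadSet μ, z = 2 * b - δ := by
  constructor
  · rintro ⟨i, rfl⟩
    exact ⟨_, ⟨i, rfl⟩, rfl⟩
  · rintro ⟨_, ⟨i, rfl⟩, rfl⟩
    exact ⟨i, rfl⟩

theorem two_mul_sub_mem_dblSet_iff {b : ℤ} : 2 * b - δ ∈ dblSet δ μ ↔ b ∈ beadSet μ := by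
  rw [mem_dblSet_iff]
  constructor
  · rintro ⟨b', hb', h⟩
    obtain rfl : b = b' := by omega
    exact hb'
  · exact fun h => ⟨b, h, rfl⟩

theorem eq_of_dblSet_eq (h : ∀ z, z ∈ dblSet δ μ ↔ z ∈ dblSet δ ν) : μ = ν := by
  refine eq_of_beadSet_eq (Set.ext fun b => ?_)
  rw [← two_mul_sub_mem_dblSet_iff (δ := δ), h, two_mul_sub_mem_dblSet_iff]

theorem zero_mem_singleMags_iff : 0 ∈ singleMags δ μ ↔ (0 : ℤ) ∈ dblSet δ μ := by
  simp [singleMags, pairedMags]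

theorem upMags_subset_singleMags : upMags δ μ ⊆ singleMags δ μ := by
  rintro k (⟨h1, h2, h3⟩ | ⟨rfl, h, -⟩)
  · exact ⟨Or.inl h2, fun h => h3 h.2.2⟩
  · exact zero_mem_singleMags_iff.2 h

theorem mem_upMags_of_pos {k : ℕ} (hk : 0 < k) : k ∈ upMags δ μ ↔ k ∈ posMags δ μ := by
  constructor
  · rintro (h | ⟨rfl, -⟩)
    · exact h
    · omega
  · exact Or.inl

/-- With the next lemma and `zero_mem_singleMags_iff` this recovers all entries, and so the diagram,
from its paired, single and positive magnitudes. -/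
theorem coe_mem_dblSet_iff {k : ℕ} (hk : 0 < k) :
    (k : ℤ) ∈ dblSet δ μ ↔ k ∈ pairedMags δ μ ∨ k ∈ posMags δ μ := by
  simp only [pairedMags, posMags, Set.mem_ofPred_eq]
  tauto

theorem neg_coe_mem_dblSet_iff {k : ℕ} (hk : 0 < k) :
    -(k : ℤ) ∈ dblSet δ μ ↔
      k ∈ pairedMags δ μ ∨ (k ∈ singleMags δ μ ∧ k ∉ posMags δ μ) := by
  simp only [pairedMags, singleMags, posMags, Set.mem_ofPred_eq]
  tauto

theorem posMags_finite (δ : ℤ) (μ : YoungDiagram) : (posMags δ μ).Finite := by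
  refine (Set.finite_Iic (dbl δ μ 0).toNat).subset ?_
  rintro k ⟨-, ⟨i, hi⟩, -⟩
  have := (dbl_strictAnti δ μ).antitone (Nat.zero_le i)
  simp only [Set.mem_Iic]
  omega

theorem upMags_finite (δ : ℤ) (μ : YoungDiagram) : (upMags δ μ).Finite := by
  refine ((posMags_finite δ μ).insert 0).subset ?_
  rintro k (h | ⟨rfl, -⟩)
  · exact Or.inr h
  · exact Or.inl rfl

theorem isolated_iff (i : ℕ) :
    (∀ j, j ≠ i → eMap δ μ j ≠ -eMap δ μ i) ↔ ∀ j, j ≠ i → dbl δ μ j ≠ -dbl δ μ i := by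
  refine forall_congr' fun j => imp_congr_right fun _ => not_congr ?_
  rw [eMap_eq_dbl, eMap_eq_dbl, ← neg_div, div_left_inj' two_ne_zero]
  exact_mod_cast Iff.rfl

/-- Far along the sequence -v_i exceeds the largest entry, so v_i has no partner. Infinitude matters
because `Nat.nth` takes a default value past the end of a finite set. -/
theorem infinite_isolated (δ : ℤ) (μ : YoungDiagram) :
    {i | ∀ j, j ≠ i → eMap δ μ j ≠ -eMap δ μ i}.Infinite := by
  refine (Set.Ioi_infinite (2 * bead μ 0 - δ).natAbs).mono ?_
  intro i hi
  simp only [Set.mem_ofPred_eq, isolated_iff]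
  intro j _ h
  have h1 := (dbl_strictAnti δ μ).antitone (Nat.zero_le j)
  have h2 : bead μ i ≤ bead μ 0 - i := by
    have := μ.rowLen_anti 0 i (Nat.zero_le _)
    simp only [bead]
    omega
  simp only [dbl, Set.mem_Ioi] at *
  omega

/-- The magnitudes of the regularized sequence enumerate the single magnitudes. -/
theorem exists_regularize (δ : ℤ) (μ : YoungDiagram) :
    ∃ σ : ℕ → ℕ, Function.Injective σ ∧ Set.range σ = singleMags δ μ ∧
      ∀ j, |regularize (eMap δ μ) j| = (σ j : ℝ) / 2 ∧
        (0 < regularize (eMap δ μ) j ↔ σ j ∈ posMags δ μ) := by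
  set P : ℕ → Prop := fun i => ∀ j, j ≠ i → eMap δ μ j ≠ -eMap δ μ i with hP
  have hinf : (Set.ofPred P).Infinite := infinite_isolated δ μ
  have hdbl := (dbl_strictAnti δ μ).injective
  have hrange := Nat.range_nth_of_infinite hinf
  -- A retained entry can be opposite only to itself, which is how the entry 0 survives.
  have hPn : ∀ j i', dbl δ μ i' = -dbl δ μ (Nat.nth P j) → i' = Nat.nth P j := by
    intro j i' h
    by_contra hne
    exact (isolated_iff _).1 (Nat.nth_mem_of_infinite hinf j) i' hne h
  have hval : ∀ j, regularize (eMap δ μ) j = (dbl δ μ (Nat.nth P j) : ℝ) / 2 := fun j =>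
    eMap_eq_dbl _ _ _
  have hself : ∀ i, dbl δ μ i ∈ dblSet δ μ := fun i => ⟨i, rfl⟩
  have hsingle : ∀ j, (dbl δ μ (Nat.nth P j)).natAbs ∈ singleMags δ μ := by
    intro j
    have hz := hself (Nat.nth P j)
    refine ⟨?_, ?_⟩
    · rcases Int.natAbs_eq (dbl δ μ (Nat.nth P j)) with h | h
      · rw [h] at hz
        exact Or.inl (by simpa using hz)
      · rw [h] at hz
        exact Or.inr (by simpa using hz)
    · rintro ⟨h1, h2, h3⟩
      have : -dbl δ μ (Nat.nth P j) ∈ dblSet δ μ := by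
        rcases Int.natAbs_eq (dbl δ μ (Nat.nth P j)) with h | h
        · rw [h]
          exact h3
        · rw [h, neg_neg]
          exact h2
      obtain ⟨i', hi'⟩ := this
      have h4 := hPn j i' hi'
      rw [h4] at hi'
      omega
  refine ⟨fun j => (dbl δ μ (Nat.nth P j)).natAbs, ?_, ?_, fun j => ⟨?_, ?_⟩⟩
  · intro j j' h
    refine Nat.nth_injective hinf ?_
    rcases Int.natAbs_eq_natAbs_iff.1 h with h | h
    · exact hdbl h
    · exact hPn _ _ h
  · refine Set.Subset.antisymm ?_ ?_
    · rintro _ ⟨j, rfl⟩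
      exact hsingle j
    · rintro k ⟨hk, hk'⟩
      obtain ⟨i, hi, habs⟩ : ∃ i, (dbl δ μ i = k ∨ dbl δ μ i = -k) ∧ (dbl δ μ i).natAbs = k := by
        rcases hk with ⟨i, hi⟩ | ⟨i, hi⟩
        · exact ⟨i, Or.inl hi, by omega⟩
        · exact ⟨i, Or.inr hi, by omega⟩
      have hPi : P i := by
        rw [hP]
        simp only
        rw [isolated_iff]
        intro j hj he
        have h0 : k = 0 := by
          by_contra hne
          have h1 := hself i
          have h2 := hself j
          refine hk' ⟨by omega, ?_⟩
          rcases hi with hi | hi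
          · rw [he, hi] at h2
            rw [hi] at h1
            exact ⟨h1, h2⟩
          · rw [he, hi, neg_neg] at h2
            rw [hi] at h1
            exact ⟨h2, h1⟩
        exact hj (hdbl (by omega))
      obtain ⟨j, hj⟩ : i ∈ Set.range (Nat.nth P) := by
        rw [hrange]
        exact hPi
      exact ⟨j, by simp only [hj, habs]⟩
  · rw [hval, abs_div, abs_two, Nat.cast_natAbs, Int.cast_abs]
  · rw [hval]
    have h1 : (0 : ℝ) < (dbl δ μ (Nat.nth P j) : ℝ) / 2 ↔ 0 < dbl δ μ (Nat.nth P j) := by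
      rw [div_pos_iff_of_pos_right two_pos, Int.cast_pos]
    rw [h1]
    have hz := hself (Nat.nth P j)
    have hs := (hsingle j).2
    constructor
    · intro h
      have e : ((dbl δ μ (Nat.nth P j)).natAbs : ℤ) = dbl δ μ (Nat.nth P j) := by omega
      have hpos : 0 < (dbl δ μ (Nat.nth P j)).natAbs := by omega
      exact ⟨hpos, by rwa [e], fun h' => hs ⟨hpos, by rwa [e], h'⟩⟩
    · rintro ⟨h2, h3, h4⟩
      by_contra h5
      have e : -((dbl δ μ (Nat.nth P j)).natAbs : ℤ) = dbl δ μ (Nat.nth P j) := by omega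
      rw [e] at h4
      exact h4 hz

theorem singleMags_infinite (δ : ℤ) (μ : YoungDiagram) : (singleMags δ μ).Infinite := by
  obtain ⟨σ, hσ, hr, -⟩ := exists_regularize δ μ
  rw [← hr]
  exact Set.infinite_range_of_injective hσ

/-! ### Ranks in an infinite set of magnitudes. -/

theorem place_strictMono {M : Set ℕ} (hM : M.Infinite) : StrictMono (place M) := fun _ _ h =>
  Nat.nth_strictMono hM (PNat.natPred_strictMono h)

theorem place_mem {M : Set ℕ} (hM : M.Infinite) (n : ℕ+) : place M n ∈ M := Nat.nth_mem_of_infinite (p := (· ∈ M)) hM _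

theorem exists_place_eq {M : Set ℕ} {k : ℕ} (hk : k ∈ M) : ∃ n, place M n = k := by
  classical
  refine ⟨(Nat.count (· ∈ M) k).succPNat, ?_⟩
  rw [place, Nat.natPred_succPNat, Nat.nth_count hk]

theorem ncard_le_place {M : Set ℕ} (hM : M.Infinite) (n : ℕ+) : {k | k ∈ M ∧ k ≤ place M n}.ncard = n := by
  have : {k | k ∈ M ∧ k ≤ place M n} = place M '' Set.Iic n := by
    ext k
    constructor
    · rintro ⟨h1, h2⟩
      obtain ⟨m, rfl⟩ := exists_place_eq h1
      exact ⟨m, (place_strictMono hM).le_iff_le.1 h2, rfl⟩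
    · rintro ⟨m, h, rfl⟩
      exact ⟨place_mem hM m, (place_strictMono hM).monotone h⟩
  rw [this, Set.ncard_image_of_injective _ (place_strictMono hM).injective]
  have h2 : Set.Iic n = ((Finset.Icc 1 n : Finset ℕ+) : Set ℕ+) := by
    ext m
    simp
  rw [h2, Set.ncard_coe_finset, PNat.card_Icc]
  simp

theorem place_add_one_le {M : Set ℕ} (hM : M.Infinite) {n : ℕ+} {k : ℕ} (hk : k ∈ M) (h : place M n < k) :
    place M (n + 1) ≤ k := by
  obtain ⟨m, rfl⟩ := exists_place_eq hk
  exact (place_strictMono hM).monotone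
    (PNat.add_one_le_iff.2 ((place_strictMono hM).lt_iff_lt.1 h))

theorem place_one_le {M : Set ℕ} (hM : M.Infinite) {k : ℕ} (hk : k ∈ M) : place M 1 ≤ k := by
  obtain ⟨m, rfl⟩ := exists_place_eq hk
  exact (place_strictMono hM).monotone one_le

/-- The untoggled set consists of the ranks of the positive single magnitudes. -/
theorem mem_untoggled_iff {n : ℕ+} :
    n ∈ untoggled δ μ ↔ place (singleMags δ μ) n ∈ upMags δ μ := by
  have hM := singleMags_infinite δ μ
  obtain ⟨σ, hσ, hr, hv⟩ := exists_regularize δ μ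
  set v := regularize (eMap δ μ)
  have hodd : {j | 0 < v j}.ncard = (posMags δ μ).ncard := by
    rw [← Set.ncard_image_of_injective _ hσ]
    congr 1
    ext k
    constructor
    · rintro ⟨j, hj, rfl⟩
      exact (hv j).2.1 hj
    · intro hk
      have : k ∈ Set.range σ := hr ▸ upMags_subset_singleMags (Or.inl hk)
      obtain ⟨j, rfl⟩ := this
      exact ⟨j, (hv j).2.2 hk, rfl⟩
  -- The injection σ from positions onto single magnitudes is order preserving for |v|, so the rank
  -- of a term is the rank of its magnitude.
  have hcard : ∀ i, {j | |v j| ≤ |v i|}.ncard = {k | k ∈ singleMags δ μ ∧ k ≤ σ i}.ncard := by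
    intro i
    rw [← Set.ncard_image_of_injective _ hσ]
    congr 1
    have hle : ∀ j, |v j| ≤ |v i| ↔ σ j ≤ σ i := fun j => by
      rw [(hv j).1, (hv i).1, div_le_div_iff_of_pos_right two_pos, Nat.cast_le]
    ext k
    constructor
    · rintro ⟨j, hj, rfl⟩
      exact ⟨hr ▸ ⟨j, rfl⟩, (hle j).1 hj⟩
    · rintro ⟨hk, hk'⟩
      rw [← hr] at hk
      obtain ⟨j, rfl⟩ := hk
      exact ⟨j, (hle j).2 hk', rfl⟩
  have hup : ∀ i, (0 < v i ∨ (v i = 0 ∧ Odd {j | 0 < v j}.ncard)) ↔ σ i ∈ upMags δ μ := by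
    intro i
    have h0 : v i = 0 ↔ σ i = 0 := by
      rw [← abs_eq_zero, (hv i).1]
      simp
    rw [(hv i).2, h0, hodd]
    constructor
    · rintro (h | ⟨h, h'⟩)
      · exact Or.inl h
      · refine Or.inr ⟨h, zero_mem_singleMags_iff.1 ?_, h'⟩
        rw [← hr, ← h]
        exact ⟨i, rfl⟩
    · rintro (h | ⟨h, -, h'⟩)
      · exact Or.inl h
      · exact Or.inr ⟨h, h'⟩
  have hn := n.pos
  simp only [untoggled, positiveTerms, Set.mem_ofPred_eq, signedRank]
  constructor
  · rintro ⟨i, hi⟩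
    split_ifs at hi with h
    · obtain ⟨m, hm⟩ := exists_place_eq (show σ i ∈ singleMags δ μ from hr ▸ ⟨i, rfl⟩)
      rw [hcard, ← hm, ncard_le_place hM] at hi
      obtain rfl : m = n := by exact_mod_cast hi
      rw [hm]
      exact (hup i).1 h
    · omega
  · intro h
    obtain ⟨i, hi⟩ : place (singleMags δ μ) n ∈ Set.range σ := hr.symm ▸ place_mem hM n
    refine ⟨i, ?_⟩
    rw [if_pos ((hup i).2 (hi.symm ▸ h)), hcard, hi, ncard_le_place hM]

theorem image_place_untoggled (δ : ℤ) (μ : YoungDiagram) :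
    place (singleMags δ μ) '' untoggled δ μ = upMags δ μ := by
  ext k
  constructor
  · rintro ⟨n, hn, rfl⟩
    exact mem_untoggled_iff.1 hn
  · intro hk
    obtain ⟨n, rfl⟩ := exists_place_eq (upMags_subset_singleMags hk)
    exact ⟨n, mem_untoggled_iff.2 hk, rfl⟩

theorem ncard_untoggled (δ : ℤ) (μ : YoungDiagram) :
    (untoggled δ μ).ncard = (upMags δ μ).ncard := by
  rw [← image_place_untoggled, Set.ncard_image_of_injective _
    (place_strictMono (singleMags_infinite δ μ)).injective]

theorem untoggled_finite (δ : ℤ) (μ : YoungDiagram) : (untoggled δ μ).Finite := by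
  refine Set.Finite.of_finite_image ?_
    (place_strictMono (singleMags_infinite δ μ)).injective.injOn
  rw [image_place_untoggled]
  exact upMags_finite δ μ

/-- The magnitude 0 is counted as positive precisely when the number of the other positive ones is
odd. -/
theorem even_ncard_untoggled (h : 0 ∈ singleMags δ μ) : Even (untoggled δ μ).ncard := by
  rw [ncard_untoggled]
  rw [zero_mem_singleMags_iff] at h
  by_cases ho : Odd (posMags δ μ).ncard
  · have : upMags δ μ = insert 0 (posMags δ μ) := by
      ext k
      simp only [upMags, Set.mem_ofPred_eq, Set.mem_insert_iff]
      tauto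
    rw [this, Set.ncard_insert_of_notMem (fun h => by simp [posMags] at h) (posMags_finite δ μ)]
    exact ho.add_one
  · have : upMags δ μ = posMags δ μ := by
      ext k
      simp only [upMags, Set.mem_ofPred_eq]
      tauto
    rw [this]
    exact Nat.not_odd_iff_even.1 ho

end BrauerBlock

namespace BrauerBlock

variable {δ : ℤ} {μ ν : YoungDiagram}

/-! ### Minimal balanced skews as sign changes -/

/-- The substitution z = 2c - δ turns c ↦ δ - c into z ↦ -z. Integers z of the wrong parity are
never entries, so the conditions on them are vacuous. -/
theorem isMinBalancedSkew_iff_dbl :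
    IsMinBalancedSkew δ μ ν ↔ ∃ x y : ℤ, x < y ∧ -x < y ∧ x ∈ dblSet δ μ ∧ -y ∈ dblSet δ μ ∧
      y ∉ dblSet δ μ ∧ (-x ∈ dblSet δ μ → x = 0) ∧ (x < 0 → 0 ∉ dblSet δ μ) ∧
      (∀ z, x < z → z < y → z ≠ -x → (z ∈ dblSet δ μ ↔ -z ∈ dblSet δ μ)) ∧
      ∀ z, z ∈ dblSet δ ν ↔ (z ∈ dblSet δ μ ∧ z ≠ x ∧ z ≠ -y) ∨ z = y ∨ z = -x := by
  have hneg : ∀ b : ℤ, -(2 * b - δ) = 2 * (δ - b) - δ := fun b => by ring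
  rw [isMinBalancedSkew_iff]
  constructor
  · rintro ⟨p, q, h1, h2, h3, h4, h5, h6, h7, h8, h9⟩
    refine ⟨2 * p - δ, 2 * q - δ, by omega, by omega, two_mul_sub_mem_dblSet_iff.2 h3, ?_, ?_, ?_,
      ?_, ?_, ?_⟩
    · rwa [hneg, two_mul_sub_mem_dblSet_iff]
    · rwa [two_mul_sub_mem_dblSet_iff]
    · rw [hneg, two_mul_sub_mem_dblSet_iff]
      intro h
      have := h6 h
      omega
    · intro h h'
      obtain ⟨c, hc, hc'⟩ := mem_dblSet_iff.1 h'
      exact h7 (by omega) c (by omega) hc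
    · intro z hz1 hz2 hz3
      by_cases hz : ∃ b, z = 2 * b - δ
      · obtain ⟨b, rfl⟩ := hz
        rw [hneg, two_mul_sub_mem_dblSet_iff, two_mul_sub_mem_dblSet_iff]
        exact h8 b (by omega) (by omega) (by omega)
      · have h1 : z ∉ dblSet δ μ := fun h => by
          obtain ⟨b, -, hb⟩ := mem_dblSet_iff.1 h
          exact hz ⟨b, hb⟩
        have h2 : -z ∉ dblSet δ μ := fun h => by
          obtain ⟨b, -, hb⟩ := mem_dblSet_iff.1 h
          exact hz ⟨δ - b, by omega⟩
        tauto
    · intro z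
      by_cases hz : ∃ b, z = 2 * b - δ
      · obtain ⟨b, rfl⟩ := hz
        rw [two_mul_sub_mem_dblSet_iff, two_mul_sub_mem_dblSet_iff, h9, hneg, hneg]
        have e : ∀ a, 2 * b - δ = 2 * a - δ ↔ b = a := fun a => by omega
        simp only [ne_eq, e]
      · have h1 : ∀ κ, z ∉ dblSet δ κ := fun κ h => by
          obtain ⟨b, -, hb⟩ := mem_dblSet_iff.1 h
          exact hz ⟨b, hb⟩
        constructor
        · intro h
          exact absurd h (h1 _)
        · rintro (h | h | h)
          · exact absurd h.1 (h1 _)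
          · exact absurd ⟨_, h⟩ hz
          · exact absurd ⟨_, h.trans (hneg _)⟩ hz
  · rintro ⟨x, y, h1, h2, h3, h4, h5, h6, h7, h8, h9⟩
    obtain ⟨p, hp, rfl⟩ := mem_dblSet_iff.1 h3
    obtain ⟨b, hb, hy⟩ := mem_dblSet_iff.1 h4
    obtain rfl : y = 2 * (δ - b) - δ := by omega
    rw [two_mul_sub_mem_dblSet_iff] at h5
    rw [hneg, two_mul_sub_mem_dblSet_iff] at h6
    refine ⟨p, δ - b, by omega, by omega, hp, by rwa [sub_sub_cancel], h5, ?_, ?_, ?_, ?_⟩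
    · intro h
      have := h6 h
      omega
    · intro h c hc hc'
      refine h7 (by omega) ?_
      rw [← two_mul_sub_mem_dblSet_iff (δ := δ)] at hc'
      rwa [show (0 : ℤ) = 2 * c - δ by omega]
    · intro c hc1 hc2 hc3
      have := h8 (2 * c - δ) (by omega) (by omega) (by omega)
      rwa [hneg, two_mul_sub_mem_dblSet_iff, two_mul_sub_mem_dblSet_iff] at this
    · intro c
      have := h9 (2 * c - δ)
      rw [hneg, hneg, two_mul_sub_mem_dblSet_iff, two_mul_sub_mem_dblSet_iff] at this
      have e : ∀ a, 2 * c - δ = 2 * a - δ ↔ c = a := fun a => by omega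
      simpa only [ne_eq, e] using this

/-- Two diagrams have the same single and the same paired magnitudes. -/
def SameCore (δ : ℤ) (μ ν : YoungDiagram) : Prop :=
  pairedMags δ μ = pairedMags δ ν ∧ singleMags δ μ = singleMags δ ν

theorem SameCore.symm (h : SameCore δ μ ν) : SameCore δ ν μ := ⟨h.1.symm, h.2.symm⟩

theorem SameCore.trans {κ : YoungDiagram} (h : SameCore δ μ ν) (h' : SameCore δ ν κ) :
    SameCore δ μ κ := ⟨h.1.trans h'.1, h.2.trans h'.2⟩

/-- `k` and `l` are consecutive single magnitudes, the sign of `l` changes from `-` to `+`, and that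
of `k` from `+` to `-`, or from `-` to `+` if `k` is the least single magnitude. -/
def IsSignChange (δ : ℤ) (μ ν : YoungDiagram) (k l : ℕ) : Prop :=
  k ∈ singleMags δ μ ∧ l ∈ singleMags δ μ ∧ k < l ∧ (∀ m ∈ singleMags δ μ, k < m → l ≤ m) ∧
    l ∉ upMags δ μ ∧ l ∈ upMags δ ν ∧
    ((k ∈ upMags δ μ ∧ k ∉ upMags δ ν) ∨
      ((∀ m ∈ singleMags δ μ, k ≤ m) ∧ k ∉ upMags δ μ ∧ k ∈ upMags δ ν)) ∧
    ∀ m, m ≠ k → m ≠ l → (m ∈ upMags δ μ ↔ m ∈ upMags δ ν)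

/-- Single magnitudes break the symmetry z ↦ -z, so none of them lies in the symmetric stretch of a
balanced skew. -/
theorem neg_mem_iff_of_mem_singleMags {m : ℕ} (hm : m ∈ singleMags δ μ) (h0 : 0 < m) :
    ¬ ((m : ℤ) ∈ dblSet δ μ ↔ -(m : ℤ) ∈ dblSet δ μ) := by
  simp only [singleMags, pairedMags, Set.mem_ofPred_eq] at hm
  tauto

theorem zero_mem_upMags_iff :
    0 ∈ upMags δ μ ↔ (0 : ℤ) ∈ dblSet δ μ ∧ Odd (posMags δ μ).ncard := by
  simp [upMags, posMags]

/-- Take l = y and k = |x|. The symmetric stretch leaves no single magnitude between k and l, and if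
x < 0 it also covers everything below k, so k is the least one. -/
theorem IsMinBalancedSkew.exists_isSignChange (h : IsMinBalancedSkew δ μ ν) :
    SameCore δ μ ν ∧ ∃ k l, IsSignChange δ μ ν k l := by
  obtain ⟨x, y, hxy, hxy', hx, hy', hy, hx', h0, hmid, hν⟩ := isMinBalancedSkew_iff_dbl.1 h
  obtain ⟨l, rfl⟩ : ∃ l : ℕ, y = l := ⟨y.toNat, by omega⟩
  obtain ⟨k, hk⟩ : ∃ k : ℕ, x = k ∨ x = -k := ⟨x.natAbs, by omega⟩
  have hkl : k < l := by omega
  have hl0 : 0 < l := by omega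
  have hother : ∀ m : ℕ, m ≠ k → m ≠ l →
      ((m : ℤ) ∈ dblSet δ ν ↔ (m : ℤ) ∈ dblSet δ μ) ∧
      (-(m : ℤ) ∈ dblSet δ ν ↔ -(m : ℤ) ∈ dblSet δ μ) := by
    intro m h1 h2
    rw [hν, hν]
    have a1 : (m : ℤ) ≠ x := by omega
    have a2 : (m : ℤ) ≠ -l := by omega
    have a3 : (m : ℤ) ≠ l := by omega
    have a4 : (m : ℤ) ≠ -x := by omega
    have b1 : -(m : ℤ) ≠ x := by omega
    have b2 : -(m : ℤ) ≠ -l := by omega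
    have b3 : -(m : ℤ) ≠ l := by omega
    have b4 : -(m : ℤ) ≠ -x := by omega
    simp only [ne_eq, a1, a2, a3, a4, b1, b2, b3, b4, not_false_eq_true, and_true, or_false,
      and_self]
  have hl1 : (l : ℤ) ∈ dblSet δ ν := (hν _).2 (Or.inr (Or.inl rfl))
  have hl2 : -(l : ℤ) ∉ dblSet δ ν := by
    rw [hν]
    rintro (h | h | h) <;> omega
  have hk1 : -x ∈ dblSet δ ν := (hν _).2 (Or.inr (Or.inr rfl))
  have hk2 : x ≠ 0 → x ∉ dblSet δ ν := by
    intro h'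
    rw [hν]
    rintro (h | h | h) <;> omega
  have hpaired : ∀ m, m ∈ pairedMags δ μ ↔ m ∈ pairedMags δ ν := by
    intro m
    simp only [pairedMags, Set.mem_ofPred_eq]
    rcases eq_or_ne m l with rfl | h1
    · exact ⟨fun h => absurd h.2.1 hy, fun h => absurd h.2.2 hl2⟩
    rcases eq_or_ne m k with rfl | h2
    · rcases Nat.eq_zero_or_pos m with rfl | h3
      · simp
      · have hne : x ≠ 0 := by omega
        have := hk2 hne
        rcases hk with rfl | rfl
        · exact ⟨fun h => absurd (hx' h.2.2) hne, fun h => absurd h.2.1 this⟩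
        · exact ⟨fun h => absurd (hx' (by rw [neg_neg]; exact h.2.1)) hne,
            fun h => absurd h.2.2 this⟩
    rw [(hother m h2 h1).1, (hother m h2 h1).2]
  have hsingle : ∀ m, m ∈ singleMags δ μ ↔ m ∈ singleMags δ ν := by
    intro m
    simp only [singleMags, Set.mem_ofPred_eq, ← hpaired]
    refine and_congr_left fun _ => ?_
    rcases eq_or_ne m l with rfl | h1
    · exact ⟨fun _ => Or.inl hl1, fun _ => Or.inr hy'⟩
    rcases eq_or_ne m k with rfl | h2
    · rcases hk with rfl | rfl
      · exact ⟨fun _ => Or.inr hk1, fun _ => Or.inl hx⟩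
      · rw [neg_neg] at hk1
        exact ⟨fun _ => Or.inl hk1, fun _ => Or.inr hx⟩
    rw [(hother m h2 h1).1, (hother m h2 h1).2]
  have hposother : ∀ m, m ≠ k → m ≠ l → (m ∈ posMags δ μ ↔ m ∈ posMags δ ν) := by
    intro m h1 h2
    simp only [posMags, Set.mem_ofPred_eq]
    rw [(hother m h1 h2).1, (hother m h1 h2).2]
  have hlμ : l ∉ posMags δ μ := fun h => hy h.2.1
  have hlν : l ∈ posMags δ ν := ⟨hl0, hl1, hl2⟩
  have hkM : k ∈ singleMags δ μ := by
    refine ⟨?_, fun h => ?_⟩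
    · rcases hk with rfl | rfl
      · exact Or.inl hx
      · exact Or.inr hx
    · have h3 := h.1
      rcases hk with rfl | rfl
      · have := hx' h.2.2
        omega
      · have := hx' (by rw [neg_neg]; exact h.2.1)
        omega
  have hlM : l ∈ singleMags δ μ := ⟨Or.inr hy', fun h => hy h.2.1⟩
  refine ⟨⟨Set.ext hpaired, Set.ext hsingle⟩, k, l, hkM, hlM, hkl, fun m hm hkm => ?_, ?_, ?_, ?_, ?_⟩
  · by_contra hlt
    exact neg_mem_iff_of_mem_singleMags hm (by omega) (hmid m (by omega) (by omega) (by omega))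
  · rwa [mem_upMags_of_pos hl0]
  · rwa [mem_upMags_of_pos hl0]
  -- For x = 0 the entry 0 stays, but exactly one positive magnitude, l, is gained. This reverses
  -- the parity and with it the conventional sign of 0.
  · rcases Nat.eq_zero_or_pos k with rfl | hk0
    · obtain rfl : x = 0 := by omega
      have hins : posMags δ ν = insert l (posMags δ μ) := by
        ext m
        rw [Set.mem_insert_iff]
        rcases eq_or_ne m l with rfl | h1
        · exact iff_of_true hlν (Or.inl rfl)
        rcases eq_or_ne m 0 with rfl | h2
        · simp [posMags]
          omega
        rw [hposother m h2 h1, or_iff_right h1]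
      rw [zero_mem_upMags_iff, zero_mem_upMags_iff, hins,
        Set.ncard_insert_of_notMem hlμ (posMags_finite δ μ), Nat.odd_add_one]
      have hz : (0 : ℤ) ∈ dblSet δ ν := by simpa using hk1
      by_cases ho : Odd (posMags δ μ).ncard
      · exact Or.inl ⟨⟨hx, ho⟩, fun h => h.2 ho⟩
      · exact Or.inr ⟨fun m _ => Nat.zero_le m, fun h => ho h.2, hz, ho⟩
    · rw [mem_upMags_of_pos hk0, mem_upMags_of_pos hk0]
      have hne : x ≠ 0 := by omega
      rcases hk with rfl | rfl
      · exact Or.inl ⟨⟨hk0, hx, fun h => hne (hx' h)⟩, fun h => h.2.2 hk1⟩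
      · rw [neg_neg] at *
        refine Or.inr ⟨fun m hm => ?_, fun h => h.2.2 hx, hk0, hk1, hk2 hne⟩
        by_contra hlt
        rcases Nat.eq_zero_or_pos m with rfl | hm0
        · exact h0 (by omega) (zero_mem_singleMags_iff.1 hm)
        · exact neg_mem_iff_of_mem_singleMags hm (by omega)
            (hmid m (by omega) (by omega) (by omega))
  · intro m h1 h2
    rcases Nat.eq_zero_or_pos m with rfl | hm0
    · rw [zero_mem_upMags_iff, zero_mem_upMags_iff]
      have hz := (hother 0 h1 h2).1
      rw [Nat.cast_zero] at hz
      rw [hz]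
      refine and_congr_right fun hz' => ?_
      -- An entry 0 excludes x < 0. Then the positive magnitude k is exchanged for l, their number
      -- is unchanged, and so is the sign of 0.
      have hx0 : 0 ≤ x := by
        by_contra hneg
        exact h0 (by omega) hz'
      obtain rfl : x = k := by omega
      have hkne : (k : ℤ) ≠ 0 := by omega
      have hins : posMags δ ν = insert l (posMags δ μ \ {k}) := by
        ext m
        rw [Set.mem_insert_iff, Set.mem_sdiff, Set.mem_singleton_iff]
        rcases eq_or_ne m l with rfl | h3
        · exact iff_of_true hlν (Or.inl rfl)
        rcases eq_or_ne m k with rfl | h4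
        · exact iff_of_false (fun h => hk2 hkne h.2.1) (fun h => h.elim h3 fun h => h.2 rfl)
        rw [hposother m h4 h3, or_iff_right h3, and_iff_left h4]
      rw [hins, Set.ncard_exchange hlμ ⟨by omega, hx, fun h => hkne (hx' h)⟩]
    · rw [mem_upMags_of_pos hm0, mem_upMags_of_pos hm0]
      exact hposother m h1 h2

/-- Take y = l and let x be k or -k, whichever is an entry of `μ`. Magnitudes in between are paired
or absent, hence symmetric. -/
theorem IsSignChange.isMinBalancedSkew (hc : SameCore δ μ ν) {k l : ℕ}
    (h : IsSignChange δ μ ν k l) : IsMinBalancedSkew δ μ ν := by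
  obtain ⟨hkM, hlM, hkl, hbetween, hlμ, hlν, hk, hother⟩ := h
  obtain ⟨hp, hs⟩ := hc
  have hl0 : 0 < l := by omega
  have hdisj : ∀ m ∈ singleMags δ μ, m ∉ pairedMags δ μ := fun m h => h.2
  have hsub : ∀ m ∈ posMags δ μ, m ∈ singleMags δ μ := fun m h =>
    upMags_subset_singleMags (Or.inl h)
  rw [mem_upMags_of_pos hl0] at hlμ hlν
  have c1 : ∀ m : ℕ, 0 < m → ((m : ℤ) ∈ dblSet δ μ ↔ m ∈ pairedMags δ μ ∨ m ∈ posMags δ μ) :=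
    fun m => coe_mem_dblSet_iff
  have c2 : ∀ m : ℕ, 0 < m → ((m : ℤ) ∈ dblSet δ ν ↔ m ∈ pairedMags δ μ ∨ m ∈ posMags δ ν) :=
    fun m hm => by rw [coe_mem_dblSet_iff hm, hp]
  have n1 : ∀ m : ℕ, 0 < m → (-(m : ℤ) ∈ dblSet δ μ ↔
      m ∈ pairedMags δ μ ∨ (m ∈ singleMags δ μ ∧ m ∉ posMags δ μ)) :=
    fun m => neg_coe_mem_dblSet_iff
  have n2 : ∀ m : ℕ, 0 < m → (-(m : ℤ) ∈ dblSet δ ν ↔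
      m ∈ pairedMags δ μ ∨ (m ∈ singleMags δ μ ∧ m ∉ posMags δ ν)) :=
    fun m hm => by rw [neg_coe_mem_dblSet_iff hm, hp, hs]
  have z1 : (0 : ℤ) ∈ dblSet δ ν ↔ (0 : ℤ) ∈ dblSet δ μ := by
    rw [← zero_mem_singleMags_iff, ← zero_mem_singleMags_iff, hs]
  have hpo : ∀ m, 0 < m → m ≠ k → m ≠ l → (m ∈ posMags δ μ ↔ m ∈ posMags δ ν) := by
    intro m h0 h1 h2
    rw [← mem_upMags_of_pos h0, ← mem_upMags_of_pos h0]
    exact hother m h1 h2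
  have hcases : ∀ z : ℤ, z = 0 ∨ ∃ m : ℕ, 0 < m ∧ (z = m ∨ z = -m) := fun z => by
    by_cases hz : z = 0
    · exact Or.inl hz
    · exact Or.inr ⟨z.natAbs, by omega, by omega⟩
  have hsymm : ∀ m : ℕ, 0 < m → m ∉ singleMags δ μ →
      ((m : ℤ) ∈ dblSet δ μ ↔ -(m : ℤ) ∈ dblSet δ μ) := by
    intro m h0 hm
    rw [c1 m h0, n1 m h0]
    have : m ∉ posMags δ μ := fun h => hm (hsub m h)
    simp only [hm, this, false_and]
  have hdl := hdisj l hlM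
  have hdk := hdisj k hkM
  obtain ⟨x, hxk, hx, hx', hneg, hxν⟩ : ∃ x : ℤ, (x = k ∨ x = -k) ∧ x ∈ dblSet δ μ ∧
      (-x ∈ dblSet δ μ → x = 0) ∧ (x < 0 → ∀ m ∈ singleMags δ μ, k ≤ m) ∧
      (0 < k → x ∉ dblSet δ ν ∧ -x ∈ dblSet δ ν) := by
    rcases Nat.eq_zero_or_pos k with rfl | hk0
    · exact ⟨0, by simp, zero_mem_singleMags_iff.1 hkM, fun _ => rfl, fun h => by omega,
        fun h => by omega⟩
    rw [mem_upMags_of_pos hk0, mem_upMags_of_pos hk0] at hk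
    rcases hk with ⟨h1, h2⟩ | ⟨h1, h2, h3⟩
    · refine ⟨k, Or.inl rfl, (c1 k hk0).2 (Or.inr h1), fun h => ?_, fun h => by omega, fun _ => ?_⟩
      · rw [n1 k hk0] at h
        exact (h.elim hdk fun h => h.2 h1).elim
      · rw [n2 k hk0, c2 k hk0]
        exact ⟨fun h => h.elim hdk h2, Or.inr ⟨hkM, h2⟩⟩
    · refine ⟨-k, Or.inr rfl, (n1 k hk0).2 (Or.inr ⟨hkM, h2⟩), fun h => ?_, fun _ => h1, fun _ => ?_⟩
      · rw [neg_neg, c1 k hk0] at h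
        exact (h.elim hdk h2).elim
      · rw [neg_neg, n2 k hk0, c2 k hk0]
        exact ⟨fun h => h.elim hdk fun h => h.2 h3, Or.inr h3⟩
  have hly : (l : ℤ) ∉ dblSet δ μ := by
    rw [c1 l hl0]
    exact fun h => h.elim hdl hlμ
  rw [isMinBalancedSkew_iff_dbl]
  refine ⟨x, l, by omega, by omega, hx, (n1 l hl0).2 (Or.inr ⟨hlM, hlμ⟩), hly, hx', ?_, ?_, ?_⟩
  · intro h h0
    have := hneg h 0 (zero_mem_singleMags_iff.2 h0)
    omega
  · intro z h1 h2 h3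
    rcases hcases z with rfl | ⟨m, hm0, hm⟩
    · simp
    have hmM : m ∉ singleMags δ μ := by
      intro hmM
      have a1 := hbetween m hmM
      have a2 := fun h => hneg h m hmM
      omega
    have := hsymm m hm0 hmM
    rcases hm with rfl | rfl
    · exact this
    · rw [neg_neg]
      exact this.symm
  · intro z
    rcases hcases z with rfl | ⟨m, hm0, hm⟩
    · rw [z1]
      constructor
      · intro h
        by_cases hx0 : x = 0
        · exact Or.inr (Or.inr (by omega))
        · exact Or.inl ⟨h, by omega, by omega⟩
      · rintro (h | h | h)
        · exact h.1
        · omega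
        · rwa [show x = 0 by omega] at hx
    rcases eq_or_ne m l with rfl | hml
    · have a1 := c2 m hm0
      have a2 := n2 m hm0
      rcases hm with rfl | rfl
      · exact iff_of_true (a1.2 (Or.inr hlν)) (Or.inr (Or.inl rfl))
      · refine iff_of_false (fun h => (a2.1 h).elim hdl fun h => h.2 hlν) ?_
        rintro (h | h | h) <;> omega
    rcases eq_or_ne m k with rfl | hmk
    · have hxν := hxν hm0
      by_cases hzx : z = x
      · refine iff_of_false (hzx ▸ hxν.1) ?_
        rintro (h | h | h) <;> omega
      · obtain rfl : z = -x := by omega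
        exact iff_of_true hxν.2 (Or.inr (Or.inr rfl))
    · have e1 : z ≠ x := by omega
      have e2 : z ≠ -l := by omega
      have e3 : z ≠ l := by omega
      have e4 : z ≠ -x := by omega
      have e5 := hpo m hm0 hmk hml
      have : z ∈ dblSet δ ν ↔ z ∈ dblSet δ μ := by
        rcases hm with rfl | rfl
        · rw [c1 m hm0, c2 m hm0, e5]
        · rw [n1 m hm0, n2 m hm0, e5]
      simp only [this, ne_eq, e1, e2, e3, e4, not_false_eq_true, and_true, or_false]

/-! ### Labelled edges -/

/-- One description for both kinds of labels: m + 1 enters and m changes its status, where m may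
enter only if m = 1. It has the shape of `IsSignChange`. -/
theorem exists_labelledEdge_iff {a b : Set ℕ+} :
    (∃ l, LabelledEdge l a b) ↔ ∃ m : ℕ+, m + 1 ∉ a ∧ m + 1 ∈ b ∧
      ((m ∈ a ∧ m ∉ b) ∨ (m = 1 ∧ m ∉ a ∧ m ∈ b)) ∧
      ∀ n, n ≠ m → n ≠ m + 1 → (n ∈ a ↔ n ∈ b) := by
  have hne : ∀ m : ℕ+, m ≠ m + 1 := fun m h => by
    have := congrArg PNat.val h
    simp at this
  have h12 : (1 : ℕ+) + 1 = 2 := rfl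
  constructor
  · rintro ⟨_ | _, h1, h2⟩
    · rename_i m
      have i1 := fun n => Set.ext_iff.1 h1 n
      have i2 := fun n => Set.ext_iff.1 h2 n
      simp only [Set.mem_sdiff, Set.mem_singleton_iff] at i1 i2
      refine ⟨m, ?_, ?_, Or.inl ?_, fun n hn hn' => ?_⟩
      · exact ((i2 _).2 rfl).2
      · exact ((i2 _).2 rfl).1
      · exact (i1 _).2 rfl
      · have := i1 n
        have := i2 n
        tauto
    · have i1 := fun n => Set.ext_iff.1 h1 n
      have i2 := fun n => Set.ext_iff.1 h2 n
      simp only [Set.mem_sdiff, Set.mem_insert_iff, Set.mem_singleton_iff,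
        Set.mem_empty_iff_false, iff_false] at i1 i2
      refine ⟨1, ?_, ?_, Or.inr ⟨rfl, ?_, ?_⟩, fun n hn hn' => ?_⟩
      · exact ((i2 _).2 (Or.inr rfl)).2
      · exact ((i2 _).2 (Or.inr rfl)).1
      · exact ((i2 1).2 (Or.inl rfl)).2
      · exact ((i2 1).2 (Or.inl rfl)).1
      · have := i1 n
        have := i2 n
        rw [h12] at hn'
        tauto
  · rintro ⟨m, h1, h2, h3 | ⟨rfl, h3⟩, h4⟩
    · refine ⟨.num m, Set.ext fun n => ?_, Set.ext fun n => ?_⟩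
      · rw [Set.mem_sdiff, Set.mem_singleton_iff]
        rcases eq_or_ne n m with rfl | hn
        · tauto
        rcases eq_or_ne n (m + 1) with rfl | hn'
        · tauto
        have := h4 n hn hn'
        tauto
      · rw [Set.mem_sdiff, Set.mem_singleton_iff]
        rcases eq_or_ne n (m + 1) with rfl | hn'
        · tauto
        rcases eq_or_ne n m with rfl | hn
        · tauto
        have := h4 n hn hn'
        tauto
    · refine ⟨.oneTwo, Set.ext fun n => ?_, Set.ext fun n => ?_⟩
      · rw [Set.mem_sdiff, Set.mem_empty_iff_false]
        rcases eq_or_ne n 1 with rfl | hn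
        · tauto
        rcases eq_or_ne n (1 + 1) with rfl | hn'
        · tauto
        have := h4 n hn hn'
        tauto
      · rw [Set.mem_sdiff, Set.mem_insert_iff, Set.mem_singleton_iff, ← h12]
        rcases eq_or_ne n 1 with rfl | hn
        · tauto
        rcases eq_or_ne n (1 + 1) with rfl | hn'
        · tauto
        have := h4 n hn hn'
        tauto

/-- `place` is an order isomorphism from the positive integers to the single magnitudes. Consecutive
magnitudes correspond to m and m + 1 and the least one to 1, so sign changes become edges. -/
theorem isMinBalancedSkew_iff_labelledEdge :
    IsMinBalancedSkew δ μ ν ↔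
      SameCore δ μ ν ∧ ∃ l, LabelledEdge l (untoggled δ μ) (untoggled δ ν) := by
  have hM := singleMags_infinite δ μ
  have hmono := place_strictMono hM
  rw [exists_labelledEdge_iff]
  constructor
  · intro h
    obtain ⟨hc, k, l, hk, hl, hkl, hb, h1, h2, h3, h4⟩ := h.exists_isSignChange
    have e : singleMags δ ν = singleMags δ μ := hc.2.symm
    refine ⟨hc, ?_⟩
    obtain ⟨m, rfl⟩ := exists_place_eq hk
    have hm1 : place (singleMags δ μ) (m + 1) = l :=
      le_antisymm (place_add_one_le hM hl hkl)
        (hb _ (place_mem hM _) (hmono (PNat.lt_add_right m 1)))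
    refine ⟨m, ?_, ?_, ?_, fun n hn hn' => ?_⟩
    · rwa [mem_untoggled_iff, hm1]
    · rwa [mem_untoggled_iff, e, hm1]
    · rw [mem_untoggled_iff, mem_untoggled_iff, e]
      rcases h3 with h3 | ⟨h3, h5⟩
      · exact Or.inl h3
      · refine Or.inr ⟨?_, h5⟩
        exact le_antisymm (hmono.le_iff_le.1 (h3 _ (place_mem hM 1))) one_le
    · rw [mem_untoggled_iff, mem_untoggled_iff, e]
      refine h4 _ (fun h => hn (hmono.injective h)) (fun h => hn' (hmono.injective (h.trans hm1.symm)))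
  · rintro ⟨hc, m, h1, h2, h3, h4⟩
    have e : singleMags δ ν = singleMags δ μ := hc.2.symm
    simp only [mem_untoggled_iff, e] at h1 h2 h3 h4
    refine IsSignChange.isMinBalancedSkew hc (k := place (singleMags δ μ) m)
      (l := place (singleMags δ μ) (m + 1)) ⟨place_mem hM _, place_mem hM _,
        hmono (PNat.lt_add_right m 1), fun k hk hmk => place_add_one_le hM hk hmk, h1, h2, ?_, ?_⟩
    · rcases h3 with h3 | ⟨rfl, h3⟩
      · exact Or.inl h3
      · exact Or.inr ⟨fun k hk => place_one_le hM hk, h3⟩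
    · intro k hk hk'
      by_cases hkM : k ∈ singleMags δ μ
      · obtain ⟨n, rfl⟩ := exists_place_eq hkM
        exact h4 n (fun h => hk (h ▸ rfl)) (fun h => hk' (h ▸ rfl))
      · have a1 : k ∉ upMags δ μ := fun h => hkM (upMags_subset_singleMags h)
        have a2 : k ∉ upMags δ ν := fun h => hkM (e ▸ upMags_subset_singleMags h)
        tauto

end BrauerBlock

namespace BrauerBlock

variable {δ : ℤ} {μ ν : YoungDiagram}

/-! ### Realizing sign patterns -/

theorem eq_of_sameCore_of_posMags (hc : SameCore δ μ ν) (h : posMags δ μ = posMags δ ν) :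
    μ = ν := by
  refine eq_of_dblSet_eq (δ := δ) fun z => ?_
  rcases lt_trichotomy z 0 with hz | rfl | hz
  · obtain ⟨k, rfl⟩ : ∃ k : ℕ, z = -k := ⟨z.natAbs, by omega⟩
    rw [neg_coe_mem_dblSet_iff (by omega), neg_coe_mem_dblSet_iff (by omega), hc.1, hc.2, h]
  · rw [← zero_mem_singleMags_iff, ← zero_mem_singleMags_iff, hc.2]
  · obtain ⟨k, rfl⟩ : ∃ k : ℕ, z = k := ⟨z.natAbs, by omega⟩
    rw [coe_mem_dblSet_iff (by omega), coe_mem_dblSet_iff (by omega), hc.1, h]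

/-- The signs of the nonzero single magnitudes already determine the diagram; the sign of 0 carries
no information. -/
theorem eq_of_sameCore_of_untoggled (hc : SameCore δ μ ν) (h : untoggled δ μ = untoggled δ ν) :
    μ = ν := by
  refine eq_of_sameCore_of_posMags hc (Set.ext fun k => ?_)
  have hup : upMags δ μ = upMags δ ν := by
    rw [← image_place_untoggled, ← image_place_untoggled, hc.2, h]
  rcases Nat.eq_zero_or_pos k with rfl | hk
  · simp [posMags]
  · rw [← mem_upMags_of_pos hk, ← mem_upMags_of_pos hk, hup]

/-- The bead b of magnitude k is moved to δ - b, which is free because k is not paired. No other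
magnitude is affected. -/
theorem exists_flip_one {k : ℕ} (hk : k ∈ singleMags δ μ) (hk0 : 0 < k) :
    ∃ ν, SameCore δ μ ν ∧ posMags δ ν = symmDiff (posMags δ μ) {k} := by
  obtain ⟨z, hzk, hz, hz'⟩ : ∃ z : ℤ, (z = k ∨ z = -k) ∧ z ∈ dblSet δ μ ∧ -z ∉ dblSet δ μ := by
    obtain ⟨h1 | h1, h2⟩ := hk
    · exact ⟨k, Or.inl rfl, h1, fun h => h2 ⟨hk0, h1, h⟩⟩
    · exact ⟨-k, Or.inr rfl, h1, fun h => h2 ⟨hk0, by rwa [neg_neg] at h, h1⟩⟩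
  obtain ⟨b, hb, rfl⟩ := mem_dblSet_iff.1 hz
  have hneg : -(2 * b - δ) = 2 * (δ - b) - δ := by ring
  rw [hneg, two_mul_sub_mem_dblSet_iff] at hz'
  obtain ⟨ν, hν⟩ := exists_move μ hb hz'
  have hE : ∀ w : ℤ, w ∈ dblSet δ ν ↔
      (w ∈ dblSet δ μ ∧ w ≠ 2 * b - δ) ∨ w = -(2 * b - δ) := by
    intro w
    constructor
    · intro h
      obtain ⟨c, hc, rfl⟩ := mem_dblSet_iff.1 h
      rw [two_mul_sub_mem_dblSet_iff]
      rcases (hν c).1 hc with h | h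
      · exact Or.inl ⟨h.1, by omega⟩
      · exact Or.inr (by omega)
    · rintro (⟨h1, h2⟩ | h)
      · obtain ⟨c, hc, rfl⟩ := mem_dblSet_iff.1 h1
        rw [two_mul_sub_mem_dblSet_iff, hν]
        exact Or.inl ⟨hc, by omega⟩
      · rw [h, hneg, two_mul_sub_mem_dblSet_iff, hν]
        exact Or.inr rfl
  rw [← two_mul_sub_mem_dblSet_iff (δ := δ), ← hneg] at hz'
  generalize 2 * b - δ = z at *
  have hother : ∀ m : ℕ, m ≠ k → ((m : ℤ) ∈ dblSet δ ν ↔ (m : ℤ) ∈ dblSet δ μ) ∧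
      (-(m : ℤ) ∈ dblSet δ ν ↔ -(m : ℤ) ∈ dblSet δ μ) := by
    intro m hm
    have a1 : (m : ℤ) ≠ z := by omega
    have a2 : (m : ℤ) ≠ -z := by omega
    have a3 : -(m : ℤ) ≠ z := by omega
    have a4 : -(m : ℤ) ≠ -z := by omega
    simp only [hE, ne_eq, a1, a2, a3, a4, not_false_eq_true, and_true, or_false, and_self]
  have hzν : z ∉ dblSet δ ν := by
    rw [hE]
    rintro (h | h)
    · exact h.2 rfl
    · omega
  have hzν' : -z ∈ dblSet δ ν := (hE _).2 (Or.inr rfl)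
  have hpaired : pairedMags δ μ = pairedMags δ ν := by
    ext m
    simp only [pairedMags, Set.mem_ofPred_eq]
    rcases eq_or_ne m k with rfl | hm
    · rcases hzk with rfl | rfl
      · exact iff_of_false (fun h => hz' h.2.2) (fun h => hzν h.2.1)
      · rw [neg_neg] at hz'
        exact iff_of_false (fun h => hz' h.2.1) (fun h => hzν h.2.2)
    · rw [(hother m hm).1, (hother m hm).2]
  refine ⟨ν, ⟨hpaired, ?_⟩, ?_⟩
  · ext m
    simp only [singleMags, Set.mem_ofPred_eq, ← hpaired]
    refine and_congr_left fun _ => ?_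
    rcases eq_or_ne m k with rfl | hm
    · rcases hzk with rfl | rfl
      · exact iff_of_true (Or.inl hz) (Or.inr hzν')
      · rw [neg_neg] at hzν'
        exact iff_of_true (Or.inr hz) (Or.inl hzν')
    · rw [(hother m hm).1, (hother m hm).2]
  · ext m
    rw [Set.mem_symmDiff, Set.mem_singleton_iff]
    rcases eq_or_ne m k with rfl | hm
    · simp only [not_true_eq_false, and_false, true_and, false_or]
      rcases hzk with rfl | rfl
      · exact iff_of_false (fun h => hzν h.2.1) (fun h => h ⟨hk0, hz, hz'⟩)
      · rw [neg_neg] at hzν'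
        exact iff_of_true ⟨hk0, hzν', hzν⟩ (fun h => h.2.2 hz)
    · simp only [hm, not_false_eq_true, and_true, false_and, or_false]
      simp only [posMags, Set.mem_ofPred_eq]
      rw [(hother m hm).1, (hother m hm).2]

theorem exists_flip_finset (T : Finset ℕ) (hT : ∀ k ∈ T, k ∈ singleMags δ μ ∧ 0 < k) :
    ∃ ν, SameCore δ μ ν ∧ posMags δ ν = symmDiff (posMags δ μ) T := by
  induction T using Finset.induction_on with
  | empty => exact ⟨μ, ⟨rfl, rfl⟩, by ext; simp [Set.mem_symmDiff]⟩
  | insert k T hk ih =>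
    obtain ⟨ν, hc, hν⟩ := ih fun m hm => hT m (Finset.mem_insert_of_mem hm)
    obtain ⟨h1, h2⟩ := hT k (Finset.mem_insert_self k T)
    rw [hc.2] at h1
    obtain ⟨κ, hc', hκ⟩ := exists_flip_one h1 h2
    refine ⟨κ, hc.trans hc', ?_⟩
    rw [hκ, hν]
    ext m
    simp only [Set.mem_symmDiff, Set.mem_singleton_iff, Finset.coe_insert, Set.mem_insert_iff,
      Finset.mem_coe]
    by_cases h : m = k
    · subst h
      tauto
    · tauto

/-- Every finite set of nonzero single magnitudes is the set of positive ones for some diagram with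
the same core. -/
theorem exists_posMags_eq {Q : Set ℕ} (hQ : Q.Finite) (h : ∀ k ∈ Q, k ∈ singleMags δ μ ∧ 0 < k) :
    ∃ ν, SameCore δ μ ν ∧ posMags δ ν = Q := by
  have hfin : (symmDiff (posMags δ μ) Q).Finite := by
    rw [Set.symmDiff_def]
    exact (posMags_finite δ μ).sdiff.union hQ.sdiff
  obtain ⟨ν, hc, hν⟩ := exists_flip_finset (δ := δ) (μ := μ) hfin.toFinset (by
    intro k hk
    rw [Set.Finite.mem_toFinset, Set.mem_symmDiff] at hk
    rcases hk with hk | hk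
    · exact ⟨upMags_subset_singleMags (Or.inl hk.1), hk.1.1⟩
    · exact h k hk.1)
  refine ⟨ν, hc, ?_⟩
  rw [hν, Set.Finite.coe_toFinset, symmDiff_symmDiff_cancel_left]

/-- Finite sets of the same parity that agree away from `1` are equal. -/
theorem eq_of_even_iff_of_forall_ne_one {a b : Set ℕ+} (ha : a.Finite) (hb : b.Finite)
    (hpar : Even a.ncard ↔ Even b.ncard) (h : ∀ n, n ≠ 1 → (n ∈ a ↔ n ∈ b)) : a = b := by
  have key : a \ {1} = b \ {1} := by
    ext n
    simp only [Set.mem_sdiff, Set.mem_singleton_iff]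
    exact and_congr_left (h n)
  have h1 : (1 : ℕ+) ∈ a ↔ 1 ∈ b := by
    by_cases h1 : (1 : ℕ+) ∈ a <;> by_cases h2 : (1 : ℕ+) ∈ b
    · exact iff_of_true h1 h2
    · have e1 := Set.ncard_sdiff_singleton_add_one h1 ha
      rw [key, Set.sdiff_singleton_eq_self h2] at e1
      rw [← e1, Nat.even_add_one] at hpar
      tauto
    · have e1 := Set.ncard_sdiff_singleton_add_one h2 hb
      rw [← key, Set.sdiff_singleton_eq_self h1] at e1
      rw [← e1, Nat.even_add_one] at hpar
      tauto
    · exact iff_of_false h1 h2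
  ext n
  rcases eq_or_ne n 1 with rfl | hn
  · exact h1
  · exact h n hn

/-- Signs of nonzero single magnitudes can be prescribed at will. If 0 is a single magnitude it has
rank 1 and its sign follows from parity, which is where `hpar` is needed. -/
theorem exists_untoggled_eq {a : Set ℕ+} (ha : a.Finite)
    (hpar : Even a.ncard ↔ Even (untoggled δ μ).ncard) :
    ∃ ν, SameCore δ μ ν ∧ untoggled δ ν = a := by
  have hM := singleMags_infinite δ μ
  have hmono := place_strictMono hM
  obtain ⟨ν, hc, hν⟩ := exists_posMags_eq (δ := δ) (μ := μ)
    (Q := {k | k ∈ place (singleMags δ μ) '' a ∧ 0 < k})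
    ((ha.image _).subset fun k hk => hk.1) (by
      rintro k ⟨⟨n, -, rfl⟩, h⟩
      exact ⟨place_mem hM n, h⟩)
  refine ⟨ν, hc, ?_⟩
  have hpos : ∀ n, 0 < place (singleMags δ μ) n → (n ∈ untoggled δ ν ↔ n ∈ a) := by
    intro n hn
    rw [mem_untoggled_iff, ← hc.2, mem_upMags_of_pos hn, hν]
    constructor
    · rintro ⟨⟨m, hm, h⟩, -⟩
      rwa [← hmono.injective h]
    · exact fun h => ⟨⟨n, h, rfl⟩, hn⟩
  by_cases h0 : 0 ∈ singleMags δ μ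
  · refine eq_of_even_iff_of_forall_ne_one (untoggled_finite δ ν) ha ?_ fun n hn => hpos n ?_
    · exact iff_of_true (even_ncard_untoggled (hc.2 ▸ h0)) (hpar.2 (even_ncard_untoggled h0))
    · exact (Nat.zero_le _).trans_lt (hmono (lt_of_le_of_ne one_le hn.symm))
  · ext n
    refine hpos n (Nat.pos_of_ne_zero fun h => h0 ?_)
    rw [← h]
    exact place_mem hM n

/-! ### Blocks -/

theorem LabelledEdge.finite {l : EdgeLabel} {a b : Set ℕ+} (h : LabelledEdge l a b) :
    (a.Finite ↔ b.Finite) := by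
  have h1 : (a \ b).Finite := by
    cases l <;> rw [h.1]
    · exact Set.finite_singleton _
    · exact Set.finite_empty
  have h2 : (b \ a).Finite := by
    cases l <;> rw [h.2]
    · exact Set.finite_singleton _
    · exact Set.toFinite _
  constructor
  · intro ha
    exact (h2.union ha).subset fun n hn => by
      by_cases hna : n ∈ a
      · exact Or.inr hna
      · exact Or.inl ⟨hn, hna⟩
  · intro hb
    exact (h1.union hb).subset fun n hn => by
      by_cases hnb : n ∈ b
      · exact Or.inr hnb
      · exact Or.inl ⟨hn, hnb⟩

theorem LabelledEdge.even_iff {l : EdgeLabel} {a b : Set ℕ+} (h : LabelledEdge l a b)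
    (ha : a.Finite) : Even a.ncard ↔ Even b.ncard := by
  have hb := h.finite.1 ha
  have e1 := Set.ncard_inter_add_ncard_sdiff_eq_ncard a b ha
  have e2 := Set.ncard_inter_add_ncard_sdiff_eq_ncard b a hb
  rw [Set.inter_comm] at e2
  cases l with
  | num α =>
    rw [h.1, Set.ncard_singleton] at e1
    rw [h.2, Set.ncard_singleton] at e2
    rw [← e1, ← e2]
  | oneTwo =>
    rw [h.1, Set.ncard_empty] at e1
    rw [h.2, Set.ncard_pair (by decide)] at e2
    rw [← e1, ← e2, Nat.even_add, Nat.even_add]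
    simp

/-- Let m + 1 be the least element other than 1. If m is missing, lower m + 1 to m; otherwise
minimality gives m = 1, and 1 and 2 are deleted. -/
theorem exists_predecessor {a : Set ℕ+} (h0 : a ≠ ∅) (h1 : a ≠ {1}) :
    ∃ a' l, LabelledEdge l a' a := by
  obtain ⟨n, ⟨hna, hn1⟩, hmin⟩ : ∃ n, (n ∈ a ∧ n ≠ 1) ∧ ∀ m, m ∈ a ∧ m ≠ 1 → n ≤ m := by
    have hne : {m | m ∈ a ∧ m ≠ 1}.Nonempty := by
      obtain ⟨m, hm⟩ := Set.nonempty_iff_ne_empty.2 h0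
      by_contra hemp
      have hall : ∀ m ∈ a, m = 1 := fun m hm => by
        by_contra hm1
        exact hemp ⟨m, hm, hm1⟩
      refine h1 (Set.Subset.antisymm hall ?_)
      rintro _ rfl
      exact hall m hm ▸ hm
    exact ⟨WellFounded.min wellFounded_lt _ hne, WellFounded.min_mem _ _ hne,
      fun m hm => WellFounded.min_le (s := {m | m ∈ a ∧ m ≠ 1}) _ hm⟩
  obtain ⟨m, rfl⟩ := PNat.exists_eq_succ_of_ne_one hn1
  have hlt : m < m + 1 := PNat.lt_add_right m 1
  by_cases hm : m ∈ a
  · obtain rfl : m = 1 := by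
      by_contra hne
      exact absurd (hmin m ⟨hm, hne⟩) (not_le.2 hlt)
    refine ⟨a \ {1, 2}, .oneTwo, ?_, ?_⟩
    · ext n
      simp
    · ext n
      have h2 : (2 : ℕ+) ∈ a := hna
      simp only [Set.mem_sdiff, Set.mem_insert_iff, Set.mem_singleton_iff, not_and, not_not]
      constructor
      · rintro ⟨h3, h4⟩
        exact h4 h3
      · rintro (rfl | rfl)
        · exact ⟨hm, fun _ => Or.inl rfl⟩
        · exact ⟨h2, fun _ => Or.inr rfl⟩
  · refine ⟨insert m (a \ {m + 1}), .num m, ?_, ?_⟩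
    · ext n
      simp only [Set.mem_sdiff, Set.mem_insert_iff, Set.mem_singleton_iff]
      constructor
      · rintro ⟨h3 | h3, h4⟩
        · exact h3
        · exact absurd h3.1 h4
      · rintro rfl
        exact ⟨Or.inl rfl, hm⟩
    · ext n
      simp only [Set.mem_sdiff, Set.mem_insert_iff, Set.mem_singleton_iff, not_or, not_and, not_not]
      constructor
      · rintro ⟨h3, -, h4⟩
        exact h4 h3
      · rintro rfl
        exact ⟨hna, hlt.ne', fun _ => rfl⟩

/-- A property that holds when the sign pattern is minimal and that is inherited along minimal
balanced skews holds for all diagrams. -/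
theorem skew_induction (δ : ℤ) {P : YoungDiagram → Prop}
    (base : ∀ μ, untoggled δ μ = ∅ ∨ untoggled δ μ = {1} → P μ)
    (step : ∀ μ ν, IsMinBalancedSkew δ μ ν → P μ → P ν) (μ : YoungDiagram) : P μ := by
  -- Induction on the number of boxes: the predecessor of the pattern is realized with the same
  -- core, hence by a smaller diagram.
  induction hn : μ.cells.card using Nat.strong_induction_on generalizing μ with
  | _ n ih =>
    by_cases h0 : untoggled δ μ = ∅
    · exact base μ (Or.inl h0)
    by_cases h1 : untoggled δ μ = {1}
    · exact base μ (Or.inr h1)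
    obtain ⟨a, l, hl⟩ := exists_predecessor h0 h1
    have ha := hl.finite.2 (untoggled_finite δ μ)
    obtain ⟨ν, hc, rfl⟩ := exists_untoggled_eq (δ := δ) (μ := μ) ha (hl.even_iff ha)
    have hskew : IsMinBalancedSkew δ ν μ :=
      isMinBalancedSkew_iff_labelledEdge.2 ⟨hc.symm, l, hl⟩
    refine step ν μ hskew (ih _ ?_ ν rfl)
    rw [← hn]
    refine Finset.card_lt_card ((Finset.ssubset_iff_subset_ne).2 ⟨hskew.1, fun he => ?_⟩)
    obtain rfl : ν = μ := YoungDiagram.ext he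
    cases l with
    | num α =>
      have := hl.1
      rw [Set.sdiff_self] at this
      exact (Set.singleton_ne_empty _).symm this
    | oneTwo =>
      have := hl.2
      rw [Set.sdiff_self] at this
      exact (Set.insert_nonempty _ _).ne_empty.symm this

theorem IsMinBalancedSkew.eqvGen (h : IsMinBalancedSkew δ μ ν) :
    Relation.EqvGen (ltDelta δ) μ ν := .rel _ _ (.single h)

theorem exists_minimal_eqvGen (δ : ℤ) (μ : YoungDiagram) :
    ∃ ν, Relation.EqvGen (ltDelta δ) μ ν ∧ (untoggled δ ν = ∅ ∨ untoggled δ ν = {1}) := by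
  induction μ using skew_induction δ with
  | base μ h => exact ⟨μ, .refl _, h⟩
  | step μ κ hs ih =>
    obtain ⟨ν, h1, h2⟩ := ih
    exact ⟨ν, .trans _ _ _ (.symm _ _ hs.eqvGen) h1, h2⟩

/-- Blocks are determined by the core and the parity of the sign pattern. -/
theorem mem_block_iff {lam : YoungDiagram} :
    μ ∈ block δ lam ↔ SameCore δ lam μ ∧
      (Even (untoggled δ lam).ncard ↔ Even (untoggled δ μ).ncard) := by
  have hskew : ∀ {μ ν : YoungDiagram}, IsMinBalancedSkew δ μ ν →
      SameCore δ μ ν ∧ (Even (untoggled δ μ).ncard ↔ Even (untoggled δ ν).ncard) := by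
    intro μ ν h
    obtain ⟨hc, l, hl⟩ := isMinBalancedSkew_iff_labelledEdge.1 h
    exact ⟨hc, hl.even_iff (untoggled_finite δ μ)⟩
  have hgen : ∀ {μ ν : YoungDiagram}, Relation.EqvGen (ltDelta δ) μ ν →
      SameCore δ μ ν ∧ (Even (untoggled δ μ).ncard ↔ Even (untoggled δ ν).ncard) := by
    intro μ ν h
    induction h with
    | rel μ ν h =>
      induction h with
      | single h => exact hskew h
      | tail _ h ih =>
        have := hskew h
        exact ⟨ih.1.trans this.1, ih.2.trans this.2⟩
    | refl μ => exact ⟨⟨rfl, rfl⟩, Iff.rfl⟩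
    | symm μ ν _ ih => exact ⟨ih.1.symm, ih.2.symm⟩
    | trans μ ν κ _ _ ih ih' => exact ⟨ih.1.trans ih'.1, ih.2.trans ih'.2⟩
  refine ⟨hgen, ?_⟩
  rintro ⟨hc, hpar⟩
  obtain ⟨lam₀, h1, h2⟩ := exists_minimal_eqvGen δ lam
  obtain ⟨μ₀, h3, h4⟩ := exists_minimal_eqvGen δ μ
  have g1 := hgen h1
  have g2 := hgen h3
  -- Both diagrams are linked to diagrams with pattern ∅ or {1}; equal parity makes these patterns
  -- equal, and equal cores then make the diagrams equal.
  obtain rfl : lam₀ = μ₀ := by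
    refine eq_of_sameCore_of_untoggled ((g1.1.symm.trans hc).trans g2.1) ?_
    have e := g1.2.symm.trans (hpar.trans g2.2)
    rcases h2 with h2 | h2 <;> rcases h4 with h4 | h4
    · rw [h2, h4]
    · rw [h2, h4] at e
      simp at e
    · rw [h2, h4] at e
      simp at e
    · rw [h2, h4]
  exact .trans _ _ _ h1 (.symm _ _ h3)

/-! ### The toggle map -/

theorem even_symmDiff_singleton_iff {α : Type*} {a : Set α} (ha : a.Finite) (x : α) :
    Even (symmDiff a {x}).ncard ↔ ¬ Even a.ncard := by
  by_cases h : x ∈ a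
  · have : symmDiff a {x} = a \ {x} := by
      ext n
      rcases eq_or_ne n x with rfl | hn
      · simp [Set.mem_symmDiff, h]
      · simp [Set.mem_symmDiff, hn]
    have e := Set.ncard_sdiff_singleton_add_one h ha
    rw [this, ← e, Nat.even_add_one, not_not]
  · have : symmDiff a {x} = insert x a := by
      ext n
      rcases eq_or_ne n x with rfl | hn
      · simp [Set.mem_symmDiff, h]
      · simp [Set.mem_symmDiff, hn]
    rw [this, Set.ncard_insert_of_notMem h ha, Nat.even_add_one]

theorem toggle_toggle (a : Set ℕ+) : toggle (toggle a) = a :=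
  symmDiff_symmDiff_cancel_right {1} a

theorem one_mem_toggle_iff {a : Set ℕ+} : 1 ∈ toggle a ↔ 1 ∉ a := by
  simp [toggle, Set.mem_symmDiff]

theorem mem_toggle_iff_of_ne_one {a : Set ℕ+} {n : ℕ+} (hn : n ≠ 1) : n ∈ toggle a ↔ n ∈ a := by
  simp [toggle, Set.mem_symmDiff, hn]

theorem toggle_finite {a : Set ℕ+} (ha : a.Finite) : (toggle a).Finite := by
  rw [toggle, Set.symmDiff_def]
  exact ha.sdiff.union (Set.toFinite _).sdiff

theorem even_toggle_iff {a : Set ℕ+} (ha : a.Finite) :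
    Even (toggle a).ncard ↔ ¬ Even a.ncard := even_symmDiff_singleton_iff ha 1

/-- Toggling 1 interchanges the two kinds of edges at m = 1, the one replacing 1 by 2 and the one
adding {1, 2}; all other edges keep their label. -/
theorem exists_labelledEdge_toggle {a b : Set ℕ+} (h : ∃ l, LabelledEdge l a b) :
    ∃ l, LabelledEdge l (toggle a) (toggle b) := by
  rw [exists_labelledEdge_iff] at h ⊢
  obtain ⟨m, h1, h2, h3, h4⟩ := h
  have hm : m + 1 ≠ 1 := (lt_of_le_of_lt (one_le (a := m)) (PNat.lt_add_right m 1)).ne'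
  refine ⟨m, ?_, ?_, ?_, fun n hn hn' => ?_⟩
  · rwa [mem_toggle_iff_of_ne_one hm]
  · rwa [mem_toggle_iff_of_ne_one hm]
  · rcases eq_or_ne m 1 with rfl | hm1
    · rw [one_mem_toggle_iff, one_mem_toggle_iff]
      tauto
    · rw [mem_toggle_iff_of_ne_one hm1, mem_toggle_iff_of_ne_one hm1]
      exact h3
  · rcases eq_or_ne n 1 with rfl | hn1
    · rw [one_mem_toggle_iff, one_mem_toggle_iff, h4 1 hn hn']
    · rw [mem_toggle_iff_of_ne_one hn1, mem_toggle_iff_of_ne_one hn1]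
      exact h4 n hn hn'

theorem exists_labelledEdge_toggle_iff {a b : Set ℕ+} :
    (∃ l, LabelledEdge l (toggle a) (toggle b)) ↔ ∃ l, LabelledEdge l a b := by
  refine ⟨fun h => ?_, exists_labelledEdge_toggle⟩
  have := exists_labelledEdge_toggle h
  rwa [toggle_toggle, toggle_toggle] at this

/-- The toggle map as an isomorphism from `G_odd` to `G_even`. -/
noncomputable def toggleIso : DigraphIso graphOdd graphEven where
  toFun a := ⟨toggle a, toggle_finite a.2.1,
    (even_toggle_iff a.2.1).2 (Nat.not_even_iff_odd.2 a.2.2)⟩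
  invFun a := ⟨toggle a, toggle_finite a.2.1,
    Nat.not_even_iff_odd.1 fun h => (even_toggle_iff a.2.1).1 h a.2.2⟩
  left_inv _ := Subtype.ext (toggle_toggle _)
  right_inv _ := Subtype.ext (toggle_toggle _)
  map_rel_iff' := exists_labelledEdge_toggle_iff

/-! ### Block graphs -/

theorem sameCore_of_mem_block {lam : YoungDiagram} (hμ : μ ∈ block δ lam) (hν : ν ∈ block δ lam) :
    SameCore δ μ ν :=
  (mem_block_iff.1 hμ).1.symm.trans (mem_block_iff.1 hν).1

theorem untoggled_bijOn (δ : ℤ) (lam : YoungDiagram) :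
    Set.BijOn (untoggled δ) (block δ lam)
      {a | a.Finite ∧ (Even (untoggled δ lam).ncard ↔ Even a.ncard)} := by
  refine ⟨fun μ hμ => ⟨untoggled_finite δ μ, (mem_block_iff.1 hμ).2⟩, fun μ hμ ν hν h =>
    eq_of_sameCore_of_untoggled (sameCore_of_mem_block hμ hν) h, ?_⟩
  rintro a ⟨ha, hpar⟩
  obtain ⟨ν, hc, rfl⟩ := exists_untoggled_eq (δ := δ) (μ := lam) ha hpar.symm
  exact ⟨ν, mem_block_iff.2 ⟨hc, hpar⟩, rfl⟩

theorem adj_blockGraph_iff {lam : YoungDiagram} (μ ν : block δ lam) :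
    (blockGraph δ lam).Adj μ ν ↔ ∃ l, LabelledEdge l (untoggled δ μ) (untoggled δ ν) := by
  refine isMinBalancedSkew_iff_labelledEdge.trans (and_iff_right ?_)
  exact sameCore_of_mem_block μ.2 ν.2

theorem exists_iso_graphEven {lam : YoungDiagram} (h : Even (untoggled δ lam).ncard) :
    ∃ Φ : DigraphIso (blockGraph δ lam) graphEven, ∀ ν, (Φ ν : Set ℕ+) = untoggled δ ν := by
  have hb := untoggled_bijOn δ lam
  have hs : {a : Set ℕ+ | a.Finite ∧ (Even (untoggled δ lam).ncard ↔ Even a.ncard)} =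
      evenSubsets := by
    ext a
    simp only [evenSubsets, Set.mem_ofPred_eq, h, true_iff]
  rw [hs] at hb
  refine ⟨⟨hb.equiv, ?_⟩, fun ν => rfl⟩
  intro μ ν
  exact (adj_blockGraph_iff μ ν).symm

theorem exists_iso_graphOdd {lam : YoungDiagram} (h : Odd (untoggled δ lam).ncard) :
    ∃ Φ : DigraphIso (blockGraph δ lam) graphOdd, ∀ ν, (Φ ν : Set ℕ+) = untoggled δ ν := by
  have hb := untoggled_bijOn δ lam
  have hs : {a : Set ℕ+ | a.Finite ∧ (Even (untoggled δ lam).ncard ↔ Even a.ncard)} =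
      oddSubsets := by
    ext a
    simp only [oddSubsets, Set.mem_ofPred_eq, ← Nat.not_even_iff_odd] at h ⊢
    simp only [h, false_iff]
  rw [hs] at hb
  refine ⟨⟨hb.equiv, ?_⟩, fun ν => rfl⟩
  intro μ ν
  exact (adj_blockGraph_iff μ ν).symm

/-- The parity of the pattern is constant on a block, so `oMap` toggles either everywhere on it or
nowhere. -/
theorem exists_iso_oMap (δ : ℤ) (lam : YoungDiagram) :
    ∃ Φ : DigraphIso (blockGraph δ lam) graphEven,
      (∀ ν, (Φ ν : Set ℕ+) = oMap δ ν) ∧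
      (Even (untoggled δ lam).ncard → ∀ ν, (Φ ν : Set ℕ+) = untoggled δ ν) ∧
      (Odd (untoggled δ lam).ncard →
        ∃ Φ' : DigraphIso (blockGraph δ lam) graphOdd,
          (∀ ν, (Φ' ν : Set ℕ+) = untoggled δ ν) ∧ ∀ ν, Φ ν = toggleIso (Φ' ν)) := by
  by_cases h : Even (untoggled δ lam).ncard
  · obtain ⟨Φ, hΦ⟩ := exists_iso_graphEven h
    refine ⟨Φ, fun ν => ?_, fun _ => hΦ, fun h' => absurd h (Nat.not_even_iff_odd.2 h')⟩
    rw [hΦ, oMap, if_neg (Nat.not_odd_iff_even.2 ((mem_block_iff.1 ν.2).2.1 h))]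
  · have h' := Nat.not_even_iff_odd.1 h
    obtain ⟨Φ', hΦ'⟩ := exists_iso_graphOdd h'
    refine ⟨Φ'.trans toggleIso, fun ν => ?_, fun h'' => absurd h'' h,
      fun _ => ⟨Φ', hΦ', fun ν => rfl⟩⟩
    rw [oMap, if_pos (Nat.not_even_iff_odd.1 fun h'' => h ((mem_block_iff.1 ν.2).2.2 h'')), ← hΦ']
    rfl

theorem oMap_bijOn (δ : ℤ) (lam : YoungDiagram) :
    Set.BijOn (oMap δ) (block δ lam) evenSubsets := by
  obtain ⟨Φ, hΦ, -⟩ := exists_iso_oMap δ lam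
  refine ⟨fun ν hν => ?_, fun μ hμ ν hν h => ?_, fun a ha => ?_⟩
  · rw [← hΦ ⟨ν, hν⟩]
    exact (Φ _).2
  · have : Φ ⟨μ, hμ⟩ = Φ ⟨ν, hν⟩ := Subtype.ext (by rw [hΦ, hΦ]; exact h)
    exact congrArg Subtype.val (Φ.injective this)
  · refine ⟨Φ.symm ⟨a, ha⟩, (Φ.symm ⟨a, ha⟩).2, ?_⟩
    rw [← hΦ, RelIso.apply_symm_apply]

end BrauerBlock

namespace BrauerBlock

/-! ### Signed sequences -/

/-- `s` is the descending arrangement of the numbers `n ∈ a` and `-n`, `n ∉ a`. -/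
def IsSignedSeq (a : Set ℕ+) (s : ℕ → ℤ) : Prop :=
  StrictAnti s ∧ (∀ i, s i ≠ 0) ∧
    ∀ n : ℕ+, ((n : ℤ) ∈ Set.range s ↔ n ∈ a) ∧ (-(n : ℤ) ∈ Set.range s ↔ n ∉ a)

/-- The positions `i < j` with `s i + s j > 0`. -/
def posPairs (s : ℕ → ℤ) : Set (ℕ × ℕ) := {q | q.1 < q.2 ∧ 0 < s q.1 + s q.2}

variable {a b : Set ℕ+} {s t : ℕ → ℤ}

theorem exists_pnat_coe_eq {z : ℤ} (hz : 0 < z) : ∃ n : ℕ+, (n : ℤ) = z :=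
  ⟨⟨z.toNat, by omega⟩, by rw [PNat.mk_coe]; omega⟩

theorem IsSignedSeq.add_ne_zero (h : IsSignedSeq a s) (i j : ℕ) : s i + s j ≠ 0 := by
  intro he
  have h1 := h.2.1 i
  wlog hpos : 0 < s i generalizing i j
  · exact this j i (by omega) (h.2.1 j) (by have := h.2.1 j; omega)
  obtain ⟨n, hn⟩ := exists_pnat_coe_eq hpos
  have h2 := h.2.2 n
  rw [hn] at h2
  exact (h2.2.1 ⟨j, by omega⟩) (h2.1.1 ⟨i, rfl⟩)

theorem IsSignedSeq.unique (hs : IsSignedSeq a s) (ht : IsSignedSeq a t) : s = t := by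
  have key : Set.range s = Set.range t := by
    ext z
    rcases lt_trichotomy z 0 with hz | rfl | hz
    · obtain ⟨n, hn⟩ := exists_pnat_coe_eq (neg_pos.2 hz)
      rw [show z = -(n : ℤ) by omega, (hs.2.2 _).2, (ht.2.2 _).2]
    · exact iff_of_false (fun ⟨i, hi⟩ => hs.2.1 i hi) (fun ⟨i, hi⟩ => ht.2.1 i hi)
    · obtain ⟨n, hn⟩ := exists_pnat_coe_eq hz
      rw [← hn, (hs.2.2 _).1, (ht.2.2 _).1]
  have := StrictMono.range_inj (f := fun i => OrderDual.toDual (s i))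
    (g := fun i => OrderDual.toDual (t i)) hs.1 ht.1
  exact this.1 key

theorem isSignedSeq_empty : IsSignedSeq ∅ fun i => -((i : ℤ) + 1) := by
  refine ⟨fun i j h => by simp only; omega, fun i => by simp only; omega, fun n => ⟨?_, ?_⟩⟩
  · simp only [Set.mem_range, Set.mem_empty_iff_false, iff_false, not_exists]
    intro i
    have := n.pos
    omega
  · simp only [Set.mem_range, Set.mem_empty_iff_false, not_false_eq_true, iff_true]
    refine ⟨n - 1, ?_⟩
    have := n.pos
    omega

/-- An edge of the subset graphs reflects the signed sequence and changes the sign of exactly one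
sum of two entries. -/
theorem IsSignedSeq.exists_reflection (hs : IsSignedSeq a s) (ht : IsSignedSeq b t)
    (h : ∃ l, LabelledEdge l a b) :
    ∃ i j, i < j ∧ (∀ k, t k = if k = i ∨ k = j then -s (Equiv.swap i j k) else s k) ∧
      (i, j) ∉ posPairs s ∧ posPairs t = insert (i, j) (posPairs s) := by
  obtain ⟨m, h1, h2, h3, h4⟩ := exists_labelledEdge_iff.1 h
  have hm0 := m.pos
  obtain ⟨j, hj⟩ := (hs.2.2 (m + 1)).2.2 h1
  obtain ⟨i, hi⟩ : ∃ i, s i = m ∧ m ∈ a ∧ m ∉ b ∨ s i = -1 ∧ m = 1 ∧ m ∉ a ∧ m ∈ b := by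
    rcases h3 with h3 | h3
    · obtain ⟨i, hi⟩ := (hs.2.2 m).1.2 h3.1
      exact ⟨i, Or.inl ⟨hi, h3⟩⟩
    · obtain ⟨i, hi⟩ := (hs.2.2 m).2.2 h3.2.1
      refine ⟨i, Or.inr ⟨?_, h3⟩⟩
      rw [hi, h3.1]
      rfl
  have hm1 : (m : ℕ) = 1 ↔ m = 1 := by rw [PNat.coe_eq_one_iff]
  have hival : s i = m ∨ (s i = -1 ∧ (m : ℕ) = 1) := by
    rcases hi with hi | hi
    · exact Or.inl hi.1
    · exact Or.inr ⟨hi.1, hm1.2 hi.2.1⟩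
  rw [PNat.add_coe, PNat.one_coe] at hj
  push_cast at hj
  have hij : i < j := by
    rw [← hs.1.lt_iff_gt]
    omega
  have hother : ∀ k, k ≠ i → k ≠ j → s k ≠ m ∧ s k ≠ -m ∧ s k ≠ m + 1 ∧ s k ≠ -(m + 1) ∧
      s k ≠ 0 := by
    intro k hki hkj
    have a1 := hs.add_ne_zero k i
    have a2 := hs.add_ne_zero k j
    have a3 : s k ≠ s i := fun h => hki (hs.1.injective h)
    have a4 : s k ≠ s j := fun h => hkj (hs.1.injective h)
    have a5 := hs.2.1 k
    omega
  let t' : ℕ → ℤ := fun k => if k = i ∨ k = j then -s (Equiv.swap i j k) else s k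
  have ti : t' i = m + 1 := by simp [t', hj]
  have tj : t' j = -s i := by simp [t']
  have tk : ∀ k, k ≠ i → k ≠ j → t' k = s k := fun k h1 h2 => by simp [t', h1, h2]
  -- No other entry has magnitude m or m + 1, so the reflected sequence is still descending. By
  -- uniqueness it is `t`, and sums other than that of i and j keep their sign.
  have ht' : IsSignedSeq b t' := by
    refine ⟨?_, ?_, ?_⟩
    · intro k k' hkk
      have hlt := hs.1 hkk
      have o1 := hother k
      have o2 := hother k'
      rcases eq_or_ne k i with rfl | hki
      · rw [ti]
        rcases eq_or_ne k' j with rfl | hkj'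
        · rw [tj]
          omega
        · rw [tk k' (by omega) hkj']
          omega
      rcases eq_or_ne k j with rfl | hkj
      · rw [tj, tk k' (by omega) (by omega)]
        omega
      rw [tk k hki hkj]
      have o1 := o1 hki hkj
      rcases eq_or_ne k' i with rfl | hki'
      · rw [ti]
        omega
      rcases eq_or_ne k' j with rfl | hkj'
      · rw [tj]
        omega
      rwa [tk k' hki' hkj']
    · intro k
      rcases eq_or_ne k i with rfl | hki
      · rw [ti]
        omega
      rcases eq_or_ne k j with rfl | hkj
      · rw [tj]
        omega
      · rw [tk k hki hkj]
        exact hs.2.1 k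
    · have hrange : ∀ z : ℤ, z ∈ Set.range t' ↔
          z = m + 1 ∨ z = -s i ∨ (z ∈ Set.range s ∧ z ≠ s i ∧ z ≠ s j) := by
        intro z
        constructor
        · rintro ⟨k, rfl⟩
          rcases eq_or_ne k i with rfl | hki
          · exact Or.inl ti
          rcases eq_or_ne k j with rfl | hkj
          · exact Or.inr (Or.inl tj)
          rw [tk k hki hkj]
          exact Or.inr (Or.inr ⟨⟨k, rfl⟩, fun h => hki (hs.1.injective h),
            fun h => hkj (hs.1.injective h)⟩)
        · rintro (rfl | rfl | ⟨⟨k, rfl⟩, h1, h2⟩)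
          · exact ⟨i, ti⟩
          · exact ⟨j, tj⟩
          · exact ⟨k, tk k (fun h => h1 (h ▸ rfl)) (fun h => h2 (h ▸ rfl))⟩
      intro n
      have hn0 := n.pos
      have en : n = m ↔ (n : ℕ) = m := PNat.coe_inj.symm
      have en' : n = m + 1 ↔ (n : ℕ) = m + 1 := by
        rw [← PNat.coe_inj, PNat.add_coe, PNat.one_coe]
      rw [hrange, hrange]
      rcases eq_or_ne n (m + 1) with hn | hn
      · have e := en'.1 hn
        rw [hn] at *
        refine ⟨iff_of_true (Or.inl (by omega)) h2, iff_of_false ?_ (fun h => h h2)⟩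
        rintro (h | h | h) <;> omega
      rcases eq_or_ne n m with hn' | hn'
      · have e := en.1 hn'
        rw [hn'] at *
        rcases hi with ⟨hi, -, hb⟩ | ⟨hi, hm, -, hb⟩
        · refine ⟨iff_of_false ?_ hb, iff_of_true (Or.inr (Or.inl (by omega))) hb⟩
          rintro (h | h | h) <;> omega
        · have := hm1.2 hm
          refine ⟨iff_of_true (Or.inr (Or.inl (by omega))) hb, iff_of_false ?_ (fun h => h hb)⟩
          rintro (h | h | h) <;> omega
      · have c1 : (n : ℕ) ≠ m := fun h => hn' (en.2 h)
        have c2 : (n : ℕ) ≠ m + 1 := fun h => hn (en'.2 h)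
        have b1 : (n : ℤ) ≠ m + 1 := by omega
        have b2 : (n : ℤ) ≠ -s i := by omega
        have b3 : (n : ℤ) ≠ s i := by omega
        have b4 : (n : ℤ) ≠ s j := by omega
        have b5 : -(n : ℤ) ≠ m + 1 := by omega
        have b6 : -(n : ℤ) ≠ -s i := by omega
        have b7 : -(n : ℤ) ≠ s i := by omega
        have b8 : -(n : ℤ) ≠ s j := by omega
        simp only [ne_eq, b1, b2, b3, b4, b5, b6, b7, b8, not_false_eq_true, and_true, false_or]
        rw [(hs.2.2 n).1, (hs.2.2 n).2, h4 n hn' hn]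
        exact ⟨Iff.rfl, Iff.rfl⟩
  obtain rfl := ht.unique ht'
  refine ⟨i, j, hij, fun k => rfl, fun h => ?_, ?_⟩
  · have := h.2
    simp only at this
    omega
  · ext ⟨k, k'⟩
    simp only [posPairs, Set.mem_ofPred_eq, Set.mem_insert_iff, Prod.mk.injEq]
    have o1 := hother k
    have o2 := hother k'
    rcases eq_or_ne k i with rfl | hki
    · rcases eq_or_ne k' j with rfl | hkj'
      · rw [ti, tj]
        omega
      by_cases hkk : k < k'
      · have := tk k' (by omega) hkj'
        omega
      · omega
    rcases eq_or_ne k j with rfl | hkj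
    · by_cases hkk : k < k'
      · have := tk k' (by omega) (by omega)
        omega
      · omega
    have o1 := o1 hki hkj
    rw [tk k hki hkj]
    rcases eq_or_ne k' i with rfl | hki'
    · omega
    rcases eq_or_ne k' j with rfl | hkj'
    · omega
    rw [tk k' hki' hkj']
    omega

/-! ### Counting pairs with positive sum. -/

theorem le_sub_of_strictAnti (hs : StrictAnti s) (k : ℕ) : s k ≤ s 0 - k := by
  induction k with
  | zero => simp
  | succ k ih =>
    have := hs (Nat.lt_succ_self k)
    push_cast
    simp only [Nat.succ_eq_add_one] at this
    omega

theorem posPairs_finite (hs : StrictAnti s) : (posPairs s).Finite := by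
  refine ((Set.finite_Iic (2 * s 0).toNat).prod (Set.finite_Iic (2 * s 0).toNat)).subset ?_
  rintro ⟨i, j⟩ ⟨-, h⟩
  have h1 := le_sub_of_strictAnti hs i
  have h2 := le_sub_of_strictAnti hs j
  simp only [Set.mem_prod, Set.mem_Iic] at *
  omega

/-- For s_i > 0 the positions counted are those of magnitude less than s_i, and each magnitude 1, …,
s_i - 1 occurs once. The value is 0 both for s_i = 1 and for negative s_i, so rows do not detect the
presence of 1. -/
theorem IsSignedSeq.ncard_row (hs : IsSignedSeq a s) (i : ℕ) :
    {j | (i, j) ∈ posPairs s}.ncard = (s i - 1).toNat := by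
  by_cases hi : s i ≤ 0
  · have : {j | (i, j) ∈ posPairs s} = ∅ := by
      ext j
      simp only [posPairs, Set.mem_ofPred_eq, Set.mem_empty_iff_false, iff_false, not_and]
      intro hij
      have := hs.1 hij
      omega
    rw [this, Set.ncard_empty]
    omega
  have hinj : Function.Injective fun j => (s j).natAbs := by
    intro j j' h
    rcases Int.natAbs_eq_natAbs_iff.1 h with h | h
    · exact hs.1.injective h
    · exact absurd (show s j + s j' = 0 by omega) (hs.add_ne_zero j j')
  rw [← Set.ncard_image_of_injective _ hinj]
  have : (fun j => (s j).natAbs) '' {j | (i, j) ∈ posPairs s} =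
      ((Finset.Icc 1 (s i - 1).toNat : Finset ℕ) : Set ℕ) := by
    ext n
    simp only [posPairs, Set.mem_image, Set.mem_ofPred_eq, Finset.coe_Icc, Set.mem_Icc]
    constructor
    · rintro ⟨j, ⟨h1, h2⟩, rfl⟩
      have := hs.1 h1
      have := hs.2.1 j
      omega
    · rintro ⟨h1, h2⟩
      obtain ⟨j, hj⟩ : ∃ j, (s j).natAbs = n := by
        have := hs.2.2 ⟨n, h1⟩
        rw [PNat.mk_coe] at this
        by_cases hn : (⟨n, h1⟩ : ℕ+) ∈ a
        · obtain ⟨j, hj⟩ := this.1.2 hn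
          exact ⟨j, by omega⟩
        · obtain ⟨j, hj⟩ := this.2.2 hn
          exact ⟨j, by omega⟩
      refine ⟨j, ⟨?_, by omega⟩, hj⟩
      rw [← hs.1.lt_iff_gt]
      omega
  rw [this, Set.ncard_coe_finset, Nat.card_Icc, Nat.add_sub_cancel]

theorem IsSignedSeq.mem_iff (hs : IsSignedSeq a s) {n : ℕ+} : n ∈ a ↔ ∃ i, s i = n :=
  (hs.2.2 n).1.symm

theorem eq_of_posPairs_eq (hs : IsSignedSeq a s) (ht : IsSignedSeq b t) (ha : a ∈ evenSubsets)
    (hb : b ∈ evenSubsets) (h : posPairs s = posPairs t) : a = b := by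
  refine eq_of_even_iff_of_forall_ne_one ha.1 hb.1 (iff_of_true ha.2 hb.2) fun n hn => ?_
  have hrow : ∀ i, (s i - 1).toNat = (t i - 1).toNat := fun i => by
    rw [← hs.ncard_row, ← ht.ncard_row, h]
  have h2 : (n : ℕ) ≠ 1 := fun h => hn (PNat.coe_eq_one_iff.1 h)
  have h0 := n.pos
  rw [hs.mem_iff, ht.mem_iff]
  refine exists_congr fun i => ?_
  have := hrow i
  omega

/-- Only row i₀ gets longer, by one. Hence, away from 1, the set b arises from a by adding m + 1 and
removing m, and evenness settles whether 1 is present. -/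
theorem labelledEdge_of_posPairs_insert (hs : IsSignedSeq a s) (ht : IsSignedSeq b t)
    (ha : a ∈ evenSubsets) (hb : b ∈ evenSubsets) {q : ℕ × ℕ} (hq : q ∉ posPairs s)
    (h : posPairs t = insert q (posPairs s)) : ∃ l, LabelledEdge l a b := by
  obtain ⟨i₀, j₀⟩ := q
  have hrow : ∀ i, i ≠ i₀ → (t i - 1).toNat = (s i - 1).toNat := fun i hi => by
    rw [← hs.ncard_row, ← ht.ncard_row, h]
    congr 1
    ext j
    simp [hi]
  have hrow₀ : (t i₀ - 1).toNat = (s i₀ - 1).toNat + 1 := by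
    rw [← hs.ncard_row, ← ht.ncard_row, h]
    have : {j | (i₀, j) ∈ insert (i₀, j₀) (posPairs s)} =
        insert j₀ {j | (i₀, j) ∈ posPairs s} := by
      ext j
      simp
    rw [this]
    refine Set.ncard_insert_of_notMem (s := {j | (i₀, j) ∈ posPairs s}) hq ?_
    exact (posPairs_finite hs.1).preimage (f := fun j => (i₀, j)) fun j _ j' _ h => by simpa using h
  -- An empty row i₀ only says s i₀ ≤ 1, and then the new entry is 2; the maximum covers this case.
  obtain ⟨m, hm⟩ : ∃ m : ℕ+, (m : ℤ) = max (s i₀) 1 := exists_pnat_coe_eq (by omega)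
  have hm0 := m.pos
  have hti : t i₀ = m + 1 := by omega
  have hcoe : ((m + 1 : ℕ+) : ℕ) = m + 1 := by rw [PNat.add_coe, PNat.one_coe]
  have hm1b : m + 1 ∈ b := ht.mem_iff.2 ⟨i₀, by rw [hti, hcoe]; push_cast; rfl⟩
  have hm1a : m + 1 ∉ a := by
    rw [hs.mem_iff, hcoe]
    rintro ⟨i, hi⟩
    push_cast at hi
    have hne : i ≠ i₀ := by
      rintro rfl
      omega
    have := hrow i hne
    exact hne (ht.1.injective (by omega))
  have hoff : ∀ n, n ≠ 1 → (n ∈ b ↔ n = m + 1 ∨ (n ∈ a ∧ n ≠ m)) := by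
    intro n hn
    have h2 : (n : ℕ) ≠ 1 := fun h => hn (PNat.coe_eq_one_iff.1 h)
    have h0 := n.pos
    have en : n = m ↔ (n : ℕ) = m := PNat.coe_inj.symm
    constructor
    · intro hnb
      obtain ⟨i, hi⟩ := ht.mem_iff.1 hnb
      rcases eq_or_ne i i₀ with rfl | hne
      · left
        rw [← PNat.coe_inj, hcoe]
        omega
      · right
        have := hrow i hne
        refine ⟨hs.mem_iff.2 ⟨i, by omega⟩, fun hnm => ?_⟩
        have := en.1 hnm
        exact hne (hs.1.injective (by omega))
    · rintro (rfl | ⟨hna, hnm⟩)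
      · exact hm1b
      · obtain ⟨i, hi⟩ := hs.mem_iff.1 hna
        have hnm' : (n : ℕ) ≠ m := fun h => hnm (en.2 h)
        have hne : i ≠ i₀ := by
          rintro rfl
          omega
        have := hrow i hne
        exact ht.mem_iff.2 ⟨i, by omega⟩
  have hlt : m < m + 1 := PNat.lt_add_right m 1
  rw [exists_labelledEdge_iff]
  by_cases hma : m ∈ a
  · have hbeq : b = insert (m + 1) (a \ {m}) := by
      refine eq_of_even_iff_of_forall_ne_one hb.1 (ha.1.sdiff.insert _) ?_ fun n hn => ?_
      · rw [Set.ncard_exchange hm1a hma]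
        exact iff_of_true hb.2 ha.2
      · rw [hoff n hn]
        simp
    refine ⟨m, hm1a, hm1b, Or.inl ⟨hma, ?_⟩, fun n hn hn' => ?_⟩
    · rw [hbeq]
      simp [hlt.ne]
    · rw [hbeq]
      simp [hn, hn']
  · obtain rfl : m = 1 := by
      by_contra hne
      have h2 : (m : ℕ) ≠ 1 := fun h => hne (PNat.coe_eq_one_iff.1 h)
      exact hma (hs.mem_iff.2 ⟨i₀, by omega⟩)
    have hbeq : b = insert 1 (insert (1 + 1) a) := by
      refine eq_of_even_iff_of_forall_ne_one hb.1 ((ha.1.insert _).insert _) ?_ fun n hn => ?_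
      · rw [Set.ncard_insert_of_notMem (by simp [hma, hlt.ne]) (ha.1.insert _),
          Set.ncard_insert_of_notMem hm1a ha.1]
        refine iff_of_true hb.2 ?_
        rw [add_assoc]
        exact ha.2.add (by decide)
      · rw [hoff n hn]
        simp [hn]
    refine ⟨1, hm1a, hm1b, Or.inr ⟨rfl, hma, ?_⟩, fun n hn hn' => ?_⟩
    · rw [hbeq]
      exact Or.inl rfl
    · rw [hbeq]
      simp only [Set.mem_insert_iff, hn, hn', false_or]

end BrauerBlock

namespace BrauerBlock

open Filter Topology

/-! ### Alcoves as sign chambers -/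

/-- The complement of all reflection hyperplanes. -/
def regularPoints : Set (ℕ → ℝ) := (⋃₀ hyperplanes)ᶜ

theorem mem_regularPoints_iff {x : ℕ → ℝ} :
    x ∈ regularPoints ↔ ∀ i j, i < j → x i ≠ x j ∧ x i ≠ -x j := by
  constructor
  · intro h i j hij
    refine ⟨fun he => h ?_, fun he => h ?_⟩
    · exact ⟨{v | v i = v j}, ⟨i, j, hij, Or.inl rfl⟩, he⟩
    · exact ⟨{v | v i = -v j}, ⟨i, j, hij, Or.inr rfl⟩, he⟩
  · rintro h ⟨H, ⟨i, j, hij, rfl | rfl⟩, hx⟩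
    · exact (h i j hij).1 hx
    · exact (h i j hij).2 hx

theorem mem_regularPoints_iff_abs {x : ℕ → ℝ} :
    x ∈ regularPoints ↔ Function.Injective fun i => |x i| := by
  rw [mem_regularPoints_iff]
  constructor
  · intro h i j he
    by_contra hne
    have hor := abs_eq_abs.1 he
    rcases lt_or_gt_of_ne hne with hlt | hlt
    · exact hor.elim (h i j hlt).1 (h i j hlt).2
    · rcases hor with h' | h'
      · exact (h j i hlt).1 h'.symm
      · exact (h j i hlt).2 (by rw [h', neg_neg])
  · intro h i j hij
    refine ⟨fun he => hij.ne (h ?_), fun he => hij.ne (h ?_)⟩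
    · simp only [he]
    · simp only [he, abs_neg]

/-- A continuous function without zeros on the regular points has constant sign on a connected
component, by the intermediate value theorem. -/
theorem pos_iff_of_mem_component {x y : ℕ → ℝ}
    (hy : y ∈ connectedComponentIn regularPoints x) {f : (ℕ → ℝ) → ℝ} (hf : Continuous f)
    (hne : ∀ z ∈ regularPoints, f z ≠ 0) : 0 < f x ↔ 0 < f y := by
  have hx : x ∈ regularPoints := by
    by_contra hx
    rw [connectedComponentIn_eq_empty hx] at hy
    exact hy
  have hxc := mem_connectedComponentIn hx
  have hpre := isPreconnected_connectedComponentIn (F := regularPoints) (x := x)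
  have key : ∀ u ∈ connectedComponentIn regularPoints x,
      ∀ v ∈ connectedComponentIn regularPoints x, 0 < f u → 0 < f v := by
    intro u hu v hv h
    by_contra h'
    obtain ⟨z, hz, h0⟩ := hpre.intermediate_value hv hu hf.continuousOn ⟨not_lt.1 h', h.le⟩
    exact hne z (connectedComponentIn_subset _ _ hz) h0
  exact ⟨key x hxc y hy, key y hy x hxc⟩

/-- The alcove of a strictly descending regular point. -/
theorem mem_component_iff {x y : ℕ → ℝ} (hx : x ∈ regularPoints) (hanti : StrictAnti x) :
    y ∈ connectedComponentIn regularPoints x ↔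
      StrictAnti y ∧ ∀ i j, i < j → y i + y j ≠ 0 ∧ (0 < x i + x j ↔ 0 < y i + y j) := by
  constructor
  · intro hy
    have hyr := connectedComponentIn_subset _ _ hy
    refine ⟨fun i j hij => ?_, fun i j hij => ⟨fun h => ?_, ?_⟩⟩
    · have := pos_iff_of_mem_component hy (f := fun z => z i - z j) (by fun_prop)
        fun z hz => sub_ne_zero.2 (mem_regularPoints_iff.1 hz i j hij).1
      have h1 := this.1 (sub_pos.2 (hanti hij))
      exact sub_pos.1 h1
    · exact (mem_regularPoints_iff.1 hyr i j hij).2 (by linarith)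
    · refine pos_iff_of_mem_component hy (f := fun z => z i + z j) (by fun_prop) fun z hz h => ?_
      exact (mem_regularPoints_iff.1 hz i j hij).2 (by linarith)
  · rintro ⟨hy, hsum⟩
    -- The forms v_i - v_j and v_i + v_j have equal strict signs at both ends, so they do not vanish
    -- on the segment.
    have hsub : segment ℝ x y ⊆ regularPoints := by
      rintro z ⟨c, d, hc, hd, hcd, rfl⟩
      rw [mem_regularPoints_iff]
      intro i j hij
      have h1 := hanti hij
      have h2 := hy hij
      have hxs : x i + x j ≠ 0 := fun h => (mem_regularPoints_iff.1 hx i j hij).2 (by linarith)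
      obtain ⟨h3, h4⟩ := hsum i j hij
      simp only [Pi.add_apply, Pi.smul_apply, smul_eq_mul]
      have hcd' : 0 < c ∨ 0 < d := by
        by_contra h
        push Not at h
        linarith
      refine ⟨fun h => ?_, fun h => ?_⟩
      · have h5 : c * (x i - x j) + d * (y i - y j) = 0 := by linarith
        have h6 : 0 ≤ c * (x i - x j) := mul_nonneg hc (by linarith)
        have h7 : 0 ≤ d * (y i - y j) := mul_nonneg hd (by linarith)
        rcases hcd' with hc' | hd'
        · have := mul_pos hc' (sub_pos.2 h1)
          linarith
        · have := mul_pos hd' (sub_pos.2 h2)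
          linarith
      · have h5 : c * (x i + x j) + d * (y i + y j) = 0 := by linarith
        rcases lt_or_gt_of_ne hxs with hneg | hpos
        · have hneg' : y i + y j < 0 := lt_of_le_of_ne
            (not_lt.1 fun h => absurd (h4.2 h) (not_lt.2 hneg.le)) h3
          rcases hcd' with hc' | hd'
          · have := mul_neg_of_pos_of_neg hc' hneg
            have := mul_nonpos_of_nonneg_of_nonpos hd hneg'.le
            linarith
          · have := mul_neg_of_pos_of_neg hd' hneg'
            have := mul_nonpos_of_nonneg_of_nonpos hc hneg.le
            linarith
        · have hpos' := h4.1 hpos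
          rcases hcd' with hc' | hd'
          · have := mul_pos hc' hpos
            have := mul_nonneg hd hpos'.le
            linarith
          · have := mul_pos hd' hpos'
            have := mul_nonneg hc hpos.le
            linarith
    exact (convex_segment x y).isPreconnected.subset_connectedComponentIn
      (left_mem_segment ℝ x y) hsub (right_mem_segment ℝ x y)

/-- The sequence of reals given by a sequence of integers. -/
def toReal (s : ℕ → ℤ) : ℕ → ℝ := fun i => (s i : ℝ)

/-- The alcove containing an integral sequence. -/
def alcoveOf (s : ℕ → ℤ) : Set (ℕ → ℝ) := connectedComponentIn regularPoints (toReal s)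

variable {a b : Set ℕ+} {s t : ℕ → ℤ}

theorem IsSignedSeq.toReal_strictAnti (hs : IsSignedSeq a s) : StrictAnti (toReal s) :=
  fun _ _ h => Int.cast_lt.2 (hs.1 h)

theorem IsSignedSeq.toReal_mem (hs : IsSignedSeq a s) : toReal s ∈ regularPoints := by
  rw [mem_regularPoints_iff]
  intro i j hij
  refine ⟨(hs.toReal_strictAnti hij).ne', fun h => hs.add_ne_zero i j ?_⟩
  have : (s i : ℝ) + s j = 0 := by
    simp only [toReal] at h
    linarith
  exact_mod_cast this

theorem IsSignedSeq.mem_alcoveOf_iff (hs : IsSignedSeq a s) {y : ℕ → ℝ} :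
    y ∈ alcoveOf s ↔ StrictAnti y ∧
      ∀ i j, i < j → y i + y j ≠ 0 ∧ ((i, j) ∈ posPairs s ↔ 0 < y i + y j) := by
  rw [alcoveOf, mem_component_iff hs.toReal_mem hs.toReal_strictAnti]
  refine and_congr_right fun _ => forall₃_congr fun i j hij => ?_
  have : 0 < toReal s i + toReal s j ↔ (i, j) ∈ posPairs s := by
    simp only [toReal, posPairs, Set.mem_ofPred_eq, hij, true_and]
    exact_mod_cast Iff.rfl
  rw [this]

theorem IsSignedSeq.toReal_mem_alcoveOf (hs : IsSignedSeq a s) : toReal s ∈ alcoveOf s :=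
  mem_connectedComponentIn hs.toReal_mem

/-- For a descending sequence v 0 + v 1 is the largest sum, so its negativity makes all sums
negative. -/
theorem fundamentalAlcove_eq : fundamentalAlcove = alcoveOf fun i => -((i : ℤ) + 1) := by
  ext y
  rw [isSignedSeq_empty.mem_alcoveOf_iff]
  refine and_congr_right fun hy => ?_
  have hnot : ∀ i j : ℕ, (i, j) ∉ posPairs fun i => -((i : ℤ) + 1) := by
    rintro i j ⟨-, h⟩
    simp only at h
    omega
  constructor
  · intro h i j hij
    have h1 := hy.antitone (Nat.zero_le i)
    have h2 := hy.antitone (show 1 ≤ j by omega)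
    have h3 : y i + y j < 0 := by linarith
    exact ⟨h3.ne, iff_of_false (hnot i j) h3.not_gt⟩
  · intro h
    obtain ⟨h1, h2⟩ := h 0 1 Nat.zero_lt_one
    exact lt_of_le_of_ne (not_lt.1 fun h => hnot 0 1 (h2.2 h)) h1

/-! ### The reflection group -/

theorem reflPlus_apply (i j : ℕ) (v : ℕ → ℝ) (k : ℕ) :
    reflPlus i j v k = v (Equiv.swap i j k) := rfl

theorem reflMinus_apply (i j : ℕ) (v : ℕ → ℝ) (k : ℕ) :
    reflMinus i j v k = if k = i ∨ k = j then -v (Equiv.swap i j k) else v k := rfl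

theorem reflPlus_reflPlus (i j : ℕ) (v : ℕ → ℝ) : reflPlus i j (reflPlus i j v) = v := by
  funext k
  simp [reflPlus_apply]

theorem reflMinus_reflMinus (i j : ℕ) (v : ℕ → ℝ) : reflMinus i j (reflMinus i j v) = v :=
  (reflMinus i j).left_inv v

theorem abs_reflMinus_apply (i j : ℕ) (v : ℕ → ℝ) (k : ℕ) :
    |reflMinus i j v k| = |v (Equiv.swap i j k)| := by
  rw [reflMinus_apply]
  split_ifs with h
  · rw [abs_neg]
  · push Not at h
    rw [Equiv.swap_apply_of_ne_of_ne h.1 h.2]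

/-- A property of elements of the reflection group follows from that of the reflections. -/
theorem groupD_induction {Q : (ℕ → ℝ) → Prop}
    (hplus : ∀ i j v, i < j → Q v → Q (reflPlus i j v))
    (hminus : ∀ i j v, i < j → Q v → Q (reflMinus i j v)) {w : Equiv.Perm (ℕ → ℝ)}
    (hw : w ∈ groupD) (v : ℕ → ℝ) : Q (w v) ↔ Q v := by
  induction hw using Subgroup.closure_induction generalizing v with
  | mem w hw =>
    obtain ⟨i, j, hij, rfl | rfl⟩ := hw
    · refine ⟨fun h => ?_, hplus i j v hij⟩
      rw [← reflPlus_reflPlus i j v]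
      exact hplus i j _ hij h
    · refine ⟨fun h => ?_, hminus i j v hij⟩
      rw [← reflMinus_reflMinus i j v]
      exact hminus i j _ hij h
  | one => exact Iff.rfl
  | mul w w' _ _ ih ih' => exact (ih (w' v)).trans (ih' v)
  | inv w _ ih =>
    have := ih (w.symm v)
    rw [Equiv.apply_symm_apply] at this
    exact this.symm

theorem groupD_mem_regularPoints_iff {w : Equiv.Perm (ℕ → ℝ)} (hw : w ∈ groupD) (v : ℕ → ℝ) :
    w v ∈ regularPoints ↔ v ∈ regularPoints := by
  refine groupD_induction (Q := fun v => v ∈ regularPoints) ?_ ?_ hw v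
  · intro i j v _ hv
    rw [mem_regularPoints_iff_abs] at *
    exact hv.comp (Equiv.swap i j).injective
  · intro i j v _ hv
    rw [mem_regularPoints_iff_abs] at *
    simp only [abs_reflMinus_apply]
    exact hv.comp (Equiv.swap i j).injective

theorem continuous_reflPlus (i j : ℕ) : Continuous (reflPlus i j) :=
  continuous_pi fun k => continuous_apply (Equiv.swap i j k)

theorem continuous_reflMinus (i j : ℕ) : Continuous (reflMinus i j) := by
  refine continuous_pi fun k => ?_
  simp only [reflMinus_apply]
  split_ifs <;> fun_prop

theorem groupD_continuous {w : Equiv.Perm (ℕ → ℝ)} (hw : w ∈ groupD) :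
    Continuous w ∧ Continuous w.symm := by
  induction hw using Subgroup.closure_induction with
  | mem w hw =>
    obtain ⟨i, j, hij, rfl | rfl⟩ := hw
    · exact ⟨continuous_reflPlus i j, continuous_reflPlus i j⟩
    · exact ⟨continuous_reflMinus i j, continuous_reflMinus i j⟩
  | one => exact ⟨continuous_id, continuous_id⟩
  | mul w w' _ _ ih ih' => exact ⟨ih.1.comp ih'.1, ih'.2.comp ih.2⟩
  | inv w _ ih => exact ⟨ih.2, ih.1⟩

/-- Elements of the group are homeomorphisms that preserve the regular points, so they permute the
components. -/
theorem groupD_image_component {w : Equiv.Perm (ℕ → ℝ)} (hw : w ∈ groupD) {x : ℕ → ℝ}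
    (hx : x ∈ regularPoints) :
    w '' connectedComponentIn regularPoints x = connectedComponentIn regularPoints (w x) := by
  let h : (ℕ → ℝ) ≃ₜ (ℕ → ℝ) := ⟨w, (groupD_continuous hw).1, (groupD_continuous hw).2⟩
  have h1 : h '' regularPoints = regularPoints := by
    ext v
    constructor
    · rintro ⟨u, hu, rfl⟩
      exact (groupD_mem_regularPoints_iff hw u).2 hu
    · intro hv
      refine ⟨w.symm v, ?_, w.apply_symm_apply v⟩
      rw [← groupD_mem_regularPoints_iff hw, w.apply_symm_apply]
      exact hv
  have h2 := h.image_connectedComponentIn hx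
  rw [h1] at h2
  exact h2

/-- Sequences whose magnitudes are `1, 2, 3, …` in some order, with an even number of positive
terms. -/
def IsEvenSigned (v : ℕ → ℝ) : Prop :=
  (Function.Injective fun i => |v i|) ∧ (Set.range fun i => |v i|) = Set.range (fun n : ℕ+ => (n : ℝ)) ∧
    {i | 0 < v i}.Finite ∧ Even {i | 0 < v i}.ncard

theorem IsEvenSigned.ne_zero {v : ℕ → ℝ} (h : IsEvenSigned v) (i : ℕ) : v i ≠ 0 := by
  intro h0
  have : |v i| ∈ Set.range (fun n : ℕ+ => (n : ℝ)) := by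
    rw [← h.2.1]
    exact ⟨i, rfl⟩
  obtain ⟨n, hn⟩ := this
  simp [h0] at hn

/-- Every generator permutes the magnitudes and changes no signs or two. This invariant identifies
the alcoves in the orbit of the fundamental one. -/
theorem isEvenSigned_groupD_iff {w : Equiv.Perm (ℕ → ℝ)} (hw : w ∈ groupD) (v : ℕ → ℝ) :
    IsEvenSigned (w v) ↔ IsEvenSigned v := by
  have himage : ∀ (i j : ℕ) (v : ℕ → ℝ),
      {k | 0 < v (Equiv.swap i j k)} = Equiv.swap i j '' {k | 0 < v k} := by
    intro i j v
    ext k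
    constructor
    · intro h
      exact ⟨Equiv.swap i j k, h, Equiv.swap_apply_self i j k⟩
    · rintro ⟨k, h, rfl⟩
      simpa using h
  have hrange : ∀ (i j : ℕ) (v : ℕ → ℝ),
      (Set.range fun k => |v (Equiv.swap i j k)|) = Set.range fun k => |v k| := fun i j v =>
    (Equiv.swap i j).surjective.range_comp fun k => |v k|
  refine groupD_induction ?_ ?_ hw v
  · rintro i j v _ ⟨h1, h2, h3, h4⟩
    refine ⟨h1.comp (Equiv.swap i j).injective, ?_, ?_, ?_⟩
    · simp only [reflPlus_apply, hrange, h2]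
    · simp only [reflPlus_apply, himage]
      exact h3.image _
    · simp only [reflPlus_apply, himage]
      rwa [Set.ncard_image_of_injective _ (Equiv.swap i j).injective]
  · intro i j v hij hv
    have hne := hv.ne_zero
    obtain ⟨h1, h2, h3, h4⟩ := hv
    have hpos : {k | 0 < reflMinus i j v k} =
        -- Each of the two sign changes toggles one position, so the parity is reversed twice.
        symmDiff (symmDiff {k | 0 < v (Equiv.swap i j k)} {i}) {j} := by
      ext k
      simp only [reflMinus_apply, Set.mem_symmDiff, Set.mem_ofPred_eq, Set.mem_singleton_iff]
      rcases eq_or_ne k i with rfl | hki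
      · simp [hij.ne, le_iff_lt_or_eq, hne j]
      rcases eq_or_ne k j with rfl | hkj
      · simp [hij.ne', le_iff_lt_or_eq, hne i]
      · simp [hki, hkj, Equiv.swap_apply_of_ne_of_ne hki hkj]
    have hfin : {k | 0 < v (Equiv.swap i j k)}.Finite := by
      rw [himage]
      exact h3.image _
    have hfin' : ∀ {S : Set ℕ} (x : ℕ), S.Finite → (symmDiff S {x}).Finite := by
      intro S x hS
      rw [Set.symmDiff_def]
      exact hS.sdiff.union (Set.toFinite _).sdiff
    refine ⟨?_, ?_, ?_, ?_⟩
    · simp only [abs_reflMinus_apply]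
      exact h1.comp (Equiv.swap i j).injective
    · simp only [abs_reflMinus_apply, hrange, h2]
    · rw [hpos]
      exact hfin' _ (hfin' _ hfin)
    · rw [hpos, even_symmDiff_singleton_iff (hfin' _ hfin), even_symmDiff_singleton_iff hfin,
        not_not, himage, Set.ncard_image_of_injective _ (Equiv.swap i j).injective]
      exact h4

theorem isEvenSigned_base : IsEvenSigned (toReal fun i => -((i : ℤ) + 1)) := by
  have habs : ∀ i : ℕ, |toReal (fun i => -((i : ℤ) + 1)) i| = (i : ℝ) + 1 := fun i => by
    simp only [toReal]
    push_cast
    rw [abs_neg, abs_of_nonneg (by positivity)]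
  have hpos : {i | 0 < toReal (fun i => -((i : ℤ) + 1)) i} = ∅ := by
    ext i
    simp only [Set.mem_ofPred_eq, Set.mem_empty_iff_false, iff_false, not_lt, toReal]
    push_cast
    have : (0 : ℝ) ≤ i := by positivity
    linarith
  refine ⟨fun i j h => ?_, ?_, ?_, ?_⟩
  · simp only [habs, add_left_inj, Nat.cast_inj] at h
    exact h
  · simp only [habs]
    ext x
    constructor
    · rintro ⟨i, rfl⟩
      exact ⟨i.succPNat, by simp⟩
    · rintro ⟨n, rfl⟩
      refine ⟨n.natPred, ?_⟩
      have := PNat.natPred_add_one n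
      simp only
      exact_mod_cast this
  · rw [hpos]
    exact Set.finite_empty
  · rw [hpos]
    simp

/-- A descending sequence with an even sign pattern is the signed sequence of an even set. -/
theorem IsEvenSigned.exists_isSignedSeq {v : ℕ → ℝ} (hv : IsEvenSigned v) (hanti : StrictAnti v) :
    ∃ (a : Set ℕ+) (s : ℕ → ℤ), a ∈ evenSubsets ∧ IsSignedSeq a s ∧ v = toReal s := by
  have hne := hv.ne_zero
  obtain ⟨hinj, hrange, hfin, heven⟩ := hv
  have habs : ∀ i, ∃ n : ℕ+, |v i| = n := fun i => by
    have : |v i| ∈ Set.range (fun n : ℕ+ => (n : ℝ)) := hrange ▸ ⟨i, rfl⟩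
    obtain ⟨n, hn⟩ := this
    exact ⟨n, hn.symm⟩
  have hsurj : ∀ n : ℕ+, ∃ i, |v i| = n := fun n => by
    have : (n : ℝ) ∈ Set.range fun i => |v i| := hrange.symm ▸ ⟨n, rfl⟩
    exact this
  have hint : ∀ i, ∃ z : ℤ, v i = z := fun i => by
    obtain ⟨n, hn⟩ := habs i
    rcases abs_eq_abs.1 (hn.trans (abs_of_nonneg (Nat.cast_nonneg _)).symm) with h | h
    · exact ⟨n, by rw [h]; push_cast; rfl⟩
    · exact ⟨-n, by rw [h]; push_cast; rfl⟩
  choose s hs using hint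
  obtain rfl : v = toReal s := funext hs
  simp only [toReal] at *
  have hpos : ∀ n : ℕ+, (0 : ℤ) < n := fun n => by exact_mod_cast n.pos
  have hsurj' : ∀ n : ℕ+, ∃ i, s i = n ∨ s i = -n := fun n => by
    obtain ⟨i, hi⟩ := hsurj n
    refine ⟨i, ?_⟩
    have : |s i| = n := by exact_mod_cast hi
    have := hpos n
    rcases abs_choice (s i) with h | h <;> omega
  have hnot : ∀ i j, s i + s j ≠ 0 := by
    intro i j h
    have h1 : s i = -s j := by omega
    have h2 : i = j := hinj (by simp [h1])
    subst h2
    exact hne i (by rw [show s i = 0 by omega]; simp)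
  refine ⟨{n | ∃ i, s i = n}, s, ?_, ⟨fun i j h => Int.cast_lt.1 (hanti h), fun i h => ?_,
    fun n => ⟨Iff.rfl, ?_⟩⟩, rfl⟩
  · have himg : (fun n : ℕ+ => (n : ℤ)) '' {n | ∃ i, s i = n} = s '' {i | 0 < (s i : ℝ)} := by
      ext z
      constructor
      · rintro ⟨n, ⟨i, hi⟩, rfl⟩
        refine ⟨i, ?_, hi⟩
        have := hpos n
        simp only [Set.mem_ofPred_eq, hi]
        exact_mod_cast this
      · rintro ⟨i, hi, rfl⟩
        have hi' : 0 < s i := by exact_mod_cast hi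
        obtain ⟨n, hn⟩ := exists_pnat_coe_eq hi'
        exact ⟨n, ⟨i, hn.symm⟩, hn⟩
    have hcoe : Function.Injective fun n : ℕ+ => (n : ℤ) := fun n m h => by
      simpa using h
    have hsinj : Function.Injective s := fun i j h => hinj (by simp [h])
    constructor
    · refine Set.Finite.of_finite_image ?_ hcoe.injOn
      rw [himg]
      exact hfin.image s
    · rw [← Set.ncard_image_of_injective _ hcoe, himg, Set.ncard_image_of_injective _ hsinj]
      exact heven
  · exact hne i (by rw [h]; simp)
  · constructor
    · rintro ⟨i, hi⟩ ⟨j, hj⟩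
      exact hnot i j (by omega)
    · intro h
      obtain ⟨i, hi | hi⟩ := hsurj' n
      · exact absurd ⟨i, hi⟩ h
      · exact ⟨i, hi⟩

/-! ### Lengths and walls -/

theorem sumHyperplane_injective {i j i' j' : ℕ} (hij : i < j) (hij' : i' < j')
    (h : {v : ℕ → ℝ | v i = -v j} = {v | v i' = -v j'}) : (i, j) = (i', j') := by
  -- A point at which the sum of the entries i and j is the only sum over two distinct positions to
  -- vanish.
  let v : ℕ → ℝ := fun k => if k = i then 1 else if k = j then -1 else 2
  have hv : v ∈ {v : ℕ → ℝ | v i = -v j} := by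
    simp [v, hij.ne']
  rw [h] at hv
  simp only [Set.mem_ofPred_eq, v] at hv
  rw [Prod.mk.injEq]
  split_ifs at hv <;> first | omega | norm_num at hv

theorem IsSignedSeq.separates_iff (hs : IsSignedSeq a s) {i j : ℕ} (hij : i < j) :
    Separates {v | v i = -v j} fundamentalAlcove (alcoveOf s) ↔ (i, j) ∈ posPairs s := by
  rw [fundamentalAlcove_eq]
  constructor
  · intro h
    by_contra hn
    obtain ⟨z, ⟨c, d, hc, hd, hcd, rfl⟩, hz⟩ := h _ isSignedSeq_empty.toReal_mem_alcoveOf _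
      hs.toReal_mem_alcoveOf
    simp only [Set.mem_ofPred_eq, Pi.add_apply, Pi.smul_apply, smul_eq_mul, toReal] at hz
    have h1 : (s i : ℝ) + s j ≤ 0 := by
      have : s i + s j ≤ 0 := not_lt.1 fun h => hn ⟨hij, h⟩
      exact_mod_cast this
    have h1' : (s i : ℝ) + s j ≠ 0 := by exact_mod_cast hs.add_ne_zero i j
    have h2 : (s i : ℝ) + s j < 0 := lt_of_le_of_ne h1 h1'
    have h3 : c * ((i : ℝ) + j + 2) = d * (s i + s j) := by
      push_cast at hz
      linarith
    have h4 : 0 ≤ c * ((i : ℝ) + j + 2) := by positivity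
    have h5 : d * ((s i : ℝ) + s j) ≤ 0 := mul_nonpos_of_nonneg_of_nonpos hd h1
    rcases mul_eq_zero.1 (le_antisymm (h3.le.trans h5) h4) with h6 | h6
    · rw [h6, zero_mul] at h3
      rw [h6, zero_add] at hcd
      rw [hcd, one_mul] at h3
      linarith
    · have : (0 : ℝ) < (i : ℝ) + j + 2 := by positivity
      linarith
  · intro h x hx y hy
    have hx' := (isSignedSeq_empty.mem_alcoveOf_iff.1 hx).2 i j hij
    have hy' := ((hs.mem_alcoveOf_iff.1 hy).2 i j hij).2.1 h
    have hx'' : x i + x j < 0 := by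
      refine lt_of_le_of_ne (not_lt.1 fun h' => ?_) hx'.1
      have := (hx'.2.2 h').2
      simp only at this
      omega
    have hD : 0 < (y i + y j) - (x i + x j) := by linarith
    -- The weights of the point of the segment at which the sum, negative at x and positive at y,
    -- vanishes.
    refine ⟨_, ⟨(y i + y j) / ((y i + y j) - (x i + x j)),
      (-(x i + x j)) / ((y i + y j) - (x i + x j)), by positivity,
      div_nonneg (by linarith) hD.le, ?_, rfl⟩, ?_⟩
    · field_simp
      ring
    · simp only [Set.mem_ofPred_eq, Pi.add_apply, Pi.smul_apply, smul_eq_mul]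
      field_simp
      ring

/-- Both alcoves consist of descending sequences, so no hyperplane v_i = v_j separates them;
distinct pairs give distinct hyperplanes v_i = -v_j. -/
theorem IsSignedSeq.alcoveLength_eq (hs : IsSignedSeq a s) :
    alcoveLength (alcoveOf s) = (posPairs s).ncard := by
  have : {H | H ∈ hyperplanes ∧ Separates H fundamentalAlcove (alcoveOf s)} =
      (fun q : ℕ × ℕ => {v : ℕ → ℝ | v q.1 = -v q.2}) '' posPairs s := by
    ext H
    constructor
    · rintro ⟨⟨i, j, hij, rfl | rfl⟩, hsep⟩
      · exfalso
        rw [fundamentalAlcove_eq] at hsep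
        obtain ⟨z, ⟨c, d, hc, hd, hcd, rfl⟩, hz⟩ := hsep _ isSignedSeq_empty.toReal_mem_alcoveOf _
          hs.toReal_mem_alcoveOf
        have h1 := isSignedSeq_empty.toReal_strictAnti hij
        have h2 := hs.toReal_strictAnti hij
        simp only [Set.mem_ofPred_eq, Pi.add_apply, Pi.smul_apply, smul_eq_mul] at hz
        have h3 := mul_nonneg hc (sub_pos.2 h1).le
        have h4 := mul_nonneg hd (sub_pos.2 h2).le
        have hcd' : 0 < c ∨ 0 < d := by
          by_contra h
          push Not at h
          linarith
        rcases hcd' with h | h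
        · have := mul_pos h (sub_pos.2 h1)
          linarith
        · have := mul_pos h (sub_pos.2 h2)
          linarith
      · exact ⟨(i, j), (hs.separates_iff hij).1 hsep, rfl⟩
    · rintro ⟨⟨i, j⟩, hq, rfl⟩
      exact ⟨⟨i, j, hq.1, Or.inr rfl⟩, (hs.separates_iff hq.1).2 hq⟩
  rw [alcoveLength, this]
  refine Set.InjOn.ncard_image ?_
  rintro ⟨i, j⟩ hq ⟨i', j'⟩ hq' h
  exact sumHyperplane_injective hq.1 hq'.1 h

/-- The weak inequalities are closed conditions. Conversely, adding ε times the base point makes all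
of them strict at once, and this converges to y in the product topology as ε ↓ 0. -/
theorem IsSignedSeq.mem_closure_iff (hs : IsSignedSeq a s) {y : ℕ → ℝ} :
    y ∈ closure (alcoveOf s) ↔ ∀ i j, i < j → y j ≤ y i ∧
      ((i, j) ∈ posPairs s → 0 ≤ y i + y j) ∧ ((i, j) ∉ posPairs s → y i + y j ≤ 0) := by
  constructor
  · intro hy i j hij
    refine ⟨?_, fun h => ?_, fun h => ?_⟩
    · have hcl : IsClosed {v : ℕ → ℝ | v j ≤ v i} := isClosed_le (by fun_prop) (by fun_prop)
      exact closure_minimal (fun v hv => ((hs.mem_alcoveOf_iff.1 hv).1 hij).le) hcl hy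
    · have hcl : IsClosed {v : ℕ → ℝ | 0 ≤ v i + v j} := isClosed_le (by fun_prop) (by fun_prop)
      exact closure_minimal (fun v hv =>
        (((hs.mem_alcoveOf_iff.1 hv).2 i j hij).2.1 h).le) hcl hy
    · have hcl : IsClosed {v : ℕ → ℝ | v i + v j ≤ 0} := isClosed_le (by fun_prop) (by fun_prop)
      exact closure_minimal (fun v hv => not_lt.1 fun h' =>
        h (((hs.mem_alcoveOf_iff.1 hv).2 i j hij).2.2 h')) hcl hy
  · intro h
    have hlim : Tendsto (fun ε : ℝ => y + ε • toReal s) (𝓝[>] 0) (𝓝 y) := by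
      have hc : Continuous fun ε : ℝ => y + ε • toReal s := by fun_prop
      have := hc.tendsto 0
      simp only [zero_smul, add_zero] at this
      exact this.mono_left nhdsWithin_le_nhds
    refine mem_closure_of_tendsto hlim ?_
    filter_upwards [self_mem_nhdsWithin] with ε hε
    have hε : 0 < ε := hε
    rw [hs.mem_alcoveOf_iff]
    refine ⟨fun i j hij => ?_, fun i j hij => ?_⟩
    · have h1 := (h i j hij).1
      have h2 := mul_pos hε (sub_pos.2 (hs.toReal_strictAnti hij))
      simp only [Pi.add_apply, Pi.smul_apply, smul_eq_mul]
      linarith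
    · obtain ⟨-, h1, h2⟩ := h i j hij
      simp only [Pi.add_apply, Pi.smul_apply, smul_eq_mul]
      by_cases hq : (i, j) ∈ posPairs s
      · have h3 : (0 : ℝ) < s i + s j := by exact_mod_cast hq.2
        have h4 := mul_pos hε h3
        have h5 := h1 hq
        have h6 : 0 < y i + ε * toReal s i + (y j + ε * toReal s j) := by
          simp only [toReal]
          linarith
        exact ⟨h6.ne', iff_of_true hq h6⟩
      · have h3 : (s i : ℝ) + s j < 0 := by
          have h1 : s i + s j ≤ 0 := not_lt.1 fun h => hq ⟨hij, h⟩
          have := lt_of_le_of_ne h1 (hs.add_ne_zero i j)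
          exact_mod_cast this
        have h4 := mul_neg_of_pos_of_neg hε h3
        have h5 := h2 hq
        have h6 : y i + ε * toReal s i + (y j + ε * toReal s j) < 0 := by
          simp only [toReal]
          linarith
        exact ⟨h6.ne, iff_of_false hq h6.not_gt⟩

/-- At a common wall point p the sign patterns can differ only at pairs with p_i + p_j = 0. As p is
on a single hyperplane there is at most one such pair, and the lengths force it to be gained. -/
theorem exists_posPairs_insert_of_shareWall (hs : IsSignedSeq a s) (ht : IsSignedSeq b t)
    (hw : ShareWall (alcoveOf s) (alcoveOf t))
    (hcard : (posPairs t).ncard = (posPairs s).ncard + 1) :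
    ∃ q, q ∉ posPairs s ∧ posPairs t = insert q (posPairs s) := by
  obtain ⟨H, hH, p, ⟨hps, hpt⟩, hpH, hpo⟩ := hw
  rw [hs.mem_closure_iff] at hps
  rw [ht.mem_closure_iff] at hpt
  have hsame : ∀ i j, i < j → p i + p j ≠ 0 → ((i, j) ∈ posPairs s ↔ (i, j) ∈ posPairs t) := by
    intro i j hij hne
    obtain ⟨-, h1, h2⟩ := hps i j hij
    obtain ⟨-, h3, h4⟩ := hpt i j hij
    constructor
    · intro h
      by_contra h'
      exact hne (le_antisymm (h4 h') (h1 h))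
    · intro h
      by_contra h'
      exact hne (le_antisymm (h2 h') (h3 h))
  have hzero : ∀ i j, i < j → p i + p j = 0 → H = {v | v i = -v j} := by
    intro i j hij h0
    by_contra hne
    exact hpo ⟨{v | v i = -v j}, ⟨⟨i, j, hij, Or.inr rfl⟩, fun h => hne h.symm⟩,
      show p i = -p j by linarith⟩
  have hfs := posPairs_finite hs.1
  have hft := posPairs_finite ht.1
  by_cases hex : ∃ i j, i < j ∧ p i + p j = 0
  · obtain ⟨i, j, hij, h0⟩ := hex
    have hoff : ∀ q, q ≠ (i, j) → (q ∈ posPairs s ↔ q ∈ posPairs t) := by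
      rintro ⟨i', j'⟩ hq
      by_cases hij' : i' < j'
      · refine hsame i' j' hij' fun h => hq ?_
        exact sumHyperplane_injective hij' hij ((hzero i' j' hij' h).symm.trans (hzero i j hij h0))
      · exact iff_of_false (fun h => hij' h.1) (fun h => hij' h.1)
    have hns : (i, j) ∉ posPairs s := by
      intro hq
      have : posPairs t ⊆ posPairs s := by
        intro q hqt
        rcases eq_or_ne q (i, j) with rfl | hne
        · exact hq
        · exact (hoff q hne).2 hqt
      have := Set.ncard_le_ncard this hfs
      omega
    have hmt : (i, j) ∈ posPairs t := by
      by_contra hq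
      have : posPairs t ⊆ posPairs s := by
        intro q hqt
        rcases eq_or_ne q (i, j) with rfl | hne
        · exact absurd hqt hq
        · exact (hoff q hne).2 hqt
      have := Set.ncard_le_ncard this hfs
      omega
    refine ⟨(i, j), hns, Set.ext fun q => ?_⟩
    rw [Set.mem_insert_iff]
    rcases eq_or_ne q (i, j) with rfl | hne
    · exact iff_of_true hmt (Or.inl rfl)
    · rw [or_iff_right hne, hoff q hne]
  -- Here the wall is of the form v_i = v_j; the patterns agree, contrary to the lengths.
  · exfalso
    push Not at hex
    have : posPairs s = posPairs t := by
      ext ⟨i, j⟩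
      by_cases hij : i < j
      · exact hsame i j hij (hex i j hij)
      · exact iff_of_false (fun h => hij h.1) (fun h => hij h.1)
    rw [this] at hcard
    omega

theorem shareWall_of_posPairs_insert (hs : IsSignedSeq a s) (ht : IsSignedSeq b t) {q : ℕ × ℕ}
    (hq : q ∉ posPairs s) (h : posPairs t = insert q (posPairs s)) :
    ShareWall (alcoveOf s) (alcoveOf t) := by
  obtain ⟨i, j⟩ := q
  have hqt : (i, j) ∈ posPairs t := h ▸ Set.mem_insert _ _
  have hij : i < j := hqt.1
  have hα : (0 : ℝ) < t i + t j := by exact_mod_cast hqt.2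
  have hneg : ∀ {a : Set ℕ+} {s : ℕ → ℤ}, IsSignedSeq a s → ∀ i j : ℕ, i < j →
      (i, j) ∉ posPairs s → (s i : ℝ) + s j < 0 := by
    intro a s hs i j hij hq
    have h1 : s i + s j ≤ 0 := not_lt.1 fun h => hq ⟨hij, h⟩
    have := lt_of_le_of_ne h1 (hs.add_ne_zero i j)
    exact_mod_cast this
  have hβ : (0 : ℝ) < -((s i : ℝ) + s j) := neg_pos.2 (hneg hs i j hij hq)
  set α : ℝ := t i + t j
  set β : ℝ := -((s i : ℝ) + s j) with hβdef
  -- A positive combination of the two base points, with weights chosen so that the sum of the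
  -- entries i and j cancels. All other sums and all differences have common strict signs, so p is
  -- on no other hyperplane; normalization is unnecessary because the alcoves are cones.
  let p : ℕ → ℝ := fun k => α * s k + β * t k
  have hp0 : p i + p j = 0 := by
    simp only [p, α, hβdef]
    ring
  have hanti : StrictAnti p := by
    intro k k' hk
    have h1 := mul_pos hα (sub_pos.2 (hs.toReal_strictAnti hk))
    have h2 := mul_pos hβ (sub_pos.2 (ht.toReal_strictAnti hk))
    simp only [p, toReal] at *
    linarith
  have hsum : ∀ k k', k < k' → (k, k') ≠ (i, j) →
      ((k, k') ∈ posPairs s → 0 < p k + p k') ∧ ((k, k') ∉ posPairs s → p k + p k' < 0) := by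
    intro k k' hk hne
    have hiff : (k, k') ∈ posPairs t ↔ (k, k') ∈ posPairs s := by
      rw [h, Set.mem_insert_iff, or_iff_right hne]
    refine ⟨fun hk1 => ?_, fun hk1 => ?_⟩
    · have h1 : (0 : ℝ) < s k + s k' := by exact_mod_cast hk1.2
      have h2 : (0 : ℝ) < t k + t k' := by exact_mod_cast (hiff.2 hk1).2
      have h3 := mul_pos hα h1
      have h4 := mul_pos hβ h2
      simp only [p]
      linarith
    · have h1 := hneg hs k k' hk hk1
      have h2 := hneg ht k k' hk fun h => hk1 (hiff.1 h)
      have h3 := mul_neg_of_pos_of_neg hα h1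
      have h4 := mul_neg_of_pos_of_neg hβ h2
      simp only [p]
      linarith
  refine ⟨{v | v i = -v j}, ⟨i, j, hij, Or.inr rfl⟩, p, ⟨?_, ?_⟩, ?_, ?_⟩
  · rw [hs.mem_closure_iff]
    intro k k' hk
    refine ⟨(hanti hk).le, ?_⟩
    by_cases hne : (k, k') = (i, j)
    · rw [Prod.mk.injEq] at hne
      rw [hne.1, hne.2, hp0]
      exact ⟨fun _ => le_rfl, fun _ => le_rfl⟩
    · exact ⟨fun h' => ((hsum k k' hk hne).1 h').le, fun h' => ((hsum k k' hk hne).2 h').le⟩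
  · rw [ht.mem_closure_iff]
    intro k k' hk
    refine ⟨(hanti hk).le, ?_⟩
    by_cases hne : (k, k') = (i, j)
    · rw [Prod.mk.injEq] at hne
      rw [hne.1, hne.2, hp0]
      exact ⟨fun _ => le_rfl, fun _ => le_rfl⟩
    · rw [h, Set.mem_insert_iff, or_iff_right hne]
      exact ⟨fun h' => ((hsum k k' hk hne).1 h').le, fun h' => ((hsum k k' hk hne).2 h').le⟩
  · simp only [Set.mem_ofPred_eq]
    linarith
  · rintro ⟨H', ⟨⟨k, k', hk, rfl | rfl⟩, hne⟩, hp⟩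
    · exact (hanti hk).ne' hp
    · have hne' : (k, k') ≠ (i, j) := by
        intro he
        rw [Prod.mk.injEq] at he
        exact hne (by rw [he.1, he.2]; rfl)
      have h0 : p k + p k' = 0 := by
        have : p k = -p k' := hp
        linarith
      by_cases hk1 : (k, k') ∈ posPairs s
      · exact ((hsum k k' hk hne').1 hk1).ne' h0
      · exact ((hsum k k' hk hne').2 hk1).ne h0

/-- Adjacency of alcoves in terms of the subset graph. -/
theorem adj_alcoveOf_iff (hs : IsSignedSeq a s) (ht : IsSignedSeq b t) (ha : a ∈ evenSubsets)
    (hb : b ∈ evenSubsets) :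
    (ShareWall (alcoveOf s) (alcoveOf t) ∧
      alcoveLength (alcoveOf t) = alcoveLength (alcoveOf s) + 1) ↔ ∃ l, LabelledEdge l a b := by
  rw [hs.alcoveLength_eq, ht.alcoveLength_eq]
  constructor
  · rintro ⟨hw, hcard⟩
    obtain ⟨q, hq, h⟩ := exists_posPairs_insert_of_shareWall hs ht hw hcard
    exact labelledEdge_of_posPairs_insert hs ht ha hb hq h
  · intro h
    obtain ⟨i, j, -, -, hq, h⟩ := hs.exists_reflection ht h
    refine ⟨shareWall_of_posPairs_insert hs ht hq h, ?_⟩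
    rw [h, Set.ncard_insert_of_notMem hq (posPairs_finite hs.1)]

theorem alcoveOf_injective (hs : IsSignedSeq a s) (ht : IsSignedSeq b t) (ha : a ∈ evenSubsets)
    (hb : b ∈ evenSubsets) (h : alcoveOf s = alcoveOf t) : a = b := by
  refine eq_of_posPairs_eq hs ht ha hb (Set.ext fun ⟨i, j⟩ => ?_)
  by_cases hij : i < j
  · have h1 := hs.toReal_mem_alcoveOf
    have h2 := ((hs.mem_alcoveOf_iff.1 h1).2 i j hij).2
    rw [h] at h1
    exact h2.trans ((ht.mem_alcoveOf_iff.1 h1).2 i j hij).2.symm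
  · exact iff_of_false (fun h => hij h.1) (fun h => hij h.1)

/-! ### The block of the empty diagram for `δ = 2` -/

/-- The reason for choosing δ = 2: e_2(∅) = (-1, -2, -3, …) has no cancelling terms and uses every
positive magnitude once. -/
theorem dblSet_two_bot {z : ℤ} : z ∈ dblSet 2 ⊥ ↔ ∃ n : ℕ+, z = -(2 * (n : ℤ)) := by
  have hrow : ∀ i, (⊥ : YoungDiagram).rowLen i = 0 := fun i => by
    by_contra h
    have : (i, 0) ∈ (⊥ : YoungDiagram) :=
      YoungDiagram.mem_iff_lt_rowLen.2 (Nat.pos_of_ne_zero h)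
    exact YoungDiagram.notMem_bot _ this
  constructor
  · rintro ⟨i, rfl⟩
    refine ⟨i.succPNat, ?_⟩
    simp only [dbl, bead, hrow, Nat.succPNat_coe]
    push_cast
    ring
  · rintro ⟨n, rfl⟩
    refine ⟨n.natPred, ?_⟩
    have := PNat.natPred_add_one n
    simp only [dbl, bead, hrow]
    omega

theorem pairedMags_two_bot : pairedMags 2 ⊥ = ∅ := by
  ext k
  simp only [Set.mem_empty_iff_false, iff_false]
  rintro ⟨h0, h1, -⟩
  obtain ⟨n, hn⟩ := dblSet_two_bot.1 h1
  omega

theorem mem_singleMags_two_bot {k : ℕ} : k ∈ singleMags 2 ⊥ ↔ ∃ n : ℕ+, k = 2 * (n : ℕ) := by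
  simp only [singleMags, pairedMags_two_bot, Set.mem_empty_iff_false, not_false_eq_true, and_true,
    Set.mem_ofPred_eq, dblSet_two_bot]
  constructor
  · rintro (⟨n, hn⟩ | ⟨n, hn⟩)
    · have := n.pos
      omega
    · exact ⟨n, by omega⟩
  · rintro ⟨n, rfl⟩
    exact Or.inr ⟨n, by push_cast; rfl⟩

theorem place_singleMags_two_bot (n : ℕ+) : place (singleMags 2 ⊥) n = 2 * (n : ℕ) := by
  have hM := singleMags_infinite 2 ⊥
  have hmono : StrictMono fun n : ℕ+ => 2 * (n : ℕ) := fun n m h => by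
    have : (n : ℕ) < m := h
    simp only
    omega
  have hrange : Set.range (place (singleMags 2 ⊥)) = Set.range fun n : ℕ+ => 2 * (n : ℕ) := by
    ext k
    constructor
    · rintro ⟨n, rfl⟩
      obtain ⟨m, hm⟩ := mem_singleMags_two_bot.1 (place_mem hM n)
      exact ⟨m, hm.symm⟩
    · rintro ⟨m, rfl⟩
      exact exists_place_eq (mem_singleMags_two_bot.2 ⟨m, rfl⟩)
  exact congrFun (((place_strictMono hM).range_inj hmono).1 hrange) n

theorem untoggled_two_bot : untoggled 2 ⊥ = ∅ := by
  ext n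
  simp only [mem_untoggled_iff, Set.mem_empty_iff_false, iff_false, place_singleMags_two_bot]
  have := n.pos
  rw [mem_upMags_of_pos (by omega)]
  rintro ⟨-, h, -⟩
  obtain ⟨m, hm⟩ := dblSet_two_bot.1 h
  omega

/-- The sequence `e_2(μ)`, with integral entries. -/
def intSeq (μ : YoungDiagram) (i : ℕ) : ℤ := bead μ i - 1

theorem toReal_intSeq (μ : YoungDiagram) : toReal (intSeq μ) = eMap 2 μ := by
  funext i
  simp only [toReal, intSeq, bead, eMap]
  push_cast
  ring

variable {μ ν : YoungDiagram}

theorem even_untoggled_of_mem_block_two (h : μ ∈ block 2 ⊥) : untoggled 2 μ ∈ evenSubsets := by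
  refine ⟨untoggled_finite 2 μ, (mem_block_iff.1 h).2.1 ?_⟩
  rw [untoggled_two_bot]
  simp

theorem oMap_two_eq (h : μ ∈ block 2 ⊥) : oMap 2 μ = untoggled 2 μ := by
  rw [oMap, if_neg (Nat.not_odd_iff_even.2 (even_untoggled_of_mem_block_two h).2)]

/-- Since the core is that of ∅, nothing is removed by `regularize` and rank equals magnitude; the
doubled magnitude of rank n is 2n. -/
theorem isSignedSeq_intSeq (h : μ ∈ block 2 ⊥) : IsSignedSeq (untoggled 2 μ) (intSeq μ) := by
  obtain ⟨hp, hsm⟩ := (mem_block_iff.1 h).1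
  have hrange : ∀ z, z ∈ Set.range (intSeq μ) ↔ 2 * z ∈ dblSet 2 μ := by
    intro z
    refine exists_congr fun i => ?_
    simp only [intSeq, dbl]
    omega
  refine ⟨fun i j hij => ?_, fun i hi => ?_, fun n => ?_⟩
  · have := bead_strictAnti μ hij
    simp only [intSeq]
    omega
  · have h0 : (0 : ℤ) ∈ dblSet 2 μ := by
      have := (hrange 0).1 ⟨i, hi⟩
      simpa using this
    rw [← zero_mem_singleMags_iff, ← hsm, mem_singleMags_two_bot] at h0
    obtain ⟨n, hn⟩ := h0
    have := n.pos
    omega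
  · have hn := n.pos
    have h2n : 0 < 2 * (n : ℕ) := by omega
    have hsingle : 2 * (n : ℕ) ∈ singleMags 2 μ := hsm ▸ mem_singleMags_two_bot.2 ⟨n, rfl⟩
    have hU : n ∈ untoggled 2 μ ↔ 2 * (n : ℕ) ∈ posMags 2 μ := by
      rw [mem_untoggled_iff, ← hsm, place_singleMags_two_bot, mem_upMags_of_pos h2n]
    have e : (2 * (n : ℤ)) = ((2 * (n : ℕ) : ℕ) : ℤ) := by push_cast; rfl
    rw [hrange, hrange, mul_neg, e, coe_mem_dblSet_iff h2n, neg_coe_mem_dblSet_iff h2n, ← hp,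
      pairedMags_two_bot, hU]
    simp [hsingle]

/-- By induction along skews, each of which acts as one reflection (ij)_-. The minimal pattern {1}
is excluded by parity, so the induction starts at (-1, -2, -3, …). -/
theorem exists_groupD_apply (h : μ ∈ block 2 ⊥) :
    ∃ w ∈ groupD, w (toReal fun i => -((i : ℤ) + 1)) = toReal (intSeq μ) := by
  induction μ using skew_induction 2 with
  | base μ hμ =>
    have he := even_untoggled_of_mem_block_two h
    have hμ' : untoggled 2 μ = ∅ := by
      refine hμ.resolve_right fun h1 => ?_
      rw [h1] at he
      have := he.2
      simp at this
    have hs := isSignedSeq_intSeq h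
    rw [hμ'] at hs
    exact ⟨1, groupD.one_mem, by rw [isSignedSeq_empty.unique hs]; rfl⟩
  | step μ ν hskew ih =>
    have hμ : μ ∈ block 2 ⊥ := .trans _ _ _ h (.symm _ _ hskew.eqvGen)
    obtain ⟨w, hw, hwe⟩ := ih hμ
    obtain ⟨i, j, hij, ht, -, -⟩ := (isSignedSeq_intSeq hμ).exists_reflection (isSignedSeq_intSeq h)
      (isMinBalancedSkew_iff_labelledEdge.1 hskew).2
    refine ⟨reflMinus i j * w,
      groupD.mul_mem (Subgroup.subset_closure ⟨i, j, hij, Or.inr rfl⟩) hw, ?_⟩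
    rw [Equiv.Perm.mul_apply, hwe]
    funext k
    rw [reflMinus_apply]
    simp only [toReal, ht k]
    split_ifs <;> push_cast <;> rfl

theorem alcoveOf_intSeq_mem (h : μ ∈ block 2 ⊥) : alcoveOf (intSeq μ) ∈ dominantAlcoves := by
  have hs := isSignedSeq_intSeq h
  refine ⟨⟨_, hs.toReal_mem, rfl⟩, ?_, fun y hy => (hs.mem_alcoveOf_iff.1 hy).1⟩
  obtain ⟨w, hw, he⟩ := exists_groupD_apply h
  refine ⟨w, hw, ?_⟩
  rw [fundamentalAlcove_eq, alcoveOf, alcoveOf,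
    groupD_image_component hw isSignedSeq_empty.toReal_mem, he]

/-- The image of (-1, -2, -3, …) under w lies in A, so it is descending, and it is evenly signed. It
is thus the signed sequence of an even set, and that set comes from a diagram of the block. -/
theorem exists_alcoveOf_eq {A : Set (ℕ → ℝ)} (hA : A ∈ dominantAlcoves) :
    ∃ μ ∈ block 2 ⊥, alcoveOf (intSeq μ) = A := by
  obtain ⟨-, ⟨w, hw, hwA⟩, hsub⟩ := hA
  rw [fundamentalAlcove_eq, alcoveOf,
    groupD_image_component hw isSignedSeq_empty.toReal_mem] at hwA
  have hreg := (groupD_mem_regularPoints_iff hw _).2 isSignedSeq_empty.toReal_mem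
  have hanti : StrictAnti (w (toReal fun i => -((i : ℤ) + 1))) := by
    refine hsub ?_
    rw [hwA]
    exact mem_connectedComponentIn hreg
  obtain ⟨a, s, ha, hs, hv⟩ :=
    ((isEvenSigned_groupD_iff hw _).2 isEvenSigned_base).exists_isSignedSeq hanti
  obtain ⟨μ, hμ, rfl⟩ := (oMap_bijOn 2 ⊥).surjOn ha
  refine ⟨μ, hμ, ?_⟩
  rw [oMap_two_eq hμ] at hs
  rw [hwA, hv, alcoveOf, (isSignedSeq_intSeq hμ).unique hs]

/-- The block graph of the empty diagram for `δ = 2` is the graph of dominant alcoves. -/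
theorem exists_iso_graphAlc : ∃ Ξ : DigraphIso (blockGraph 2 ⊥) graphAlc,
    ∀ μ, eMap 2 μ ∈ (Ξ μ : Set (ℕ → ℝ)) := by
  let f : block 2 ⊥ → dominantAlcoves := fun μ => ⟨alcoveOf (intSeq μ), alcoveOf_intSeq_mem μ.2⟩
  have hf : Function.Bijective f := by
    constructor
    · intro μ ν h
      have h1 := alcoveOf_injective (isSignedSeq_intSeq μ.2) (isSignedSeq_intSeq ν.2)
        (even_untoggled_of_mem_block_two μ.2) (even_untoggled_of_mem_block_two ν.2)
        (congrArg Subtype.val h)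
      exact Subtype.ext (eq_of_sameCore_of_untoggled (sameCore_of_mem_block μ.2 ν.2) h1)
    · rintro ⟨A, hA⟩
      obtain ⟨μ, hμ, he⟩ := exists_alcoveOf_eq hA
      exact ⟨⟨μ, hμ⟩, Subtype.ext he⟩
  refine ⟨⟨Equiv.ofBijective f hf, ?_⟩, fun μ => ?_⟩
  · intro μ ν
    rw [adj_blockGraph_iff]
    exact adj_alcoveOf_iff (isSignedSeq_intSeq μ.2) (isSignedSeq_intSeq ν.2)
      (even_untoggled_of_mem_block_two μ.2) (even_untoggled_of_mem_block_two ν.2)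
  · rw [← toReal_intSeq]
    exact (isSignedSeq_intSeq μ.2).toReal_mem_alcoveOf

end BrauerBlock

/-! ### Assembly of the isomorphisms. -/

theorem mainTheorem2 :
    ∃ (T : BrauerBlock.DigraphIso BrauerBlock.graphOdd BrauerBlock.graphEven)
      (Θ : BrauerBlock.DigraphIso BrauerBlock.graphEven BrauerBlock.graphAlc),
      -- the toggle map is an isomorphism from `G_odd` to `G_even`
      (∀ a, (T a : Set ℕ+) = BrauerBlock.toggle a) ∧
      -- `G_even ≅ G_alc`: the alcove of `o_2(μ)`, `μ ∈ [∅]_2`, is the one containing `e_2(μ)`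
      (∀ μ ∈ BrauerBlock.block 2 ⊥, ∀ a : BrauerBlock.evenSubsets,
        (a : Set ℕ+) = BrauerBlock.oMap 2 μ →
          BrauerBlock.eMap 2 μ ∈ (Θ a : Set (ℕ → ℝ))) ∧
      (∀ (δ : ℤ) (lam : YoungDiagram),
        -- `o_δ` restricts to a bijection from the block onto the even subsets
        Set.BijOn (BrauerBlock.oMap δ) (BrauerBlock.block δ lam) BrauerBlock.evenSubsets ∧
        -- this bijection is an isomorphism `G_δ(λ) ≅ G_even`
        (∃ Φ : BrauerBlock.DigraphIso (BrauerBlock.blockGraph δ lam) BrauerBlock.graphEven,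
          (∀ ν : BrauerBlock.block δ lam, (Φ ν : Set ℕ+) = BrauerBlock.oMap δ ν) ∧
          -- no toggling is needed on the block of `λ` in the even case
          (Even (BrauerBlock.untoggled δ lam).ncard →
            ∀ ν : BrauerBlock.block δ lam, (Φ ν : Set ℕ+) = BrauerBlock.untoggled δ ν) ∧
          -- in the odd case it factors through `G_odd` and the toggle map
          (Odd (BrauerBlock.untoggled δ lam).ncard →
            ∃ Φ' : BrauerBlock.DigraphIso (BrauerBlock.blockGraph δ lam) BrauerBlock.graphOdd,
              (∀ ν : BrauerBlock.block δ lam, (Φ' ν : Set ℕ+) = BrauerBlock.untoggled δ ν) ∧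
              ∀ ν, Φ ν = T (Φ' ν))) ∧
        -- via `[∅]_2` the map `o_δ` passes to an isomorphism `G_δ(λ) ≅ G_alc`
        (∃ Ψ : BrauerBlock.DigraphIso (BrauerBlock.blockGraph δ lam) BrauerBlock.graphAlc,
          ∀ ν : BrauerBlock.block δ lam, ∃ μ ∈ BrauerBlock.block 2 ⊥,
            BrauerBlock.oMap 2 μ = BrauerBlock.oMap δ ν ∧
              BrauerBlock.eMap 2 μ ∈ (Ψ ν : Set (ℕ → ℝ)))) ∧
      -- all block graphs are isomorphic
      (∀ (δ δ' : ℤ) (lam lam' : YoungDiagram),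
        Nonempty (BrauerBlock.DigraphIso (BrauerBlock.blockGraph δ lam)
          (BrauerBlock.blockGraph δ' lam'))) := by
  obtain ⟨Φ₂, hΦ₂, -⟩ := BrauerBlock.exists_iso_oMap 2 ⊥
  obtain ⟨Ξ, hΞ⟩ := BrauerBlock.exists_iso_graphAlc
  -- G_even is matched with G_alc through the block of ∅ for δ = 2, where both isomorphisms are
  -- explicit.
  refine ⟨BrauerBlock.toggleIso, Φ₂.symm.trans Ξ, fun a => rfl, fun μ hμ a ha => ?_,
    fun δ lam => ⟨BrauerBlock.oMap_bijOn δ lam, BrauerBlock.exists_iso_oMap δ lam, ?_⟩,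
    fun δ δ' lam lam' => ?_⟩
  · have h1 : Φ₂ ⟨μ, hμ⟩ = a := Subtype.ext ((hΦ₂ ⟨μ, hμ⟩).trans ha.symm)
    have h2 : Φ₂.symm a = ⟨μ, hμ⟩ := by rw [← h1, RelIso.symm_apply_apply]
    rw [RelIso.trans_apply, h2]
    exact hΞ ⟨μ, hμ⟩
  · obtain ⟨Φ, hΦ, -⟩ := BrauerBlock.exists_iso_oMap δ lam
    refine ⟨Φ.trans (Φ₂.symm.trans Ξ), fun ν =>
      ⟨Φ₂.symm (Φ ν), (Φ₂.symm (Φ ν)).2, ?_, hΞ (Φ₂.symm (Φ ν))⟩⟩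
    rw [← hΦ₂, RelIso.apply_symm_apply, hΦ]
  · obtain ⟨Φ, -⟩ := BrauerBlock.exists_iso_oMap δ lam
    obtain ⟨Φ', -⟩ := BrauerBlock.exists_iso_oMap δ' lam'
    exact ⟨Φ.trans Φ'.symm⟩
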